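/- **Theorem (convergence of private tree-based online Frank–Wolfe for general convex losses, $\ell_p$ geometry, $1<p\le\infty$).** *Setting.* Let $d\ge1$, $n\ge3$, $1<p\le\infty$, $\frac1p+\frac1q=1$. Let $\mathcal C\subset\mathbb R^d$ be compact and convex with $0\in\mathcal C$ and $\ell_p$-diameter $D$, let $P$ be a probability distribution on $\mathcal X$, $f:\mathcal C\times\mathcal X\to\mathbb R$ a loss with gradient $\nabla f(\theta,x)$ in $\theta$, $F(\theta)=\mathbb E_{x\sim P}f(\theta,x)$ and $\theta^*\in\arg\min_{\mathcal C}F$. Assume that $F$ is convex on $\mathcal C$ and that for all $\theta,\theta'\in\mathcal C$, $x\in\mathcal X$ $$\|\nabla f(\theta,x)-\nabla f(\theta',x)\|_q\le\beta\|\theta-\theta'\|_p,\qquad \|\nabla f(\theta,x)-\nabla F(\theta)\|_q\le G,\qquad \|\nabla f(\theta,x)\|_q\le L .$$ *Regular norms.* A norm $N$ on $\mathbb R^d$ is $\kappa$-smooth if $N^2$ is differentiable and $N(x+y)^2\le N(x)^2+\langle\nabla (N^2)(x),y\rangle+\kappa N(y)^2$ for all $x,y$. The norm $\|\cdot\|_q$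 is $\kappa$-regular with associated norm $\|\cdot\|_+$ if for some $1\le\kappa_+\le\kappa$ the norm $\|\cdot\|_+$ is $\kappa_+$-smooth and $\|x\|_q^2\le\|x\|_+^2\le\frac{\kappa}{\kappa_+}\|x\|_q^2$ for all $x$. *Algorithm (DP-TOFW).* Let $\varepsilon>0$, $\delta\in(0,1)$, let $\|\cdot\|_q$ be $\kappa_q$-regular with associated norm $\|\cdot\|_+$, put $h=\lceil\log_2 n\rceil$ and $$\sigma_+^2=\frac{8(h+1)^2\,\kappa_q\log((h+1)/\delta)\,(\beta D+L)^2}{\varepsilon^2}.$$ Let $x_1,\dots,x_n$ be i.i.d. from $P$ and $\theta_0=\theta_1=0$. At step $t=1,\dots,n$ the vector $g_t=(t+1)\nabla f(\theta_t,x_t)-t\nabla f(\theta_{t-1},x_t)$ is added to all nodes on the path from the $t$-th leaf to the root of a complete binary tree with $2^h$ leaves (initially zero); each node on that path, from the leaf up to and including the first left child (the root counts as one), also receives an independent noise vector with density proportional to $\exp(-\|z\|_+^2/(2\sigma_+^2))$ (a point mass at $0$ if $\sigma_+=0$). The noisy partial sum $\tilde G_t$ is the sum, over the levels $i$ (leaves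 at level $0$) with $i$-th binary digit of $t$ equal to $1$, of the content of the level-$i$ node of the path if it is a left child, and of its left sibling otherwise. Then $$d_t=\tfrac1{t+1}\tilde G_t,\qquad v_t\in\arg\min_{v\in\mathcal C}\langle d_t,v\rangle,\qquad \theta_{t+1}=\theta_t+\tfrac1{t+1}(v_t-\theta_t),$$ where $v_t$ is a fixed measurable function of $d_t$. *Conclusion.* For every $\varepsilon_0>0$ there is a constant $C>0$, depending only on $\varepsilon_0$, such that whenever $0<\varepsilon\le\varepsilon_0$ and $0<\alpha<1$, the following hold. 1. For every such regularity structure $(\kappa_q,\|\cdot\|_+)$ of $\|\cdot\|_q$, with probability at least $1-\alpha$, for all $t\in\{1,\dots,n\}$ simultaneously, $$F(\theta_t)-F(\theta^*)\le C\left[\frac{D(\beta D+G)\big(\sqrt{\kappa_q}+\sqrt{\log(n/\alpha)}\big)}{\sqrt t}+\frac{(1+\log t)\big(\beta D^2+D\sigma_+\sqrt{d\log(\log n/\alpha)}\,\log n\big)}{t}\right].$$ 2. Let $m=\max\{2,\log d\}$. The norm $\|\cdot\|_q$ is $\kappa_q$-regular with associated norm $\|\cdot\|_+$ for the following choices. If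 $1<p\le2$: $\kappa_q=\min\{q-1,\,e^2(m-1)\}$ and $\|\cdot\|_+=\|\cdot\|_{q^+}$, where $q^+=q$ if $q-1\le e^2(m-1)$ and $q^+=m$ otherwise. If $2<p\le\infty$: $\kappa_q=d^{1-2/p}$ and $\|\cdot\|_+=d^{1/2-1/p}\|\cdot\|_2$. 3. With the choices in 2, with probability at least $1-\alpha$, for all $t\in\{1,\dots,n\}$ simultaneously, $$F(\theta_t)-F(\theta^*)\le C\,\sqrt{\kappa_q}\,D(\beta D+G+L)\,\log^4\!\Big(\frac{n}{\alpha\delta}\Big)\Big(\frac1{\sqrt t}+\frac{\sqrt d}{t\varepsilon}\Big)\qquad(1<p\le2),$$ that is, $\tilde O\big(\frac1{\sqrt t}+\frac{\sqrt d}{t\varepsilon}\big)$ for fixed $p$ (as $\kappa_q\le\frac1{p-1}$), and $$F(\theta_t)-F(\theta^*)\le C\,D(\beta D+G+L)\,\log^4\!\Big(\frac{n}{\alpha\delta}\Big)\Big(\frac{d^{1/2-1/p}}{\sqrt t}+\frac{d^{1-1/p}}{t\varepsilon}\Big)\qquad(2<p\le\infty).$$ -/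

import Mathlib

open MeasureTheory

/-- The `ℓ_p` norm on `ℝ^d`, `p ∈ [1, ∞]`. -/
noncomputable def ellNorm {d : ℕ} (p : ENNReal) (x : Fin d → ℝ) : ℝ :=
  ‖WithLp.toLp p x‖

/-- The diameter of `S ⊆ ℝ^d` in the `ℓ_p` norm. -/
noncomputable def ellDiam {d : ℕ} (p : ENNReal) (S : Set (Fin d → ℝ)) : ℝ :=
  sSup {r : ℝ | ∃ x ∈ S, ∃ y ∈ S, r = ellNorm p (x - y)}

/-- The linear functional `v ↦ ⟨u, v⟩` (standard inner product). -/
noncomputable def dotL {d : ℕ} (u : Fin d → ℝ) : (Fin d → ℝ) →L[ℝ] ℝ :=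
  ∑ i, u i • ContinuousLinearMap.proj (R := ℝ) (φ := fun _ : Fin d => ℝ) i

/-- `grad` is a gradient of `φ` at all points of `S` (derivative taken relative to `S`, so that
`φ` only has to be meaningful on `S`). -/
def IsGradientOn {d : ℕ} (S : Set (Fin d → ℝ)) (φ : (Fin d → ℝ) → ℝ)
    (grad : (Fin d → ℝ) → (Fin d → ℝ)) : Prop :=
  ∀ θ ∈ S, HasFDerivWithinAt φ (dotL (grad θ)) S θ

/-- `N` is a norm on `ℝ^d`. -/
structure IsNormFun {d : ℕ} (N : (Fin d → ℝ) → ℝ) : Prop where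
  add_le : ∀ x y, N (x + y) ≤ N x + N y
  smul : ∀ (a : ℝ) (x), N (a • x) = |a| * N x
  eq_zero : ∀ x, N x = 0 → x = 0

/-- The norm `N` is `κ`-smooth: `N²` is differentiable and
`N(x+y)² ≤ N(x)² + ⟨∇(N²)(x), y⟩ + κ N(y)²`. -/
def IsSmoothNorm {d : ℕ} (N : (Fin d → ℝ) → ℝ) (κ : ℝ) : Prop :=
  Differentiable ℝ (fun x => N x ^ 2) ∧
    ∀ x y, N (x + y) ^ 2 ≤ N x ^ 2 + fderiv ℝ (fun z => N z ^ 2) x y + κ * N y ^ 2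

/-- The norm `M` is `κ`-regular, with associated smooth norm `N`. -/
def IsRegularNorm {d : ℕ} (M N : (Fin d → ℝ) → ℝ) (κ : ℝ) : Prop :=
  IsNormFun N ∧ ∃ κ₁ : ℝ, 1 ≤ κ₁ ∧ κ₁ ≤ κ ∧ IsSmoothNorm N κ₁ ∧
    ∀ x, M x ^ 2 ≤ N x ^ 2 ∧ N x ^ 2 ≤ κ / κ₁ * M x ^ 2

/-- The regularity constant `κ_q` of the `ℓ_q` norm on `ℝ^d`, `1/p + 1/q = 1`. -/
noncomputable def kappaQ (d : ℕ) (p q : ENNReal) : ℝ :=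
  if p ≤ 2 then min (q.toReal - 1) (Real.exp 2 * (max 2 (Real.log d) - 1))
  else (d : ℝ) ^ (1 - 2 * p⁻¹.toReal)

/-- The smooth norm `‖·‖_{q,+}` associated with the `ℓ_q` norm on `ℝ^d`, `1/p + 1/q = 1`. -/
noncomputable def plusNorm (d : ℕ) (p q : ENNReal) (x : Fin d → ℝ) : ℝ :=
  if p ≤ 2 then
    if q.toReal - 1 ≤ Real.exp 2 * (max 2 (Real.log d) - 1) then ellNorm q x
    else ellNorm (ENNReal.ofReal (max 2 (Real.log d))) x
  else (d : ℝ) ^ (1 / 2 - p⁻¹.toReal) * ellNorm 2 x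

/-- The generalized Gaussian distribution `𝒢_N(0, σ²)`: density proportional to
`exp (-N(z)² / (2σ²))` with respect to Lebesgue measure; a point mass at `0` if `σ = 0`. -/
noncomputable def genGaussian {d : ℕ} (N : (Fin d → ℝ) → ℝ) (σ : ℝ) : Measure (Fin d → ℝ) :=
  if σ = 0 then Measure.dirac 0
  else
    (∫⁻ z : Fin d → ℝ, ENNReal.ofReal (Real.exp (-(N z ^ 2 / (2 * σ ^ 2)))))⁻¹ •
      (volume : Measure (Fin d → ℝ)).withDensity
        (fun z => ENNReal.ofReal (Real.exp (-(N z ^ 2 / (2 * σ ^ 2)))))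

/-- The noise level `σ_+` of the algorithm; `Nat.clog 2 n = ⌈log₂ n⌉`. -/
noncomputable def sigmaPlus (n : ℕ) (κ β D L ε δ : ℝ) : ℝ :=
  Real.sqrt (8 * ((Nat.clog 2 n : ℝ) + 1) ^ 2 * κ * Real.log (((Nat.clog 2 n : ℝ) + 1) / δ) *
    (β * D + L) ^ 2 / ε ^ 2)

/-! ### The tree-based aggregation protocol

The nodes of the complete binary tree with leaves `1, …, 2 ^ h` are the pairs `(ℓ, j)`, where
`ℓ ≤ h` is the height above the leaves; `(ℓ, j)` has the leaves `j * 2 ^ ℓ + 1, …, (j + 1) * 2 ^ ℓ`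
below it. A node is a left child iff `j` is even; the root `(h, 0)` counts as a left child. The
contents of the tree is a function `T ℓ j`. -/

/-- The node of height `ℓ` on the path from the leaf `t ≥ 1` to the root is
`(ℓ, pathIndex t ℓ)`. -/
def pathIndex (t ℓ : ℕ) : ℕ := (t - 1) / 2 ^ ℓ

/-- The node of height `ℓ` on the path of the leaf `t` is not above the first left child of that
path. -/
abbrev InNoisyPath (t ℓ : ℕ) : Prop := ∀ k < ℓ, ¬ Even (pathIndex t k)

/-- Insertion of the `t`-th stream element `g`: it is added to all nodes on the path of the leaf
`t`; the nodes up to the first left child on that path also receive fresh noise. -/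
def treeUpdate {V : Type*} [Add V] [Zero V] {h : ℕ} (t : ℕ) (g : V) (noise : Fin (h + 1) → V)
    (T : Fin (h + 1) → ℕ → V) : Fin (h + 1) → ℕ → V :=
  fun ℓ j =>
    if j = pathIndex t ℓ then T ℓ j + g + (if InNoisyPath t ℓ then noise ℓ else 0) else T ℓ j

/-- The noisy partial sum returned after the insertion of the `t`-th stream element. -/
def treeOutput {V : Type*} [AddCommMonoid V] {h : ℕ} (t : ℕ) (T : Fin (h + 1) → ℕ → V) : V :=
  ∑ ℓ : Fin (h + 1),
    if t.testBit ℓ then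
      if Even (pathIndex t ℓ) then T ℓ (pathIndex t ℓ) else T ℓ (pathIndex t ℓ - 1)
    else 0

/-- The state of the online Frank-Wolfe algorithm before step `t`: `θ_{t-1}`, `θ_t` and the
contents of the aggregation tree. -/
structure FWState (d h : ℕ) where
  prev : Fin d → ℝ
  cur : Fin d → ℝ
  tree : Fin (h + 1) → ℕ → (Fin d → ℝ)

/-- Step `t` of the algorithm with gradient `grad` of the loss and linear minimization oracle
`lmo`, on the sample `x` and the noise draws `noise`. -/
noncomputable def fwStep {d h : ℕ} {X : Type*} (grad : (Fin d → ℝ) → X → (Fin d → ℝ))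
    (lmo : (Fin d → ℝ) → (Fin d → ℝ)) (t : ℕ) (x : X) (noise : Fin (h + 1) → (Fin d → ℝ))
    (S : FWState d h) : FWState d h :=
  let g := ((t : ℝ) + 1) • grad S.cur x - (t : ℝ) • grad S.prev x
  let T := treeUpdate t g noise S.tree
  let dt := (1 / ((t : ℝ) + 1)) • treeOutput t T
  let v := lmo dt
  { prev := S.cur
    cur := S.cur + (1 / ((t : ℝ) + 1)) • (v - S.cur)
    tree := T }

/-- The state after `k` steps (`k ≤ n`), started at `θ_0 = θ_1 = 0` with an empty tree; `xs` are
the samples and `zs` the noise draws. -/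
noncomputable def fwRun {d n : ℕ} {X : Type*} (grad : (Fin d → ℝ) → X → (Fin d → ℝ))
    (lmo : (Fin d → ℝ) → (Fin d → ℝ)) (xs : Fin n → X)
    (zs : Fin n → Fin (Nat.clog 2 n + 1) → (Fin d → ℝ)) : ℕ → FWState d (Nat.clog 2 n)
  | 0 => { prev := 0, cur := 0, tree := fun _ _ => 0 }
  | k + 1 =>
    if hk : k < n then fwStep grad lmo (k + 1) (xs ⟨k, hk⟩) (zs ⟨k, hk⟩) (fwRun grad lmo xs zs k)
    else fwRun grad lmo xs zs k

/-- The iterate `θ_t`, `1 ≤ t ≤ n`. -/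
noncomputable def fwIterate {d n : ℕ} {X : Type*} (grad : (Fin d → ℝ) → X → (Fin d → ℝ))
    (lmo : (Fin d → ℝ) → (Fin d → ℝ)) (xs : Fin n → X)
    (zs : Fin n → Fin (Nat.clog 2 n + 1) → (Fin d → ℝ)) (t : ℕ) : Fin d → ℝ :=
  (fwRun grad lmo xs zs (t - 1)).cur

/-- `lmo` is a (measurable) linear minimization oracle over `S`:
`lmo u ∈ argmin_{v ∈ S} ⟨u, v⟩`. -/
def IsLinMinOracle {d : ℕ} (S : Set (Fin d → ℝ)) (lmo : (Fin d → ℝ) → (Fin d → ℝ)) : Prop :=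
  Measurable lmo ∧ ∀ u, lmo u ∈ S ∧ ∀ v ∈ S, dotL u (lmo u) ≤ dotL u v

/-- The joint law of `n` i.i.d. samples from `P` and of the noise draws, which are i.i.d. from
`𝒢_N(0, σ²)` and independent of the samples. -/
noncomputable def runLaw {d : ℕ} {X : Type*} [MeasurableSpace X] (n : ℕ) (P : Measure X)
    (N : (Fin d → ℝ) → ℝ) (σ : ℝ) :
    Measure ((Fin n → X) × (Fin n → Fin (Nat.clog 2 n + 1) → (Fin d → ℝ))) :=
  (Measure.pi fun _ => P).prod (Measure.pi fun _ => Measure.pi fun _ => genGaussian N σ)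

/-! The weights of the stream make its conditional means telescope: summing `(i+1)∇F(θ_i) -
i∇F(θ_{i-1})` over `1 ≤ i ≤ t` leaves `(t+1)∇F(θ_t) - ∇F(0)`. Hence `d_t` equals `∇F(θ_t)` up to
`1/(t+1)` times three errors: the fixed vector `∇F(0)`, of size at most `L`, a martingale with `t`
increments, and at most `h+1` privacy draws (`sum_streamElement`, `treeOutput_fwRun`).

Consecutive iterates satisfy `‖θ_t - θ_{t-1}‖_p ≤ D/t`, so smoothness bounds `t` times a gradient
difference by `βD` and the increments by `2(βD+G)`, uniformly in `t` (`streamNoise_le`). An Azuma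
inequality in a `κ`-regular norm bounds the martingale by order `(βD+G)√t(√κ + √log(n/α))`
(`IsBoundedMartingale.measure_gt_le`). It rests on a smooth surrogate of the norm, an infimal
convolution with the square of the companion norm (`exists_smooth_approx`), and on Hoeffding's lemma
for one increment at a time. The privacy draws are handled by an exponential moment of `N²`
(`measure_sum_noise_gt_le`). A union bound over `t ≤ n` makes all of this simultaneous
(`measure_goodRun`).

With gradient error `e_t ≤ (A√t + R)/(t+1)`, the Frank–Wolfe inequality multiplied by `t+1` becomes
a telescoping inequality for `t(F(θ_t) - F(θ*))`, whose sum is of order `A√t + R log t`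
(`frankWolfe_recursion`). Dividing by `t` gives the rate. The leftover terms in `L` disappear into
the noise term because `L ≤ εσ_+ ≤ ε₀σ_+`; this is how the constant comes to depend on `ε₀`.

The concrete regularity structures come from the `(q-1)`-smoothness of `‖·‖_q²` for `q ≥ 2` and from
comparing `ℓ_q` with `ℓ_m`, `m = max(2, log d)`, or with `ℓ_2`. -/

/-! ### The `ℓ_q` norms -/

section EllNorm

variable {d : ℕ}

theorem isNormFun_ellNorm {q : ENNReal} (hq : 1 ≤ q) : IsNormFun (ellNorm q : (Fin d → ℝ) → ℝ) := by
  have : Fact (1 ≤ q) := ⟨hq⟩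
  refine ⟨fun x y => ?_, fun a x => ?_, fun x hx => ?_⟩
  · simpa [ellNorm, WithLp.toLp_add] using norm_add_le (WithLp.toLp q x) (WithLp.toLp q y)
  · simpa [ellNorm, WithLp.toLp_smul] using norm_smul a (WithLp.toLp q x)
  · simpa [ellNorm] using hx

theorem continuous_ellNorm {q : ENNReal} (hq : 1 ≤ q) :
    Continuous (ellNorm q : (Fin d → ℝ) → ℝ) := by
  have : Fact (1 ≤ q) := ⟨hq⟩
  exact continuous_norm.comp (PiLp.continuous_toLp q (fun _ : Fin d => ℝ))

theorem abs_apply_le_ellNorm {q : ENNReal} (hq : 1 ≤ q) (x : Fin d → ℝ) (i : Fin d) :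
    |x i| ≤ ellNorm q x := by
  have : Fact (1 ≤ q) := ⟨hq⟩
  simpa [ellNorm] using PiLp.norm_apply_le (WithLp.toLp q x) i

theorem norm_le_ellNorm {q : ENNReal} (hq : 1 ≤ q) (x : Fin d → ℝ) : ‖x‖ ≤ ellNorm q x := by
  have : Fact (1 ≤ q) := ⟨hq⟩
  refine (pi_norm_le_iff_of_nonneg (norm_nonneg _)).2 fun i => abs_apply_le_ellNorm hq x i

theorem ellNorm_eq_sum {q : ENNReal} (hq : 1 ≤ q) (hq' : q ≠ ⊤) (x : Fin d → ℝ) :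
    ellNorm q x = (∑ i, |x i| ^ q.toReal) ^ (1 / q.toReal) := by
  have : 0 < q.toReal := ENNReal.toReal_pos (by positivity) hq'
  simp [ellNorm, PiLp.norm_eq_sum this]

theorem one_le_toReal {q : ENNReal} (hq : 1 ≤ q) (hq' : q ≠ ⊤) : 1 ≤ q.toReal := by
  simpa using ENNReal.toReal_mono hq' hq

theorem ellNorm_rpow {q : ENNReal} (hq : 1 ≤ q) (hq' : q ≠ ⊤) (x : Fin d → ℝ) :
    ellNorm q x ^ q.toReal = ∑ i, |x i| ^ q.toReal := by
  have h1 := one_le_toReal hq hq'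
  rw [ellNorm_eq_sum hq hq', ← Real.rpow_mul (Finset.sum_nonneg fun i _ => by positivity),
    one_div_mul_cancel (by linarith), Real.rpow_one]

theorem ellNorm_nonneg {q : ENNReal} (hq : 1 ≤ q) (x : Fin d → ℝ) : 0 ≤ ellNorm q x :=
  (norm_nonneg x).trans (norm_le_ellNorm hq x)

/-- Each coordinate is at most `‖x‖_r`, so `|x i| ^ q ≤ |x i| ^ r * ‖x‖_r ^ (q - r)`; then sum over
`i`. -/
theorem ellNorm_anti {r q : ENNReal} (hr : 1 ≤ r) (hrq : r ≤ q) (hq' : q ≠ ⊤) (x : Fin d → ℝ) :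
    ellNorm q x ≤ ellNorm r x := by
  have hr' : r ≠ ⊤ := ne_top_of_le_ne_top hq' hrq
  have h1 := one_le_toReal hr hr'
  have h2 := ENNReal.toReal_mono hq' hrq
  have hA := ellNorm_nonneg hr x
  refine (Real.rpow_le_rpow_iff (ellNorm_nonneg (hr.trans hrq) x) hA
    (by linarith : 0 < q.toReal)).1 ?_
  rw [ellNorm_rpow (hr.trans hrq) hq']
  have key : ∀ i, |x i| ^ q.toReal ≤ |x i| ^ r.toReal * ellNorm r x ^ (q.toReal - r.toReal) := by
    intro i
    have : |x i| ^ q.toReal = |x i| ^ r.toReal * |x i| ^ (q.toReal - r.toReal) := by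
      rw [← Real.rpow_add_of_nonneg (abs_nonneg _) (by linarith) (by linarith)]; congr 1; ring
    rw [this]
    exact mul_le_mul_of_nonneg_left (Real.rpow_le_rpow (abs_nonneg _)
      (abs_apply_le_ellNorm hr x i) (sub_nonneg.2 h2)) (by positivity)
  refine (Finset.sum_le_sum fun i _ => key i).trans_eq ?_
  rw [← Finset.sum_mul, ← ellNorm_rpow hr hr', ← Real.rpow_add_of_nonneg hA (by linarith)
    (by linarith)]
  congr 1; ring

/-- Power-mean inequality for the numbers `|x i| ^ r` with exponent `q / r ≥ 1`. -/
theorem ellNorm_le_dim_rpow_mul {r q : ENNReal} (hr : 1 ≤ r) (hrq : r ≤ q) (hq' : q ≠ ⊤)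
    (x : Fin d → ℝ) :
    ellNorm r x ≤ (d : ℝ) ^ (1 / r.toReal - 1 / q.toReal) * ellNorm q x := by
  have hr' : r ≠ ⊤ := ne_top_of_le_ne_top hq' hrq
  have h1 := one_le_toReal hr hr'
  have h2 := ENNReal.toReal_mono hq' hrq
  have hA := ellNorm_nonneg hr x
  have hB := ellNorm_nonneg (hr.trans hrq) x
  refine (Real.rpow_le_rpow_iff hA (by positivity) (by linarith : 0 < q.toReal)).1 ?_
  have h3 := Real.rpow_sum_le_const_mul_sum_rpow Finset.univ (fun i => |x i| ^ r.toReal)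
    (p := q.toReal / r.toReal) ((one_le_div (by linarith)).2 h2)
  have h4 : ∀ i, |(|x i| ^ r.toReal)| ^ (q.toReal / r.toReal) = |x i| ^ q.toReal := by
    intro i
    rw [abs_of_nonneg (by positivity), ← Real.rpow_mul (abs_nonneg _)]
    congr 1; field_simp
  simp only [h4] at h3
  simp only [abs_of_nonneg (Real.rpow_nonneg (abs_nonneg _) _), Finset.card_univ,
    Fintype.card_fin] at h3
  rw [← ellNorm_rpow hr hr', ← ellNorm_rpow (hr.trans hrq) hq', ← Real.rpow_mul hA] at h3
  rw [Real.mul_rpow (by positivity) hB, ← Real.rpow_mul (by positivity)]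
  have e1 : r.toReal * (q.toReal / r.toReal) = q.toReal := by field_simp
  have e2 : (1 / r.toReal - 1 / q.toReal) * q.toReal = q.toReal / r.toReal - 1 := by
    have : q.toReal ≠ 0 := by linarith
    field_simp
  rw [e2]; rwa [e1] at h3

theorem dotL_apply (u v : Fin d → ℝ) : dotL u v = ∑ i, u i * v i := by
  simp [dotL]

theorem abs_dotL_le {p q : ENNReal} (hp : 1 < p) (hpq : p⁻¹ + q⁻¹ = 1) (u v : Fin d → ℝ) :
    |dotL u v| ≤ ellNorm q u * ellNorm p v := by
  rw [dotL_apply]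
  refine (Finset.abs_sum_le_sum_abs _ _).trans ?_
  simp only [abs_mul]
  rcases eq_or_ne p ⊤ with rfl | hp'
  · have hq : q = 1 := by simpa using hpq
    subst hq
    rw [ellNorm_eq_sum le_rfl ENNReal.one_ne_top]
    simp only [ENNReal.toReal_one, Real.rpow_one, div_one, Finset.sum_mul]
    gcongr with i
    exact abs_apply_le_ellNorm le_top v i
  · have hq1 : 1 ≤ q := by
      rw [← ENNReal.inv_le_one, ← hpq]; exact le_add_self
    have hq' : q ≠ ⊤ := by
      rintro rfl
      simp at hpq
      exact hp.ne' (by simpa using hpq)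
    have hc : q.toReal.HolderConjugate p.toReal := by
      have h1 : 1 < p.toReal := by simpa using ENNReal.toReal_strict_mono hp' hp
      refine Real.HolderConjugate.symm ((Real.holderConjugate_iff).2 ⟨h1, ?_⟩)
      rw [← ENNReal.toReal_inv, ← ENNReal.toReal_inv, ← ENNReal.toReal_add, hpq, ENNReal.toReal_one]
      · exact ENNReal.inv_ne_top.2 (by positivity)
      · exact ENNReal.inv_ne_top.2 (by positivity)
    rw [ellNorm_eq_sum hq1 hq', ellNorm_eq_sum hp.le hp']
    simpa using Real.inner_le_Lp_mul_Lq Finset.univ (fun i => |u i|) (fun i => |v i|) hc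

theorem IsNormFun.zero {N : (Fin d → ℝ) → ℝ} (hN : IsNormFun N) : N 0 = 0 := by
  simpa using hN.smul 0 0

theorem IsNormFun.neg {N : (Fin d → ℝ) → ℝ} (hN : IsNormFun N) (x) : N (-x) = N x := by
  simpa using hN.smul (-1) x

theorem IsNormFun.nonneg {N : (Fin d → ℝ) → ℝ} (hN : IsNormFun N) (x) : 0 ≤ N x := by
  have := hN.add_le x (-x)
  rw [hN.neg, add_neg_cancel, hN.zero] at this
  linarith

theorem IsNormFun.sum_le {N : (Fin d → ℝ) → ℝ} (hN : IsNormFun N) {ι : Type*} (s : Finset ι)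
    (f : ι → Fin d → ℝ) : N (∑ i ∈ s, f i) ≤ ∑ i ∈ s, N (f i) :=
  Finset.le_sum_of_subadditive N hN.zero.le hN.add_le s f

theorem IsNormFun.exists_le_mul_norm {N : (Fin d → ℝ) → ℝ} (hN : IsNormFun N) :
    ∃ c, 0 ≤ c ∧ ∀ x, N x ≤ c * ‖x‖ := by
  refine ⟨∑ i, N (Pi.single i 1), Finset.sum_nonneg fun i _ => hN.nonneg _, fun x => ?_⟩
  have hx : x = ∑ i, x i • (Pi.single i 1 : Fin d → ℝ) := by
    ext j; simp [Finset.sum_apply, Pi.single_apply]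
  conv_lhs => rw [hx]
  refine (hN.sum_le _ _).trans ?_
  rw [Finset.sum_mul]
  gcongr with i
  rw [hN.smul, mul_comm]
  gcongr
  · exact hN.nonneg _
  · exact norm_le_pi_norm x i

theorem IsNormFun.sub_le {N : (Fin d → ℝ) → ℝ} (hN : IsNormFun N) (x y) : N x - N y ≤ N (x - y) := by
  have := hN.add_le (x - y) y
  rw [sub_add_cancel] at this; linarith

theorem IsNormFun.continuous {N : (Fin d → ℝ) → ℝ} (hN : IsNormFun N) : Continuous N := by
  obtain ⟨c, hc0, hc⟩ := hN.exists_le_mul_norm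
  have : LipschitzWith c.toNNReal N := by
    refine LipschitzWith.of_dist_le_mul fun x y => ?_
    rw [Real.dist_eq, dist_eq_norm, abs_le]
    have h1 := hN.sub_le x y
    have h2 := hN.sub_le y x
    have h3 := hc (x - y)
    have h4 := hN.neg (x - y)
    rw [neg_sub] at h4
    rw [Real.coe_toNNReal c hc0]
    constructor <;> linarith
  exact this.continuous

end EllNorm

/-! ### Smoothness of the square of the `ℓ_q` norm, `q ≥ 2` -/

/-- With `r = q - 2`, the function `|u| ^ r * u` is `1/q` times the derivative of `|u| ^ q`. This
supplies the second derivative of the power sum, valid also at vanishing coordinates and for `q =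
2`. -/
theorem hasDerivAt_abs_rpow_mul_self {r : ℝ} (hr : 0 ≤ r) (u : ℝ) :
    HasDerivAt (fun u : ℝ => |u| ^ r * u) ((r + 1) * |u| ^ r) u := by
  rcases hr.eq_or_lt with rfl | hr
  · simpa using hasDerivAt_id' u
  rcases eq_or_ne u 0 with rfl | hu
  · rw [abs_zero, Real.zero_rpow hr.ne', mul_zero, hasDerivAt_iff_tendsto_slope_zero]
    have : Filter.Tendsto (fun t : ℝ => |t| ^ r) (nhdsWithin 0 {0}ᶜ) (nhds 0) := by
      have hc : Continuous fun t : ℝ => |t| ^ r :=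
        continuous_abs.rpow_const fun _ => Or.inr hr.le
      have := hc.tendsto 0
      rw [abs_zero, Real.zero_rpow hr.ne'] at this
      exact this.mono_left nhdsWithin_le_nhds
    refine this.congr' ?_
    filter_upwards [self_mem_nhdsWithin] with t ht
    have : t ≠ 0 := ht
    simp; field_simp
  · have h1 : HasDerivAt (fun u : ℝ => |u| ^ r) (SignType.sign u * r * |u| ^ (r - 1)) u :=
      (hasDerivAt_abs hu).rpow_const (Or.inl (abs_ne_zero.2 hu))
    refine (h1.mul (hasDerivAt_id' u)).congr_deriv ?_
    have h2 : |u| ^ r = |u| ^ (r - 1) * |u| := by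
      rw [← Real.rpow_add_one (abs_ne_zero.2 hu)]; congr 1; ring
    have h3 : (SignType.sign u : ℝ) * u = |u| := by
      rcases lt_or_gt_of_ne hu with h | h
      · simp [h, abs_of_neg]
      · simp [h, abs_of_pos]
    rw [h2, mul_one]
    linear_combination (r * |u| ^ (r - 1)) * h3

theorem le_of_second_deriv_le {φ φ' φ'' : ℝ → ℝ} {c : ℝ} (h1 : ∀ s, HasDerivAt φ (φ' s) s)
    (h2 : ∀ s, HasDerivAt φ' (φ'' s) s) (h3 : ∀ s, φ'' s ≤ c) : φ 1 ≤ φ 0 + φ' 0 + c / 2 := by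
  have a1 : Antitone fun s => φ' s - c * s := by
    refine antitone_of_hasDerivAt_nonpos
      (fun s => (h2 s).sub ((hasDerivAt_id s).const_mul c)) fun s => ?_
    simpa using h3 s
  have a2 : AntitoneOn (fun s => φ s - φ' 0 * s - c / 2 * s ^ 2) (Set.Icc 0 1) := by
    have hd : ∀ s, HasDerivAt (fun s => φ s - φ' 0 * s - c / 2 * s ^ 2)
        (φ' s - φ' 0 - c * s) s := by
      intro s
      refine (((h1 s).sub ((hasDerivAt_id s).const_mul (φ' 0))).sub
        ((hasDerivAt_pow 2 s).const_mul (c / 2))).congr_deriv ?_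
      simp; ring
    refine antitoneOn_of_hasDerivWithinAt_nonpos (convex_Icc 0 1)
      (fun s _ => (hd s).continuousAt.continuousWithinAt)
      (fun s _ => (hd s).hasDerivWithinAt) fun s hs => ?_
    rw [interior_Icc] at hs
    have := a1 hs.1.le
    simp at this ⊢
    linarith
  have := a2 (by simp : (0 : ℝ) ∈ Set.Icc 0 1) (by simp : (1 : ℝ) ∈ Set.Icc 0 1) zero_le_one
  simp at this
  linarith

section Smooth

variable {d : ℕ}

theorem ellNorm_sq {q : ENNReal} (hq : 1 ≤ q) (hq' : q ≠ ⊤) (x : Fin d → ℝ) :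
    ellNorm q x ^ 2 = (∑ i, |x i| ^ q.toReal) ^ (2 / q.toReal) := by
  have h1 := one_le_toReal hq hq'
  rw [ellNorm_eq_sum hq hq', ← Real.rpow_natCast, ← Real.rpow_mul
    (Finset.sum_nonneg fun i _ => by positivity)]
  congr 1
  push_cast; ring

theorem sum_abs_rpow_pos {Q : ℝ} {x : Fin d → ℝ} (hx : x ≠ 0) : 0 < ∑ i, |x i| ^ Q := by
  obtain ⟨i, hi⟩ := Function.ne_iff.1 hx
  exact Finset.sum_pos' (fun j _ => by positivity)
    ⟨i, Finset.mem_univ _, Real.rpow_pos_of_pos (abs_pos.2 hi) _⟩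

theorem IsNormFun.hasFDerivAt_sq_zero {N : (Fin d → ℝ) → ℝ} (hN : IsNormFun N) :
    HasFDerivAt (fun x => N x ^ 2) (0 : (Fin d → ℝ) →L[ℝ] ℝ) 0 := by
  obtain ⟨c, hc0, hc⟩ := hN.exists_le_mul_norm
  rw [hasFDerivAt_iff_isLittleO_nhds_zero]
  simp only [zero_add, hN.zero, zero_apply, sub_zero]
  have h1 : (fun x => N x ^ 2) =O[nhds 0] fun x : Fin d → ℝ => ‖x‖ ^ 2 := by
    refine Asymptotics.IsBigO.of_bound (c ^ 2) (Filter.Eventually.of_forall fun x => ?_)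
    rw [Real.norm_of_nonneg (by positivity), Real.norm_of_nonneg (by positivity), ← mul_pow]
    exact pow_le_pow_left₀ (hN.nonneg x) (hc x) 2
  simp only [ne_eq, OfNat.ofNat_ne_zero, not_false_eq_true, zero_pow]
  simp only [sub_zero]
  exact h1.trans_isLittleO (Asymptotics.isLittleO_norm_pow_id one_lt_two)

theorem differentiable_ellNorm_sq {q : ENNReal} (hq : 1 < q) (hq' : q ≠ ⊤) :
    Differentiable ℝ fun x : Fin d → ℝ => ellNorm q x ^ 2 := by
  intro x
  rcases eq_or_ne x 0 with rfl | hx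
  · exact (isNormFun_ellNorm hq.le).hasFDerivAt_sq_zero.differentiableAt
  have h1 : 1 < q.toReal := by simpa using ENNReal.toReal_strict_mono hq' hq
  simp only [ellNorm_sq hq.le hq']
  refine DifferentiableAt.rpow_const ?_ (Or.inl (sum_abs_rpow_pos hx).ne')
  refine DifferentiableAt.fun_sum fun i _ => ?_
  have h2 : DifferentiableAt ℝ (fun z : Fin d → ℝ => z i) x := by fun_prop
  exact (hasDerivAt_abs_rpow (x i) h1).differentiableAt.comp x h2

/-- Second-order Taylor bound of the squared `ℓ_q` norm along a line that avoids the origin. -/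
theorem ellNorm_sq_add_le_of_line {q : ENNReal} (hq : 2 ≤ q) (hq' : q ≠ ⊤) (x y : Fin d → ℝ)
    (hxy : ∀ s : ℝ, x + s • y ≠ 0) :
    ∃ a, HasDerivAt (fun s : ℝ => ellNorm q (x + s • y) ^ 2) a 0 ∧
      ellNorm q (x + y) ^ 2 ≤ ellNorm q x ^ 2 + a + (q.toReal - 1) * ellNorm q y ^ 2 := by
  have hq1 : 1 ≤ q := one_le_two.trans hq
  have hQ : 2 ≤ q.toReal := by simpa using ENNReal.toReal_mono hq' hq
  set Q := q.toReal with hQdef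
  let T : ℝ → ℝ := fun s => ∑ i, |x i + s * y i| ^ Q
  let T' : ℝ → ℝ := fun s => ∑ i, Q * y i * (|x i + s * y i| ^ (Q - 2) * (x i + s * y i))
  let T'' : ℝ → ℝ := fun s => ∑ i, Q * y i * ((Q - 1) * |x i + s * y i| ^ (Q - 2) * y i)
  have hT : ∀ s, 0 < T s := fun s => sum_abs_rpow_pos (x := x + s • y) (hxy s)
  have hlin : ∀ i s, HasDerivAt (fun s : ℝ => x i + s * y i) (y i) s := fun i s => by
    simpa using ((hasDerivAt_id' s).mul_const (y i)).const_add (x i)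
  have dT : ∀ s, HasDerivAt T (T' s) s := fun s => by
    refine HasDerivAt.fun_sum fun i _ => ?_
    refine ((hasDerivAt_abs_rpow (x i + s * y i) (by linarith : 1 < Q)).comp s
      (hlin i s)).congr_deriv ?_
    ring
  have dT' : ∀ s, HasDerivAt T' (T'' s) s := fun s => by
    refine HasDerivAt.fun_sum fun i _ => HasDerivAt.const_mul _ ?_
    refine ((hasDerivAt_abs_rpow_mul_self (by linarith : 0 ≤ Q - 2) (x i + s * y i)).comp s
      (hlin i s)).congr_deriv ?_
    ring
  let φ : ℝ → ℝ := fun s => T s ^ (2 / Q)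
  let φ' : ℝ → ℝ := fun s => T' s * (2 / Q) * T s ^ (2 / Q - 1)
  let φ'' : ℝ → ℝ := fun s => T'' s * (2 / Q) * T s ^ (2 / Q - 1) +
    T' s * (2 / Q) * (T' s * (2 / Q - 1) * T s ^ (2 / Q - 1 - 1))
  have dφ : ∀ s, HasDerivAt φ (φ' s) s := fun s => (dT s).rpow_const (Or.inl (hT s).ne')
  have dφ' : ∀ s, HasDerivAt φ' (φ'' s) s := fun s =>
    ((dT' s).mul_const _).mul ((dT s).rpow_const (Or.inl (hT s).ne'))
  have hb : ∀ s, φ'' s ≤ 2 * ((Q - 1) * ellNorm q y ^ 2) := by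
    intro s
    have hQ2 : 2 / Q - 1 ≤ 0 := by
      rw [sub_nonpos, div_le_one (by linarith)]; exact hQ
    -- For `Q ≥ 2` the exponent `2 / Q - 1` is nonpositive, so the part of the second derivative
    -- quadratic in `T'` only helps and is dropped.
    have hneg : T' s * (2 / Q) * (T' s * (2 / Q - 1) * T s ^ (2 / Q - 1 - 1)) ≤ 0 := by
      have : 0 ≤ T' s ^ 2 * (2 / Q) * T s ^ (2 / Q - 1 - 1) := by
        have := (hT s).le; positivity
      nlinarith
    have hH : T'' s ≤ Q * (Q - 1) * (T s ^ (1 - 2 / Q) * ellNorm q y ^ 2) := by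
      have e : T'' s = Q * (Q - 1) * ∑ i, |x i + s * y i| ^ (Q - 2) * |y i| ^ 2 := by
        simp only [T'', Finset.mul_sum, sq_abs]
        refine Finset.sum_congr rfl fun i _ => ?_
        ring
      rw [e]
      refine mul_le_mul_of_nonneg_left ?_ (by nlinarith)
      -- Hölder with exponents `Q / (Q - 2)` and `Q / 2`; at `Q = 2` the first exponent degenerates,
      -- but both sides then agree.
      rcases hQ.eq_or_lt with h2 | h2
      · rw [ellNorm_sq hq1 hq', ← hQdef, ← h2]
        simp
      · have hc : (Q / (Q - 2)).HolderConjugate (Q / 2) := by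
          rw [Real.holderConjugate_iff]
          constructor
          · rw [one_lt_div (by linarith)]; linarith
          · field_simp; ring
        have := Real.inner_le_Lp_mul_Lq_of_nonneg Finset.univ
          (f := fun i => |x i + s * y i| ^ (Q - 2)) (g := fun i => |y i| ^ 2) hc
          (fun i _ => by positivity) (fun i _ => by positivity)
        refine this.trans_eq ?_
        rw [ellNorm_sq hq1 hq', ← hQdef]
        congr 1
        · have e1 : ∀ i, (|x i + s * y i| ^ (Q - 2)) ^ (Q / (Q - 2)) = |x i + s * y i| ^ Q := by
            intro i
            rw [← Real.rpow_mul (abs_nonneg _)]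
            congr 1
            have : Q - 2 ≠ 0 := by linarith
            field_simp
          simp only [e1]
          congr 1
          field_simp
        · have e2 : ∀ i, (|y i| ^ 2) ^ (Q / 2) = |y i| ^ Q := by
            intro i
            rw [← Real.rpow_natCast, ← Real.rpow_mul (abs_nonneg _)]
            congr 1
            push_cast; ring
          simp only [e2]
          congr 1
          field_simp
    have h1 : T'' s * (2 / Q) * T s ^ (2 / Q - 1) ≤ 2 * ((Q - 1) * ellNorm q y ^ 2) := by
      have h0 : T s ^ (1 - 2 / Q) * T s ^ (2 / Q - 1) = 1 := by
        rw [← Real.rpow_add (hT s)]; simp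
      have hp : 0 ≤ (2 / Q) * T s ^ (2 / Q - 1) := by
        have := (hT s).le; positivity
      calc T'' s * (2 / Q) * T s ^ (2 / Q - 1)
          = T'' s * ((2 / Q) * T s ^ (2 / Q - 1)) := by ring
        _ ≤ (Q * (Q - 1) * (T s ^ (1 - 2 / Q) * ellNorm q y ^ 2)) *
            ((2 / Q) * T s ^ (2 / Q - 1)) := mul_le_mul_of_nonneg_right hH hp
        _ = (Q * (2 / Q)) * (Q - 1) * ellNorm q y ^ 2 *
            (T s ^ (1 - 2 / Q) * T s ^ (2 / Q - 1)) := by ring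
        _ = 2 * ((Q - 1) * ellNorm q y ^ 2) := by
          rw [h0, mul_div_cancel₀ _ (by linarith : Q ≠ 0)]; ring
    simp only [φ'']
    linarith
  have hφ : ∀ s : ℝ, ellNorm q (x + s • y) ^ 2 = φ s := fun s => by
    rw [ellNorm_sq hq1 hq']; rfl
  refine ⟨φ' 0, ?_, ?_⟩
  · simp only [hφ]; exact dφ 0
  · have := le_of_second_deriv_le dφ dφ' hb
    rw [← hφ, ← hφ] at this
    simp only [one_smul, zero_smul, add_zero] at this
    linarith

theorem isSmoothNorm_ellNorm {q : ENNReal} (hq : 2 ≤ q) (hq' : q ≠ ⊤) :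
    IsSmoothNorm (ellNorm q : (Fin d → ℝ) → ℝ) (q.toReal - 1) := by
  have hq1 : 1 ≤ q := one_le_two.trans hq
  have hQ : 2 ≤ q.toReal := by simpa using ENNReal.toReal_mono hq' hq
  have hN := isNormFun_ellNorm (d := d) hq1
  have hdiff := differentiable_ellNorm_sq (d := d) (ENNReal.one_lt_two.trans_le hq) hq'
  refine ⟨hdiff, fun x y => ?_⟩
  have hline : HasDerivAt (fun s : ℝ => ellNorm q (x + s • y) ^ 2)
      (fderiv ℝ (fun z : Fin d → ℝ => ellNorm q z ^ 2) x y) 0 := by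
    have h1 : HasDerivAt (fun s : ℝ => x + s • y) y 0 := by
      simpa using ((hasDerivAt_id' (0 : ℝ)).smul_const y).const_add x
    have h2 : HasFDerivAt (fun z : Fin d → ℝ => ellNorm q z ^ 2)
        (fderiv ℝ (fun z : Fin d → ℝ => ellNorm q z ^ 2) x) (x + (0 : ℝ) • y) := by
      simpa using (hdiff x).hasFDerivAt
    exact h2.comp_hasDerivAt 0 h1
  by_cases hxy : ∀ s : ℝ, x + s • y ≠ 0
  · obtain ⟨a, ha, hle⟩ := ellNorm_sq_add_le_of_line hq hq' x y hxy
    rwa [hline.unique ha]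
  -- If the line meets the origin, `x` is a multiple of `y`, the squared norm along the line is the
  -- quadratic `(r - s) ^ 2 * ‖y‖ ^ 2`, and `1 ≤ q - 1` suffices.
  · push Not at hxy
    obtain ⟨s, hs⟩ := hxy
    have hx : x = (-s) • y := by rw [neg_smul]; exact eq_neg_of_add_eq_zero_left hs
    have hf : ∀ r : ℝ, ellNorm q (x + r • y) ^ 2 = (r - s) ^ 2 * ellNorm q y ^ 2 := by
      intro r
      rw [hx, ← add_smul, hN.smul, mul_pow, sq_abs]; ring
    have hd : HasDerivAt (fun r : ℝ => ellNorm q (x + r • y) ^ 2) (-2 * s * ellNorm q y ^ 2) 0 := by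
      simp only [hf]
      refine ((((hasDerivAt_id' (0 : ℝ)).sub_const s).pow 2).mul_const _).congr_deriv ?_
      simp
    rw [hline.unique hd]
    have e0 := hf 0
    have e1 := hf 1
    simp only [one_smul, zero_smul, add_zero] at e0 e1
    rw [e0, e1]
    nlinarith [sq_nonneg (ellNorm q y)]

theorem IsNormFun.const_mul {N : (Fin d → ℝ) → ℝ} (hN : IsNormFun N) {c : ℝ} (hc : 0 < c) :
    IsNormFun fun x => c * N x := by
  refine ⟨fun x y => ?_, fun a x => ?_, fun x hx => hN.eq_zero x ?_⟩
  · rw [← mul_add]; exact mul_le_mul_of_nonneg_left (hN.add_le x y) hc.le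
  · rw [hN.smul]; ring
  · simpa [hc.ne'] using hx

theorem IsSmoothNorm.const_mul {N : (Fin d → ℝ) → ℝ} {κ : ℝ} (hN : IsSmoothNorm N κ) (c : ℝ) :
    IsSmoothNorm (fun x => c * N x) κ := by
  have e : (fun x => (c * N x) ^ 2) = fun x => c ^ 2 * N x ^ 2 := by
    funext x; ring
  refine ⟨by rw [e]; exact hN.1.const_mul _, fun x y => ?_⟩
  rw [e, fderiv_const_mul (hN.1 x)]
  have := mul_le_mul_of_nonneg_left (hN.2 x y) (sq_nonneg c)
  simp only [smul_apply, smul_eq_mul]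
  nlinarith

theorem one_le_conj {p q : ENNReal} (hpq : p⁻¹ + q⁻¹ = 1) : 1 ≤ q := by
  rw [← ENNReal.inv_le_one, ← hpq]; exact le_add_self

theorem conj_ne_top {p q : ENNReal} (hp : 1 < p) (hpq : p⁻¹ + q⁻¹ = 1) : q ≠ ⊤ := by
  rintro rfl
  simp at hpq
  exact hp.ne' (by simpa using hpq)

theorem two_le_conj {p q : ENNReal} (hpq : p⁻¹ + q⁻¹ = 1) (hp2 : p ≤ 2) : 2 ≤ q := by
  by_contra! h
  have h1 : (2 : ENNReal)⁻¹ ≤ p⁻¹ := ENNReal.inv_le_inv.2 hp2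
  have h2 : (2 : ENNReal)⁻¹ < q⁻¹ := ENNReal.inv_lt_inv.2 h
  have := ENNReal.add_lt_add_of_le_of_lt (by simp) h1 h2
  rw [hpq, ENNReal.inv_two_add_inv_two] at this
  exact lt_irrefl _ this

theorem conj_le_two {p q : ENNReal} (hpq : p⁻¹ + q⁻¹ = 1) (hp2 : 2 < p) : q ≤ 2 := by
  by_contra! h
  have h1 : p⁻¹ < (2 : ENNReal)⁻¹ := ENNReal.inv_lt_inv.2 hp2
  have h2 : q⁻¹ < (2 : ENNReal)⁻¹ := ENNReal.inv_lt_inv.2 h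
  have := ENNReal.add_lt_add h1 h2
  rw [hpq, ENNReal.inv_two_add_inv_two] at this
  exact lt_irrefl _ this

/-- For large `q` the smoothness constant `q - 1` of `ℓ_q` is wasteful. Replacing `ℓ_q` by `ℓ_m`
with `m ≥ log d` costs only a factor `d ^ (1/m) ≤ e` in the norm, hence `e²` in its square. For `q ≤
2` the Euclidean norm has smoothness constant `1`, and the whole of `κ` is the distortion between
`ℓ_q` and `ℓ_2`. -/
theorem isRegularNorm_plusNorm {p q : ENNReal} (hd : 1 ≤ d) (hp : 1 < p) (hpq : p⁻¹ + q⁻¹ = 1) :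
    IsRegularNorm (ellNorm q : (Fin d → ℝ) → ℝ) (plusNorm d p q) (kappaQ d p q) := by
  have hq1 := one_le_conj hpq
  have hq' := conj_ne_top hp hpq
  have hd' : (1 : ℝ) ≤ d := by exact_mod_cast hd
  by_cases hp2 : p ≤ 2
  · have hq2 := two_le_conj hpq hp2
    have hQ : 2 ≤ q.toReal := by simpa using ENNReal.toReal_mono hq' hq2
    set m := max 2 (Real.log d) with hm
    have hm2 : 2 ≤ m := le_max_left _ _
    by_cases h : q.toReal - 1 ≤ Real.exp 2 * (m - 1)
    · have e1 : (plusNorm d p q : (Fin d → ℝ) → ℝ) = ellNorm q := by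
        funext x; simp [plusNorm, hp2, ← hm, h]
      have e2 : kappaQ d p q = q.toReal - 1 := by simp [kappaQ, hp2, ← hm, h]
      rw [e1, e2]
      refine ⟨isNormFun_ellNorm hq1, q.toReal - 1, by linarith, le_rfl,
        isSmoothNorm_ellNorm hq2 hq', fun x => ⟨le_rfl, ?_⟩⟩
      rw [div_self (by linarith), one_mul]
    · have e1 : (plusNorm d p q : (Fin d → ℝ) → ℝ) = ellNorm (ENNReal.ofReal m) := by
        funext x; simp [plusNorm, hp2, ← hm, h]
      have e2 : kappaQ d p q = Real.exp 2 * (m - 1) := by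
        simp [kappaQ, hp2, ← hm, (not_le.1 h).le]
      push Not at h
      have hexp : 1 ≤ Real.exp 2 := Real.one_le_exp (by norm_num)
      have hmq : m ≤ q.toReal := by nlinarith
      set r := ENNReal.ofReal m with hr
      have hr2 : 2 ≤ r := by
        rw [hr, ← ENNReal.ofReal_ofNat]; exact ENNReal.ofReal_le_ofReal hm2
      have hr1 : 1 ≤ r := one_le_two.trans hr2
      have hrq : r ≤ q := ENNReal.ofReal_le_of_le_toReal hmq
      have hrm : r.toReal = m := ENNReal.toReal_ofReal (by linarith)
      have hs := isSmoothNorm_ellNorm (d := d) hr2 (by simp [hr])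
      rw [hrm] at hs
      rw [e1, e2]
      refine ⟨isNormFun_ellNorm hr1, m - 1, by linarith, by nlinarith, hs, fun x => ⟨?_, ?_⟩⟩
      · exact pow_le_pow_left₀ (ellNorm_nonneg hq1 x) (ellNorm_anti hr1 hrq hq' x) 2
      · rw [mul_div_cancel_right₀ _ (by linarith)]
        have h1 := ellNorm_le_dim_rpow_mul hr1 hrq hq' x
        have h2 : (d : ℝ) ^ (1 / r.toReal - 1 / q.toReal) ≤ Real.exp 1 := by
          rw [Real.rpow_def_of_pos (by linarith), hrm]
          refine Real.exp_le_exp.2 ?_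
          have hlog : Real.log d ≤ m := le_max_right _ _
          have hlog0 : 0 ≤ Real.log d := Real.log_nonneg hd'
          have : 0 ≤ 1 / q.toReal := by positivity
          calc Real.log d * (1 / m - 1 / q.toReal) ≤ Real.log d * (1 / m) := by
                gcongr; linarith
            _ = Real.log d / m := by ring
            _ ≤ 1 := by rw [div_le_one (by linarith)]; exact hlog
        have h3 : ellNorm r x ≤ Real.exp 1 * ellNorm q x :=
          h1.trans (mul_le_mul_of_nonneg_right h2 (ellNorm_nonneg hq1 x))
        have h4 := pow_le_pow_left₀ (ellNorm_nonneg hr1 x) h3 2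
        rw [mul_pow, ← Real.exp_nat_mul] at h4
        simpa using h4
  · push Not at hp2
    have hq2 := conj_le_two hpq hp2
    set a := p⁻¹.toReal with ha
    have hab : a + 1 / q.toReal = 1 := by
      rw [one_div, ha, ← ENNReal.toReal_inv, ← ENNReal.toReal_add, hpq, ENNReal.toReal_one]
      · exact ENNReal.inv_ne_top.2 (by positivity)
      · exact ENNReal.inv_ne_top.2 (by positivity)
    have ha2 : a ≤ 1 / 2 := by
      have := ENNReal.toReal_mono (b := 2⁻¹) (by simp) (ENNReal.inv_le_inv.2 hp2.le)
      rw [ENNReal.toReal_inv 2] at this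
      simpa only [ENNReal.toReal_ofNat, one_div] using this
    have e1 : (plusNorm d p q : (Fin d → ℝ) → ℝ) = fun x => (d : ℝ) ^ (1 / 2 - a) * ellNorm 2 x := by
      funext x; simp [plusNorm, not_le.2 hp2, ← ha]
    have e2 : kappaQ d p q = (d : ℝ) ^ (1 - 2 * a) := by simp [kappaQ, not_le.2 hp2, ← ha]
    have hsm := isSmoothNorm_ellNorm (d := d) (le_refl (2 : ENNReal)) (by simp)
    have e3 : (2 : ENNReal).toReal - 1 = 1 := by simp; norm_num
    rw [e3] at hsm
    have hsq : ((d : ℝ) ^ (1 / 2 - a)) ^ 2 = (d : ℝ) ^ (1 - 2 * a) := by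
      rw [← Real.rpow_natCast, ← Real.rpow_mul (by positivity)]
      congr 1; push_cast; ring
    rw [e1, e2]
    refine ⟨(isNormFun_ellNorm one_le_two).const_mul (by positivity), 1, le_rfl,
      Real.one_le_rpow hd' (by linarith), hsm.const_mul _, fun x => ⟨?_, ?_⟩⟩
    · have h1 := ellNorm_le_dim_rpow_mul hq1 hq2 (by simp) x
      have e4 : 1 / q.toReal - 1 / (2 : ENNReal).toReal = 1 / 2 - a := by
        simp only [ENNReal.toReal_ofNat]; linarith
      rw [e4] at h1
      exact pow_le_pow_left₀ (ellNorm_nonneg hq1 x) h1 2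
    · rw [mul_pow, hsq, div_one]
      have := pow_le_pow_left₀ (ellNorm_nonneg one_le_two x) (ellNorm_anti hq1 hq2 (by simp) x) 2
      gcongr

end Smooth

/-! ### The contents of the aggregation tree -/

section Tree

variable {V : Type*} [AddCommGroup V] {h : ℕ}

/-- The tree after the insertion of the first `k` elements of the stream `g`. -/
def treeRun (g : ℕ → V) (noise : ℕ → Fin (h + 1) → V) : ℕ → Fin (h + 1) → ℕ → V
  | 0 => fun _ _ => 0
  | k + 1 => treeUpdate (k + 1) (g k) (noise k) (treeRun g noise k)

/-- All nodes below height `ℓ` on the path are right children exactly when the leaf is the last one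
under the node of height `ℓ`. Thus a node receives noise precisely when its block is completed, and
only once. -/
theorem inNoisyPath_succ_iff (t ℓ : ℕ) : InNoisyPath (t + 1) ℓ ↔ 2 ^ ℓ ∣ t + 1 := by
  induction ℓ with
  | zero => simp [InNoisyPath]
  | succ ℓ ih =>
    have h1 : InNoisyPath (t + 1) (ℓ + 1) ↔ InNoisyPath (t + 1) ℓ ∧ ¬ Even (t / 2 ^ ℓ) := by
      simp only [InNoisyPath, Nat.lt_succ_iff_lt_or_eq, pathIndex, Nat.add_sub_cancel]
      constructor
      · exact fun hk => ⟨fun k hkl => hk k (Or.inl hkl), hk ℓ (Or.inr rfl)⟩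
      · rintro ⟨h1, h2⟩ k (hk | rfl)
        exacts [h1 k hk, h2]
    rw [h1, ih]
    have key : ∀ c, t + 1 = 2 ^ ℓ * c → t / 2 ^ ℓ = c - 1 ∧ 1 ≤ c := by
      intro c hc
      have hc1 : 1 ≤ c := by
        rcases Nat.eq_zero_or_pos c with rfl | h'
        · simp at hc
        · exact h'
      refine ⟨?_, hc1⟩
      obtain ⟨e, rfl⟩ := Nat.exists_eq_add_of_le' hc1
      have hpos : 0 < 2 ^ ℓ := by positivity
      rw [Nat.add_sub_cancel]
      refine Nat.div_eq_of_lt_le ?_ ?_ <;> nlinarith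
    constructor
    · rintro ⟨⟨c, hc⟩, ho⟩
      obtain ⟨h2, h3⟩ := key c hc
      rw [h2, Nat.not_even_iff_odd] at ho
      obtain ⟨b, hb⟩ := ho
      refine ⟨b + 1, ?_⟩
      rw [hc, show c = 2 * (b + 1) by omega, pow_succ]; ring
    · rintro ⟨c, hc⟩
      have hc' : t + 1 = 2 ^ ℓ * (2 * c) := by rw [hc, pow_succ]; ring
      obtain ⟨h2, h3⟩ := key _ hc'
      refine ⟨⟨_, hc'⟩, ?_⟩
      rw [h2, Nat.not_even_iff_odd]
      exact ⟨c - 1, by omega⟩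

/-- Invariant of the tree: a node holds the part of its block inserted so far, written as a
difference of prefix sums, and carries noise once the block is full. -/
theorem treeRun_apply (g : ℕ → V) (noise : ℕ → Fin (h + 1) → V) (t : ℕ) (ℓ : Fin (h + 1)) (j : ℕ) :
    treeRun g noise t ℓ j =
      ∑ i ∈ Finset.range (min t ((j + 1) * 2 ^ (ℓ : ℕ))), g i -
        ∑ i ∈ Finset.range (min t (j * 2 ^ (ℓ : ℕ))), g i +
      if (j + 1) * 2 ^ (ℓ : ℕ) ≤ t then noise ((j + 1) * 2 ^ (ℓ : ℕ) - 1) ℓ else 0 := by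
  have hpos : 0 < 2 ^ (ℓ : ℕ) := by positivity
  induction t with
  | zero =>
    have : ¬ (j + 1) * 2 ^ (ℓ : ℕ) ≤ 0 := by
      have : 0 < (j + 1) * 2 ^ (ℓ : ℕ) := by positivity
      omega
    simp [treeRun]
  | succ t ih =>
    have hj : (j + 1) * 2 ^ (ℓ : ℕ) = j * 2 ^ (ℓ : ℕ) + 2 ^ (ℓ : ℕ) := by ring
    simp only [treeRun, treeUpdate, pathIndex, Nat.add_sub_cancel, ih]
    have hdiv : j = t / 2 ^ (ℓ : ℕ) ↔ j * 2 ^ (ℓ : ℕ) ≤ t ∧ t < (j + 1) * 2 ^ (ℓ : ℕ) := by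
      rw [eq_comm, Nat.div_eq_iff hpos]
      omega
    generalize hA : (j + 1) * 2 ^ (ℓ : ℕ) = a at *
    generalize hB : j * 2 ^ (ℓ : ℕ) = b at *
    -- Here `a` and `b` are the right and left ends of the block of the node. The node is touched at
    -- time `t + 1` exactly when `b ≤ t < a`; otherwise both truncated prefix sums do not move or
    -- move together.
    by_cases h1 : j = t / 2 ^ (ℓ : ℕ)
    · obtain ⟨hb, ha⟩ := hdiv.1 h1
      have hn : InNoisyPath (t + 1) ℓ ↔ a = t + 1 := by
        rw [inNoisyPath_succ_iff]
        constructor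
        · rintro ⟨c, hc⟩
          have h2 : j < c := by
            by_contra! hle
            have := Nat.mul_le_mul_right (2 ^ (ℓ : ℕ)) hle
            rw [mul_comm c, ← hc] at this
            omega
          have := Nat.mul_le_mul_right (2 ^ (ℓ : ℕ)) (Nat.succ_le_of_lt h2)
          rw [mul_comm c, ← hc, Nat.succ_eq_add_one, hA] at this
          omega
        · rintro h2
          exact ⟨j + 1, by rw [← h2, ← hA, mul_comm]⟩
      have hle : a ≤ t + 1 ↔ a = t + 1 := by omega
      rw [if_pos h1, if_neg (by omega : ¬ a ≤ t), min_eq_left ha.le,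
        min_eq_left (by omega : t + 1 ≤ a), min_eq_right hb, min_eq_right (by omega : b ≤ t + 1), Finset.sum_range_succ, add_zero]
      simp only [hn, hle]
      by_cases h2 : a = t + 1
      · simp only [h2, if_true, Nat.add_sub_cancel]; abel
      · simp only [h2, if_false]; abel
    · rw [if_neg h1]
      rcases lt_or_ge t b with h2 | h2
      · rw [if_neg (by omega : ¬ a ≤ t), if_neg (by omega : ¬ a ≤ t + 1), 
          min_eq_left (by omega : t ≤ a), min_eq_left (by omega : t ≤ b),
          min_eq_left (by omega : t + 1 ≤ a), min_eq_left (by omega : t + 1 ≤ b)]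
        simp
      · have ha : a ≤ t := by
          by_contra! h3
          exact h1 (hdiv.2 ⟨h2, h3⟩)
        rw [if_pos ha, if_pos (by omega : a ≤ t + 1), min_eq_right ha, min_eq_right h2,
          min_eq_right (by omega : a ≤ t + 1), min_eq_right (by omega : b ≤ t + 1)]

/-- When bit `ℓ` of `t` is set, `t / 2 ^ ℓ` is odd. The left child on the path or the left sibling,
whichever the output reads, is therefore always the node of index `t / 2 ^ ℓ - 1`, whose block is
complete. -/
theorem pathIndex_of_testBit {t ℓ : ℕ} (hb : t.testBit ℓ) :
    (Even (pathIndex t ℓ) → pathIndex t ℓ = t / 2 ^ ℓ - 1) ∧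
      (¬ Even (pathIndex t ℓ) → pathIndex t ℓ = t / 2 ^ ℓ) := by
  have hodd : t / 2 ^ ℓ % 2 = 1 := by
    simpa [Nat.testBit_eq_decide_div_mod_eq] using hb
  have hpos : 0 < 2 ^ ℓ := by positivity
  have h1 : pathIndex t ℓ = t / 2 ^ ℓ ∨ pathIndex t ℓ = t / 2 ^ ℓ - 1 := by
    unfold pathIndex
    have h2 : (t - 1) / 2 ^ ℓ ≤ t / 2 ^ ℓ := Nat.div_le_div_right (Nat.sub_le _ _)
    have h3 : t / 2 ^ ℓ ≤ (t - 1) / 2 ^ ℓ + 1 := by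
      rw [← Nat.add_div_right _ hpos]
      exact Nat.div_le_div_right (by omega)
    generalize t / 2 ^ ℓ = x at *
    generalize (t - 1) / 2 ^ ℓ = y at *
    omega
  generalize t / 2 ^ ℓ = x at *
  rw [Nat.even_iff]
  rcases h1 with h1 | h1 <;> rw [h1] <;> omega

theorem treeOutput_eq_sum {t : ℕ} (T : Fin (h + 1) → ℕ → V) :
    treeOutput t T = ∑ ℓ : Fin (h + 1),
      if t.testBit ℓ then T ℓ (t / 2 ^ (ℓ : ℕ) - 1) else 0 := by
  refine Finset.sum_congr rfl fun ℓ _ => ?_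
  split_ifs with h1 h2
  · rw [(pathIndex_of_testBit h1).1 h2]
  · rw [(pathIndex_of_testBit h1).2 h2]
  · rfl

/-- The blocks of the binary expansion of `t` are adjacent: rounding `t` down to a multiple of `2 ^
(ℓ + 1)` removes one block of length `2 ^ ℓ` if bit `ℓ` is set and nothing otherwise. -/
theorem sum_range_dyadic (A : ℕ → V) (t H : ℕ) :
    ∑ ℓ ∈ Finset.range H, (if t.testBit ℓ then
      A (t / 2 ^ ℓ * 2 ^ ℓ) - A ((t / 2 ^ ℓ - 1) * 2 ^ ℓ) else 0) =
      A t - A (t / 2 ^ H * 2 ^ H) := by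
  induction H with
  | zero => simp
  | succ H ih =>
    rw [Finset.sum_range_succ, ih]
    have hd : t / 2 ^ (H + 1) = t / 2 ^ H / 2 := by rw [pow_succ, Nat.div_div_eq_div_mul]
    have hb : t.testBit H = decide (t / 2 ^ H % 2 = 1) := Nat.testBit_eq_decide_div_mod_eq
    by_cases hodd : t / 2 ^ H % 2 = 1
    · have e : t / 2 ^ (H + 1) * 2 ^ (H + 1) = (t / 2 ^ H - 1) * 2 ^ H := by
        rw [hd, pow_succ, mul_comm (2 ^ H), ← mul_assoc]
        congr 1; omega
      simp [hb, hodd, e]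
    · have e : t / 2 ^ (H + 1) * 2 ^ (H + 1) = t / 2 ^ H * 2 ^ H := by
        rw [hd, pow_succ, mul_comm (2 ^ H), ← mul_assoc]
        congr 1; omega
      simp [hb, hodd, e]

theorem treeOutput_treeRun (g : ℕ → V) (noise : ℕ → Fin (h + 1) → V) {t : ℕ} (ht : t < 2 ^ (h + 1)) :
    treeOutput t (treeRun g noise t) = ∑ i ∈ Finset.range t, g i +
      ∑ ℓ : Fin (h + 1), if t.testBit ℓ then noise (t / 2 ^ (ℓ : ℕ) * 2 ^ (ℓ : ℕ) - 1) ℓ else 0 := by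
  have hd := sum_range_dyadic (fun k => ∑ i ∈ Finset.range k, g i) t (h + 1)
  -- The levels `0, …, h` see every bit of `t < 2 ^ (h + 1)`, so the part left after rounding down
  -- is empty.
  simp only [Nat.div_eq_of_lt ht, zero_mul, Finset.range_zero, Finset.sum_empty, sub_zero] at hd
  rw [treeOutput_eq_sum, ← hd, Finset.sum_range fun ℓ => _, ← Finset.sum_add_distrib]
  refine Finset.sum_congr rfl fun ℓ _ => ?_
  by_cases hb : t.testBit ℓ
  · have hodd : t / 2 ^ (ℓ : ℕ) % 2 = 1 := by
      simpa [Nat.testBit_eq_decide_div_mod_eq] using hb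
    have h1 : t / 2 ^ (ℓ : ℕ) - 1 + 1 = t / 2 ^ (ℓ : ℕ) := by
      generalize t / 2 ^ (ℓ : ℕ) = x at *
      omega
    have h2 : t / 2 ^ (ℓ : ℕ) * 2 ^ (ℓ : ℕ) ≤ t := Nat.div_mul_le_self _ _
    have h3 : (t / 2 ^ (ℓ : ℕ) - 1) * 2 ^ (ℓ : ℕ) ≤ t :=
      (Nat.mul_le_mul_right _ (Nat.sub_le _ _)).trans h2
    simp only [hb, if_true, treeRun_apply, h1, h2, min_eq_right h2, min_eq_right h3]
  · simp [hb]

end Tree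

/-! ### The generalized Gaussian distribution -/

section Gaussian

theorem lintegral_pi_prod_eq_prod {ι : Type*} [Fintype ι] {Ω : ι → Type*}
    [∀ i, MeasurableSpace (Ω i)] (μ : ∀ i, Measure (Ω i)) [∀ i, IsProbabilityMeasure (μ i)]
    {f : ∀ i, Ω i → ENNReal} (hf : ∀ i, Measurable (f i)) :
    ∫⁻ x, ∏ i, f i (x i) ∂Measure.pi μ = ∏ i, ∫⁻ x, f i x ∂μ i := by
  rw [ProbabilityTheory.lintegral_prod_eq_prod_lintegral_of_indepFun Finset.univ
    (fun i (x : ∀ i, Ω i) => f i (x i))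
    (ProbabilityTheory.iIndepFun_pi fun i => (hf i).aemeasurable)
    fun i => (hf i).comp (measurable_pi_apply i)]
  refine Finset.prod_congr rfl fun i _ => ?_
  exact (measurePreserving_eval μ i).lintegral_comp (hf i)

variable {d : ℕ} {N : (Fin d → ℝ) → ℝ}

/-- The normalizing constant of the generalized Gaussian distribution. -/
noncomputable def gaussMass {d : ℕ} (N : (Fin d → ℝ) → ℝ) (s : ℝ) : ENNReal :=
  ∫⁻ z : Fin d → ℝ, ENNReal.ofReal (Real.exp (-(N z ^ 2 / (2 * s ^ 2))))

theorem measurable_gaussDensity (hN : IsNormFun N) (s : ℝ) :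
    Measurable fun z => ENNReal.ofReal (Real.exp (-(N z ^ 2 / (2 * s ^ 2)))) := by
  have := hN.continuous.measurable
  fun_prop

theorem gaussMass_ne_top (hle : ∀ z, ‖z‖ ≤ N z) {s : ℝ} (hs : s ≠ 0) :
    gaussMass N s ≠ ⊤ := by
  have hs2 : 0 < s ^ 2 := by positivity
  -- Comparison with a product Gaussian, through `∑ z_i² ≤ d N(z)²`; `d + 1` in place of `d` keeps
  -- `b` meaningful when `d = 0`.
  set b : ℝ := 1 / (2 * s ^ 2 * (d + 1)) with hb
  have hb0 : 0 < b := by positivity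
  have hint : Integrable (fun z : Fin d → ℝ => ∏ i, Real.exp (-b * z i ^ 2)) := by
    rw [volume_pi]
    exact Integrable.fintype_prod fun _ => integrable_exp_neg_mul_sq hb0
  refine ((lintegral_mono fun z => ?_).trans_lt hint.lintegral_lt_top).ne
  refine ENNReal.ofReal_le_ofReal ?_
  rw [← Real.exp_sum]
  refine Real.exp_le_exp.2 ?_
  have h1 : ∑ i, z i ^ 2 ≤ (d + 1) * N z ^ 2 := by
    calc ∑ i, z i ^ 2 ≤ ∑ _i : Fin d, N z ^ 2 := by
          refine Finset.sum_le_sum fun i _ => ?_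
          rw [← sq_abs]
          exact pow_le_pow_left₀ (abs_nonneg _) ((norm_le_pi_norm z i).trans (hle z)) 2
      _ = d * N z ^ 2 := by simp
      _ ≤ (d + 1) * N z ^ 2 := by nlinarith [sq_nonneg (N z)]
  rw [← Finset.mul_sum, neg_mul, neg_le_neg_iff]
  calc b * ∑ i, z i ^ 2 ≤ b * ((d + 1) * N z ^ 2) := by gcongr
    _ = N z ^ 2 / (2 * s ^ 2) := by
      rw [hb]; field_simp

theorem gaussMass_ne_zero (hN : IsNormFun N) (s : ℝ) : gaussMass N s ≠ 0 := by
  unfold gaussMass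
  rw [Ne, lintegral_eq_zero_iff (measurable_gaussDensity hN s)]
  intro h
  have h2 : ∀ᵐ _ : Fin d → ℝ, False := by
    filter_upwards [h] with z hz
    have := Real.exp_pos (-(N z ^ 2 / (2 * s ^ 2)))
    simp only [Pi.zero_apply, ENNReal.ofReal_eq_zero] at hz
    linarith
  have : (ae (volume : Measure (Fin d → ℝ))).NeBot := inferInstance
  exact Filter.eventually_false_iff_eq_bot.1 h2 |> this.ne

theorem gaussMass_mul (hN : IsNormFun N) {r : ℝ} (hr : 0 < r) (s : ℝ) :
    gaussMass N (r * s) = ENNReal.ofReal (r ^ d) * gaussMass N s := by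
  have hm := measurable_gaussDensity hN s
  have h1 : gaussMass N (r * s) =
      ∫⁻ z : Fin d → ℝ, ENNReal.ofReal (Real.exp (-(N (r⁻¹ • z) ^ 2 / (2 * s ^ 2)))) := by
    refine lintegral_congr fun z => ?_
    have h2 : (r⁻¹ * N z) ^ 2 / (2 * s ^ 2) = N z ^ 2 / (2 * (r * s) ^ 2) := by
      rw [mul_pow, mul_pow, inv_pow]
      field_simp
    rw [hN.smul, abs_of_pos (inv_pos.2 hr), h2]
  rw [h1, ← lintegral_map hm (measurable_const_smul r⁻¹),
    Measure.map_addHaar_smul _ (inv_ne_zero hr.ne'), lintegral_smul_measure, smul_eq_mul,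
    Module.finrank_fin_fun, inv_pow, inv_inv, abs_of_pos (by positivity)]
  rfl

theorem genGaussian_of_ne_zero {s : ℝ} (hs : s ≠ 0) :
    genGaussian N s = (gaussMass N s)⁻¹ • (volume : Measure (Fin d → ℝ)).withDensity
      (fun z => ENNReal.ofReal (Real.exp (-(N z ^ 2 / (2 * s ^ 2))))) := by
  simp only [genGaussian, hs, if_false]; rfl

theorem isProbabilityMeasure_genGaussian (hN : IsNormFun N) (hle : ∀ z, ‖z‖ ≤ N z) (s : ℝ) :
    IsProbabilityMeasure (genGaussian N s) := by
  by_cases hs : s = 0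
  · simp only [genGaussian, hs, if_true]; infer_instance
  · constructor
    rw [genGaussian_of_ne_zero hs, Measure.smul_apply, withDensity_apply _ MeasurableSet.univ,
      Measure.restrict_univ, smul_eq_mul]
    exact ENNReal.inv_mul_cancel (gaussMass_ne_zero hN s) (gaussMass_ne_top hle hs)

/-- Tilting by `exp(N²/(4s²))` turns the density of scale `s` into the one of scale `√2 s`. The
ratio of the normalizing constants is `√2 ^ d`, by homogeneity of `N`, whatever the norm. -/
theorem lintegral_exp_sq_genGaussian_le (hN : IsNormFun N) (hle : ∀ z, ‖z‖ ≤ N z) {s : ℝ}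
    (hs : s ≠ 0) :
    ∫⁻ z, ENNReal.ofReal (Real.exp (N z ^ 2 / (4 * s ^ 2))) ∂genGaussian N s ≤
      ENNReal.ofReal (Real.exp d) := by
  have hm : Measurable fun z => ENNReal.ofReal (Real.exp (N z ^ 2 / (4 * s ^ 2))) := by
    have := hN.continuous.measurable
    fun_prop
  have h2 : (0 : ℝ) < √2 := by positivity
  rw [genGaussian_of_ne_zero hs, lintegral_smul_measure,
    lintegral_withDensity_eq_lintegral_mul _ (measurable_gaussDensity hN s) hm, smul_eq_mul]
  have h1 : ∫⁻ z, ((fun z => ENNReal.ofReal (Real.exp (-(N z ^ 2 / (2 * s ^ 2))))) *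
      fun z => ENNReal.ofReal (Real.exp (N z ^ 2 / (4 * s ^ 2)))) z = gaussMass N (√2 * s) := by
    refine lintegral_congr fun z => ?_
    rw [Pi.mul_apply, ← ENNReal.ofReal_mul (Real.exp_pos _).le, ← Real.exp_add]
    congr 2
    rw [mul_pow, Real.sq_sqrt zero_le_two]
    field_simp
    ring
  rw [h1, gaussMass_mul hN h2, mul_left_comm,
    ENNReal.inv_mul_cancel (gaussMass_ne_zero hN s) (gaussMass_ne_top hle hs), mul_one]
  refine ENNReal.ofReal_le_ofReal ?_
  have h3 : √2 ≤ Real.exp 1 := by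
    have : √2 ≤ 2 := by rw [Real.sqrt_le_left (by norm_num)]; norm_num
    have := Real.add_one_le_exp (1 : ℝ)
    linarith
  calc √2 ^ d ≤ Real.exp 1 ^ d := pow_le_pow_left₀ h2.le h3 d
    _ = Real.exp d := by rw [← Real.exp_nat_mul]; simp

/-- Tail bound for the sum of the norms of finitely many distinct noise draws. -/
theorem measure_sum_noise_gt_le (hN : IsNormFun N) (hle : ∀ z, ‖z‖ ≤ N z) {s : ℝ} (hs : 0 ≤ s)
    {ι κ : Type*} [Fintype ι] [Fintype κ] [DecidableEq ι] [DecidableEq κ] (S : Finset κ)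
    (τ : κ → ι) {c u : ℝ} (hc : (S.card : ℝ) ≤ c) (hu : 0 ≤ u) :
    (Measure.pi fun _ : ι => Measure.pi fun _ : κ => genGaussian N s)
      {zs | 2 * s * √(c * (d * c + u)) < ∑ ℓ ∈ S, N (zs (τ ℓ) ℓ)} ≤
      ENNReal.ofReal (Real.exp (-u)) := by
  have hprob := isProbabilityMeasure_genGaussian hN hle s
  have hc0 : 0 ≤ c := (Nat.cast_nonneg _).trans hc
  have hdc : 0 ≤ d * c + u := by positivity
  rcases hs.eq_or_lt with rfl | hs
  · have h0 : ∀ᵐ zs ∂(Measure.pi fun _ : ι => Measure.pi fun _ : κ => genGaussian N 0),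
        ∀ ℓ, zs (τ ℓ) ℓ = 0 := by
      refine Filter.eventually_all.2 fun ℓ => ?_
      have h1 : ∀ᵐ z ∂(genGaussian N 0), z = 0 := by
        simp [genGaussian, ae_dirac_eq]
      have h2 : ∀ᵐ w ∂(Measure.pi fun _ : κ => genGaussian N 0), w ℓ = 0 :=
        (Measure.tendsto_eval_ae_ae (μ := fun _ : κ => genGaussian N 0) (i := ℓ)).eventually h1
      exact (Measure.tendsto_eval_ae_ae (μ := fun _ : ι => Measure.pi fun _ : κ =>
        genGaussian N 0) (i := τ ℓ)).eventually h2
    refine le_trans (le_of_eq ?_) zero_le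
    rw [measure_eq_zero_iff_ae_notMem]
    filter_upwards [h0] with zs hzs
    simp [hzs, hN.zero]
  let φ : (Fin d → ℝ) → ENNReal := fun z => ENNReal.ofReal (Real.exp (N z ^ 2 / (4 * s ^ 2)))
  have hφ : Measurable φ := by
    have := hN.continuous.measurable
    fun_prop
  -- Only the coordinates `(τ ℓ, ℓ)` with `ℓ ∈ S` enter. They are distinct because the `ℓ` are, so
  -- the product measure factorizes the exponential moment without any condition on `τ`.
  let F : ι → κ → (Fin d → ℝ) → ENNReal := fun i ℓ z => if ℓ ∈ S ∧ i = τ ℓ then φ z else 1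
  have hF : ∀ i ℓ, Measurable (F i ℓ) := by
    intro i ℓ
    by_cases h : ℓ ∈ S ∧ i = τ ℓ
    · simpa [F, h] using hφ
    · simp [F, h]
  have hprod : ∀ zs : ι → κ → Fin d → ℝ,
      ∏ i, ∏ ℓ, F i ℓ (zs i ℓ) = ENNReal.ofReal (Real.exp ((∑ ℓ ∈ S, N (zs (τ ℓ) ℓ) ^ 2) /
        (4 * s ^ 2))) := by
    intro zs
    rw [Finset.prod_comm, Finset.sum_div, Real.exp_sum,
      ENNReal.ofReal_prod_of_nonneg fun _ _ => (Real.exp_pos _).le, ← Finset.prod_subset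
      (Finset.subset_univ S)]
    · refine Finset.prod_congr rfl fun ℓ hℓ => ?_
      rw [Finset.prod_eq_single (τ ℓ)]
      · simp [F, hℓ, φ]
      · intro i _ hi; simp [F, hi]
      · simp
    · intro ℓ _ hℓ
      simp [F, hℓ]
  have hint : ∫⁻ zs, ∏ i, ∏ ℓ, F i ℓ (zs i ℓ)
      ∂(Measure.pi fun _ : ι => Measure.pi fun _ : κ => genGaussian N s) ≤
      ENNReal.ofReal (Real.exp (d * c)) := by
    rw [lintegral_pi_prod_eq_prod (fun _ : ι => Measure.pi fun _ : κ => genGaussian N s)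
      (f := fun i w => ∏ ℓ, F i ℓ (w ℓ))
      fun i => Finset.measurable_prod _ fun ℓ _ => (hF i ℓ).comp (measurable_pi_apply ℓ)]
    have h1 : ∀ i, ∫⁻ w, ∏ ℓ, F i ℓ (w ℓ) ∂(Measure.pi fun _ : κ => genGaussian N s) =
        ∏ ℓ, ∫⁻ z, F i ℓ z ∂genGaussian N s := fun i =>
      lintegral_pi_prod_eq_prod (fun _ : κ => genGaussian N s) (hF i)
    simp only [h1]
    rw [Finset.prod_comm, ← Finset.prod_subset (Finset.subset_univ S)]
    · calc ∏ ℓ ∈ S, ∏ i, ∫⁻ z, F i ℓ z ∂genGaussian N s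
          ≤ ∏ _ℓ ∈ S, ENNReal.ofReal (Real.exp d) := by
            refine Finset.prod_le_prod' fun ℓ hℓ => ?_
            rw [Finset.prod_eq_single (τ ℓ)]
            · simp only [F, hℓ, true_and, if_true]
              exact lintegral_exp_sq_genGaussian_le hN hle hs.ne'
            · intro i _ hi; simp [F, hi]
            · simp
        _ ≤ ENNReal.ofReal (Real.exp (d * c)) := by
            rw [Finset.prod_const, ← ENNReal.ofReal_pow (Real.exp_pos _).le, ← Real.exp_nat_mul]
            refine ENNReal.ofReal_le_ofReal (Real.exp_le_exp.2 ?_)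
            rw [mul_comm]
            gcongr
    · intro ℓ _ hℓ
      simp [F, hℓ]
  have hsub : {zs : ι → κ → Fin d → ℝ | 2 * s * √(c * (d * c + u)) < ∑ ℓ ∈ S, N (zs (τ ℓ) ℓ)} ⊆
      {zs | ENNReal.ofReal (Real.exp (d * c + u)) ≤ ∏ i, ∏ ℓ, F i ℓ (zs i ℓ)} := by
    intro zs hzs
    rw [Set.mem_ofPred_eq] at hzs ⊢
    rw [hprod]
    refine ENNReal.ofReal_le_ofReal (Real.exp_le_exp.2 ?_)
    rw [le_div_iff₀ (by positivity)]
    -- By Cauchy–Schwarz over at most `c` terms, a large sum of norms forces `∑ N² > 4s²(dc + u)`.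
    -- Markov's inequality then compares `exp(dc + u)` with the moment bound `exp(dc)`.
    have h1 : (2 * s * √(c * (d * c + u))) ^ 2 < (∑ ℓ ∈ S, N (zs (τ ℓ) ℓ)) ^ 2 :=
      pow_lt_pow_left₀ hzs (by positivity) two_ne_zero
    rw [mul_pow, Real.sq_sqrt (by positivity)] at h1
    have h2 := sq_sum_le_card_mul_sum_sq (s := S) (f := fun ℓ => N (zs (τ ℓ) ℓ))
    have h3 : 0 ≤ ∑ ℓ ∈ S, N (zs (τ ℓ) ℓ) ^ 2 := Finset.sum_nonneg fun _ _ => sq_nonneg _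
    have h4 : c * ((d * c + u) * (4 * s ^ 2)) < c * ∑ ℓ ∈ S, N (zs (τ ℓ) ℓ) ^ 2 := by
      have := mul_le_mul_of_nonneg_right hc h3
      nlinarith
    exact (lt_of_mul_lt_mul_left h4 hc0).le
  have hmk := mul_meas_ge_le_lintegral₀ (μ := Measure.pi fun _ : ι => Measure.pi fun _ : κ =>
      genGaussian N s) (f := fun zs => ∏ i, ∏ ℓ, F i ℓ (zs i ℓ)) (by
    refine (Finset.measurable_prod _ fun i _ => Finset.measurable_prod _ fun ℓ _ => ?_).aemeasurable
    exact (hF i ℓ).comp ((measurable_pi_apply ℓ).comp (measurable_pi_apply i)))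
    (ENNReal.ofReal (Real.exp (d * c + u)))
  have hfin := (mul_le_mul_right (measure_mono hsub) _).trans (hmk.trans hint)
  have he : ENNReal.ofReal (Real.exp (d * c)) =
      ENNReal.ofReal (Real.exp (d * c + u)) * ENNReal.ofReal (Real.exp (-u)) := by
    rw [← ENNReal.ofReal_mul (Real.exp_pos _).le, ← Real.exp_add]
    congr 2; ring
  rw [he] at hfin
  exact (ENNReal.mul_le_mul_iff_right (by simp [Real.exp_pos]) ENNReal.ofReal_ne_top).1 hfin

end Gaussian

/-! ### Concentration of vector-valued martingales -/

section Martingale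

variable {d : ℕ}

/-- A regular norm is approximated by a smooth function, the infimal convolution of the norm with
the square of its smooth companion. -/
theorem exists_smooth_approx {M N : (Fin d → ℝ) → ℝ} {κ γ : ℝ} (hM : IsNormFun M)
    (hle : ∀ z, ‖z‖ ≤ M z) (hreg : IsRegularNorm M N κ) (hγ : 0 < γ) :
    ∃ v : (Fin d → ℝ) → ℝ, Continuous v ∧ v 0 = 0 ∧ (∀ x, M x ≤ v x + γ / 2) ∧
      ∀ x, ∃ ℓ : (Fin d → ℝ) →L[ℝ] ℝ, (∀ y, |ℓ y| ≤ M y) ∧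
        ∀ y, v (x + y) ≤ v x + ℓ y + κ / (2 * γ) * M y ^ 2 := by
  obtain ⟨hN, κ₁, hκ₁, -, ⟨-, hsm⟩, hMN⟩ := hreg
  -- The surrogate is `v x = min_z M (x - z) + N z ² / (2γ)`; the minimum is attained because `J x`
  -- is continuous and coercive. It is 1-Lipschitz for `M` and inherits a quadratic upper bound from
  -- `N²` by moving the minimizer along with `x`.
  let J : (Fin d → ℝ) → (Fin d → ℝ) → ℝ := fun x z => M (x - z) + N z ^ 2 / (2 * γ)
  have hJc : ∀ x, Continuous (J x) := fun x => by
    have h1 := hM.continuous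
    have h2 := hN.continuous
    fun_prop
  have hcoer : ∀ x, Filter.Tendsto (J x) (Filter.cocompact _) Filter.atTop := by
    intro x
    refine Filter.tendsto_atTop_mono (f := fun z => ‖z‖ + -M x) (fun z => ?_)
      (Filter.tendsto_atTop_add_const_right _ _ (tendsto_norm_cocompact_atTop (E := Fin d → ℝ)))
    have h1 := hM.sub_le z x
    have h2 : M (z - x) = M (x - z) := by rw [← hM.neg, neg_sub]
    have h3 := hle z
    have h4 : 0 ≤ N z ^ 2 / (2 * γ) := by positivity
    simp only [J]
    linarith
  choose m hm using fun x => (hJc x).exists_forall_le (hcoer x)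
  let v : (Fin d → ℝ) → ℝ := fun x => J x (m x)
  have hv_le : ∀ x z, v x ≤ M (x - z) + N z ^ 2 / (2 * γ) := hm
  have hv_lip : ∀ x y, v (x + y) ≤ v x + M y := by
    intro x y
    have h1 := hv_le (x + y) (m x)
    have h2 := hM.add_le (x - m x) y
    rw [show x - m x + y = x + y - m x by abel] at h2
    have h3 : v x = M (x - m x) + N (m x) ^ 2 / (2 * γ) := rfl
    linarith
  have hsmooth : ∀ x, ∃ ℓ : (Fin d → ℝ) →L[ℝ] ℝ,
      ∀ y, v (x + y) ≤ v x + ℓ y + κ / (2 * γ) * M y ^ 2 := by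
    intro x
    refine ⟨(1 / (2 * γ)) • fderiv ℝ (fun z => N z ^ 2) (m x), fun y => ?_⟩
    have h1 := hv_le (x + y) (m x + y)
    rw [add_sub_add_right_eq_sub] at h1
    have h2 := hsm (m x) y
    have h3 : v x = M (x - m x) + N (m x) ^ 2 / (2 * γ) := rfl
    have h4 : κ₁ * N y ^ 2 ≤ κ * M y ^ 2 := by
      have := mul_le_mul_of_nonneg_left (hMN y).2 (by linarith : 0 ≤ κ₁)
      rwa [← mul_assoc, mul_div_cancel₀ _ (by linarith)] at this
    have h5 : N (m x + y) ^ 2 / (2 * γ) ≤ N (m x) ^ 2 / (2 * γ) +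
        1 / (2 * γ) * fderiv ℝ (fun z => N z ^ 2) (m x) y + κ / (2 * γ) * M y ^ 2 := by
      have e : N (m x) ^ 2 / (2 * γ) + 1 / (2 * γ) * fderiv ℝ (fun z => N z ^ 2) (m x) y +
          κ / (2 * γ) * M y ^ 2 = (N (m x) ^ 2 + fderiv ℝ (fun z => N z ^ 2) (m x) y +
            κ * M y ^ 2) / (2 * γ) := by ring
      rw [e]
      gcongr
      linarith
    simp only [smul_apply, smul_eq_mul]
    linarith
  refine ⟨v, ?_, ?_, fun x => ?_, fun x => ?_⟩
  · obtain ⟨c, hc0, hc⟩ := hM.exists_le_mul_norm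
    have : LipschitzWith c.toNNReal v := by
      refine LipschitzWith.of_dist_le_mul fun x y => ?_
      rw [Real.dist_eq, dist_eq_norm, abs_le, Real.coe_toNNReal c hc0]
      have h1 := hv_lip x (y - x)
      have h2 := hv_lip y (x - y)
      rw [add_sub_cancel] at h1 h2
      have h3 := hc (x - y)
      have h4 := hM.neg (x - y)
      rw [neg_sub] at h4
      constructor <;> linarith
    exact this.continuous
  · refine le_antisymm ?_ ?_
    · simpa [hM.zero, hN.zero] using hv_le 0 0
    · have h1 := hM.nonneg (0 - m 0)
      have h2 : 0 ≤ N (m 0) ^ 2 / (2 * γ) := by positivity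
      exact add_nonneg h1 h2
  · have h1 := hM.add_le (x - m x) (m x)
    rw [sub_add_cancel] at h1
    have h3 : v x = M (x - m x) + N (m x) ^ 2 / (2 * γ) := rfl
    -- Young's inequality `a ≤ a²/(2γ) + γ/2`, after `M ≤ N`.
    have h4 : M (m x) ≤ N (m x) ^ 2 / (2 * γ) + γ / 2 := by
      have h5 : M (m x) ^ 2 / (2 * γ) ≤ N (m x) ^ 2 / (2 * γ) := by
        exact div_le_div_of_nonneg_right (hMN (m x)).1 (by positivity)
      have h6 : M (m x) ≤ M (m x) ^ 2 / (2 * γ) + γ / 2 := by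
        have : M (m x) ^ 2 / (2 * γ) + γ / 2 - M (m x) = (M (m x) - γ) ^ 2 / (2 * γ) := by
          field_simp; ring
        have : 0 ≤ (M (m x) - γ) ^ 2 / (2 * γ) := by positivity
        linarith
      linarith
    linarith
  · obtain ⟨ℓ, hℓ⟩ := hsmooth x
    -- The Lipschitz bound gives `-M(sy) ≤ v(x + sy) - v(x)`, which the quadratic bound caps by
    -- `sℓ(y) + O(s²)`; divide by `s` and let `s → 0`. Replacing `y` by `-y` gives the other half of
    -- `|ℓ y| ≤ M y`.
    have hlow : ∀ y, -M y ≤ ℓ y := by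
      intro y
      have hs : ∀ s : ℝ, 0 < s → -M y ≤ ℓ y + s * (κ / (2 * γ) * M y ^ 2) := by
        intro s hs
        have h1 := hℓ (s • y)
        have h2 := hv_lip (x + s • y) (-(s • y))
        rw [add_neg_cancel_right, hM.neg, hM.smul, abs_of_pos hs] at h2
        rw [hM.smul, abs_of_pos hs, map_smul, smul_eq_mul] at h1
        have h3 : 0 ≤ s * (ℓ y + s * (κ / (2 * γ) * M y ^ 2) + M y) := by nlinarith
        have := nonneg_of_mul_nonneg_right h3 hs
        linarith
      have ht : Filter.Tendsto (fun s : ℝ => ℓ y + s * (κ / (2 * γ) * M y ^ 2))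
          (nhdsWithin 0 (Set.Ioi 0)) (nhds (ℓ y)) := by
        have hc : Continuous fun s : ℝ => ℓ y + s * (κ / (2 * γ) * M y ^ 2) := by fun_prop
        have := hc.tendsto 0
        rw [zero_mul, add_zero] at this
        exact this.mono_left nhdsWithin_le_nhds
      exact ge_of_tendsto ht (by filter_upwards [self_mem_nhdsWithin] with s h using hs s h)
    refine ⟨ℓ, fun y => abs_le.2 ⟨hlow y, ?_⟩, hℓ⟩
    have := hlow (-y)
    rw [hM.neg, map_neg] at this
    linarith

/-- Resampling one coordinate preserves the product law. This plays the role of the tower property,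
so that no filtration is needed. -/
theorem lintegral_pi_update {ι : Type*} [Fintype ι] [DecidableEq ι] {Ω : ι → Type*}
    [∀ i, MeasurableSpace (Ω i)] (μ : ∀ i, Measure (Ω i)) [∀ i, IsProbabilityMeasure (μ i)]
    {f : (∀ i, Ω i) → ENNReal} (hf : Measurable f) (i : ι) :
    ∫⁻ x, f x ∂Measure.pi μ = ∫⁻ x, ∫⁻ y, f (Function.update x i y) ∂μ i ∂Measure.pi μ := by
  have h1 : ∀ g : (∀ i, Ω i) → ENNReal, Measurable g → (fun _ => ∫⁻ x, g x ∂Measure.pi μ) =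
      ∫⋯∫⁻_(Finset.univ.erase i), (fun x => ∫⁻ y, g (Function.update x i y) ∂μ i) ∂μ := by
    intro g hg
    rw [← lmarginal_erase' (μ := μ) g hg (Finset.mem_univ i), lmarginal_univ]
  have hg : Measurable fun x => ∫⁻ y, f (Function.update x i y) ∂μ i := by
    simpa [lmarginal_singleton] using hf.lmarginal μ (s := {i})
  have h2 := h1 f hf
  have h3 := h1 _ hg
  simp only [Function.update_idem, lintegral_const, measure_univ, mul_one] at h3
  have hne : Nonempty (∀ i, Ω i) := by
    have := fun i => (inferInstance : IsProbabilityMeasure (μ i)).neZero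
    have : ∀ i, Nonempty (Ω i) := fun i => by
      by_contra h
      rw [not_nonempty_iff] at h
      exact NeZero.ne (μ i) (Measure.eq_zero_of_isEmpty _)
    infer_instance
  exact congrFun (h2.trans h3.symm) hne.some

theorem lintegral_exp_le_of_abs_le {X : Type*} [MeasurableSpace X] {P : Measure X}
    [IsProbabilityMeasure P] {Y : X → ℝ} {B : ℝ} (hY : Measurable Y) (hB : ∀ x, |Y x| ≤ B)
    (h0 : ∫ x, Y x ∂P = 0) (c : ℝ) :
    ∫⁻ x, ENNReal.ofReal (Real.exp (c * Y x)) ∂P ≤ ENNReal.ofReal (Real.exp (c ^ 2 * B ^ 2 / 2)) := by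
  have h := ProbabilityTheory.hasSubgaussianMGF_of_mem_Icc (μ := P) (a := -B) (b := B)
    hY.aemeasurable (Filter.Eventually.of_forall fun x => abs_le.1 (hB x))
  simp only [h0, sub_zero] at h
  rw [← ofReal_integral_eq_lintegral_ofReal (h.integrable_exp_mul c)
    (Filter.Eventually.of_forall fun x => (Real.exp_pos _).le)]
  refine ENNReal.ofReal_le_ofReal ((h.mgf_le c).trans_eq ?_)
  congr 1
  simp only [NNReal.coe_pow, NNReal.coe_div, coe_nnnorm, Real.norm_eq_abs, NNReal.coe_ofNat]
  rw [div_pow, sq_abs]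
  ring

variable {X : Type*} [MeasurableSpace X] {P : Measure X} [IsProbabilityMeasure P] {n : ℕ}

/-- A vector-valued martingale `S` with increments `ξ` on the product space: `S k` and `ξ k` are
functions of the first `k` and `k + 1` coordinates. -/
structure IsBoundedMartingale (P : Measure X) (M : (Fin d → ℝ) → ℝ) (B : ℝ)
    (S ξ : ℕ → (Fin n → X) → (Fin d → ℝ)) : Prop where
  zero : ∀ xs, S 0 xs = 0
  succ : ∀ k xs, k < n → S (k + 1) xs = S k xs + ξ k xs
  measurable : ∀ k, k < n → Measurable (ξ k)
  measurable_sum : ∀ k, k ≤ n → Measurable (S k)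
  adapted : ∀ k (hk : k < n) xs y, S k (Function.update xs ⟨k, hk⟩ y) = S k xs
  bound : ∀ k xs, k < n → M (ξ k xs) ≤ B
  mean : ∀ k (hk : k < n) xs, ∫ y, ξ k (Function.update xs ⟨k, hk⟩ y) ∂P = 0

/-- Each step integrates out the single coordinate `k`, on which `S k` does not depend. The
first-order term `ℓ (ξ k)` is a centred scalar bounded by `B`, so Hoeffding's lemma contributes
`c²B²/2`, and the quadratic remainder contributes `caB²`. -/
theorem IsBoundedMartingale.lintegral_exp_le {M : (Fin d → ℝ) → ℝ} {B a c : ℝ}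
    {S ξ : ℕ → (Fin n → X) → (Fin d → ℝ)} (h : IsBoundedMartingale P M B S ξ) (hM : IsNormFun M)
    (hle : ∀ z, ‖z‖ ≤ M z) {v : (Fin d → ℝ) → ℝ} (hv : Continuous v) (hv0 : v 0 = 0)
    (ha : 0 ≤ a) (hc : 0 ≤ c)
    (hsm : ∀ x, ∃ ℓ : (Fin d → ℝ) →L[ℝ] ℝ, (∀ y, |ℓ y| ≤ M y) ∧
        ∀ y, v (x + y) ≤ v x + ℓ y + a * M y ^ 2) {k : ℕ} (hk : k ≤ n) :
    ∫⁻ xs, ENNReal.ofReal (Real.exp (c * v (S k xs))) ∂(Measure.pi fun _ : Fin n => P) ≤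
      ENNReal.ofReal (Real.exp (k * (c ^ 2 * B ^ 2 / 2 + c * a * B ^ 2))) := by
  induction k with
  | zero => simp [h.zero, hv0]
  | succ k ih =>
    have hkn : k < n := hk
    have hmeas : Measurable fun xs => ENNReal.ofReal (Real.exp (c * v (S (k + 1) xs))) := by
      have h1 := h.measurable_sum _ hk
      have h2 := hv.measurable.comp h1
      fun_prop
    set E := c ^ 2 * B ^ 2 / 2 + c * a * B ^ 2 with hE
    rw [lintegral_pi_update (fun _ : Fin n => P) hmeas ⟨k, hkn⟩]
    have hstep : ∀ xs : Fin n → X, ∫⁻ y, ENNReal.ofReal (Real.exp (c * v (S (k + 1)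
        (Function.update xs ⟨k, hkn⟩ y)))) ∂P ≤
        ENNReal.ofReal (Real.exp E) * ENNReal.ofReal (Real.exp (c * v (S k xs))) := by
      intro xs
      obtain ⟨ℓ, hℓ, hvℓ⟩ := hsm (S k xs)
      let η : X → Fin d → ℝ := fun y => ξ k (Function.update xs ⟨k, hkn⟩ y)
      have hη : Measurable η := (h.measurable k hkn).comp (measurable_update xs)
      have hηB : ∀ y, M (η y) ≤ B := fun y => h.bound k _ hkn
      have hηi : Integrable η P := by
        refine Integrable.of_bound hη.aestronglyMeasurable B
          (Filter.Eventually.of_forall fun y => (hle _).trans (hηB y))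
      have hmean : ∫ y, ℓ (η y) ∂P = 0 := by
        rw [ℓ.integral_comp_comm hηi, h.mean k hkn xs, map_zero]
      have hH := lintegral_exp_le_of_abs_le (P := P) (ℓ.continuous.measurable.comp hη)
        (fun y => (hℓ _).trans (hηB y)) hmean c
      have hpt : ∀ y, ENNReal.ofReal (Real.exp (c * v (S (k + 1)
          (Function.update xs ⟨k, hkn⟩ y)))) ≤
          ENNReal.ofReal (Real.exp (c * v (S k xs) + c * a * B ^ 2)) *
            ENNReal.ofReal (Real.exp (c * ℓ (η y))) := by
        intro y
        rw [← ENNReal.ofReal_mul (Real.exp_pos _).le, ← Real.exp_add, h.succ k _ hkn,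
          h.adapted k hkn]
        refine ENNReal.ofReal_le_ofReal (Real.exp_le_exp.2 ?_)
        have h1 := hvℓ (η y)
        have h2 : a * M (η y) ^ 2 ≤ a * B ^ 2 := by
          gcongr
          · exact hM.nonneg _
          · exact hηB y
        have h3 : v (S k xs + η y) ≤ v (S k xs) + ℓ (η y) + a * B ^ 2 := by linarith
        have h4 := mul_le_mul_of_nonneg_left h3 hc
        simp only [η] at h4 ⊢
        linarith
      refine (lintegral_mono hpt).trans ?_
      rw [lintegral_const_mul' _ _ ENNReal.ofReal_ne_top]
      refine (mul_le_mul_right hH _).trans_eq ?_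
      rw [← ENNReal.ofReal_mul (Real.exp_pos _).le, ← Real.exp_add,
        ← ENNReal.ofReal_mul (Real.exp_pos _).le, ← Real.exp_add]
      congr 2
      rw [hE]; ring
    refine (lintegral_mono hstep).trans ?_
    rw [lintegral_const_mul' _ _ ENNReal.ofReal_ne_top]
    refine (mul_le_mul_right (ih hkn.le) _).trans_eq ?_
    rw [← ENNReal.ofReal_mul (Real.exp_pos _).le, ← Real.exp_add]
    congr 2
    push_cast; ring

/-- Azuma's inequality in a regular norm. -/
theorem IsBoundedMartingale.measure_gt_le {M N : (Fin d → ℝ) → ℝ} {B κ u : ℝ}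
    {S ξ : ℕ → (Fin n → X) → (Fin d → ℝ)} (h : IsBoundedMartingale P M B S ξ) (hM : IsNormFun M)
    (hle : ∀ z, ‖z‖ ≤ M z) (hreg : IsRegularNorm M N κ) (hB : 0 ≤ B) (hu : 0 < u) {k : ℕ}
    (hk : k ≤ n) :
    (Measure.pi fun _ : Fin n => P) {xs | B * √k * (√κ + √(2 * u)) < M (S k xs)} ≤
      ENNReal.ofReal (Real.exp (-u)) := by
  have hκ : 1 ≤ κ := by
    obtain ⟨-, κ₁, h1, h2, -⟩ := hreg
    exact h1.trans h2
  rcases Nat.eq_zero_or_pos k with rfl | hk0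
  · simp [h.zero, hM.zero]
  -- If `B = 0` the martingale vanishes; this case is split off because `c` below divides by `b`.
  rcases hB.eq_or_lt with rfl | hB
  · have h0 : ∀ j, j ≤ n → ∀ xs, S j xs = 0 := by
      intro j
      induction j with
      | zero => exact fun _ xs => h.zero xs
      | succ j ih =>
        intro hj xs
        have h1 := h.bound j xs hj
        rw [h.succ j xs hj, ih (by omega) xs,
          hM.eq_zero _ (le_antisymm h1 (hM.nonneg _)), add_zero]
    simp [h0 k hk, hM.zero]
  have hk1 : (0 : ℝ) < k := by exact_mod_cast hk0
  set b := B * √k with hb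
  have hb0 : 0 < b := by positivity
  have hb2 : b ^ 2 = B ^ 2 * k := by rw [hb, mul_pow, Real.sq_sqrt hk1.le]
  have hsκ : 0 < √κ := Real.sqrt_pos.2 (by linarith)
  have hsκ2 : √κ ^ 2 = κ := Real.sq_sqrt (by linarith)
  have hsu : 0 < √(2 * u) := by positivity
  have hsu2 : √(2 * u) ^ 2 = 2 * u := Real.sq_sqrt (by linarith)
  -- With `γ = b√κ` the smoothing error `γ/2` and the drift `kB²κ/(2γ)` both equal `b√κ/2`, together
  -- `b√κ`. With `c = √(2u)/b` the Gaussian exponent is `u` and the threshold contributes `2u`,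
  -- leaving `exp(-u)`.
  have hγ : 0 < b * √κ := by positivity
  obtain ⟨v, hv, hv0, hvM, hsm⟩ := exists_smooth_approx hM hle hreg hγ
  set c := √(2 * u) / b with hc
  have hc0 : 0 < c := by positivity
  have hmgf := h.lintegral_exp_le hM hle hv hv0 (a := κ / (2 * (b * √κ))) (c := c)
    (by positivity) hc0.le hsm hk
  have hexp : k * (c ^ 2 * B ^ 2 / 2 + c * (κ / (2 * (b * √κ))) * B ^ 2) =
      u + √(2 * u) * √κ / 2 := by
    have e1 : k * (c ^ 2 * B ^ 2 / 2) = u := by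
      have : k * (c ^ 2 * B ^ 2 / 2) = c ^ 2 * b ^ 2 / 2 := by rw [hb2]; ring
      rw [this, hc, div_pow, hsu2]; field_simp
    have e2 : k * (c * (κ / (2 * (b * √κ))) * B ^ 2) = √(2 * u) * √κ / 2 := by
      have : k * (c * (κ / (2 * (b * √κ))) * B ^ 2) = c * (κ / (2 * (b * √κ))) * b ^ 2 := by
        rw [hb2]; ring
      rw [this, hc]
      nth_rewrite 1 [← hsκ2]
      field_simp
    rw [mul_add, e1, e2]
  rw [hexp] at hmgf
  have hsub : {xs | b * (√κ + √(2 * u)) < M (S k xs)} ⊆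
      {xs | ENNReal.ofReal (Real.exp (c * (b * √κ / 2 + b * √(2 * u)))) ≤
        ENNReal.ofReal (Real.exp (c * v (S k xs)))} := by
    intro xs hxs
    rw [Set.mem_ofPred_eq] at hxs ⊢
    refine ENNReal.ofReal_le_ofReal (Real.exp_le_exp.2 (mul_le_mul_of_nonneg_left ?_ hc0.le))
    have := hvM (S k xs)
    linarith
  have hmeas : Measurable fun xs => ENNReal.ofReal (Real.exp (c * v (S k xs))) := by
    have h2 := hv.measurable.comp (h.measurable_sum k hk)
    exact ENNReal.measurable_ofReal.comp (Real.measurable_exp.comp (h2.const_mul c))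
  have hmk := mul_meas_ge_le_lintegral₀ (μ := Measure.pi fun _ : Fin n => P) hmeas.aemeasurable
    (ENNReal.ofReal (Real.exp (c * (b * √κ / 2 + b * √(2 * u)))))
  have hfin := (mul_le_mul_right (measure_mono hsub) _).trans (hmk.trans hmgf)
  have he : ENNReal.ofReal (Real.exp (u + √(2 * u) * √κ / 2)) =
      ENNReal.ofReal (Real.exp (c * (b * √κ / 2 + b * √(2 * u)))) *
        ENNReal.ofReal (Real.exp (-u)) := by
    rw [← ENNReal.ofReal_mul (Real.exp_pos _).le, ← Real.exp_add]
    congr 2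
    have hcb : c * b = √(2 * u) := div_mul_cancel₀ _ hb0.ne'
    linear_combination (-(√κ / 2 + √(2 * u))) * hcb - hsu2
  rw [he] at hfin
  exact (ENNReal.mul_le_mul_iff_right (by simp [Real.exp_pos]) ENNReal.ofReal_ne_top).1 hfin

end Martingale

/-! ### The optimization problem -/

section Problem

variable {d : ℕ}

theorem IsNormFun.integral_le {N : (Fin d → ℝ) → ℝ} (hN : IsNormFun N) {X : Type*}
    [MeasurableSpace X] {P : Measure X} [IsProbabilityMeasure P] {g : X → Fin d → ℝ} {c : ℝ}
    (hg : Integrable g P) (hc : ∀ x, N (g x) ≤ c) : N (∫ x, g x ∂P) ≤ c := by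
  have hconv : Convex ℝ {z | N z ≤ c} := by
    intro x hx y hy a b ha hb hab
    rw [Set.mem_ofPred_eq] at hx hy ⊢
    refine (hN.add_le _ _).trans ?_
    rw [hN.smul, hN.smul, abs_of_nonneg ha, abs_of_nonneg hb]
    calc a * N x + b * N y ≤ a * c + b * c := by gcongr
      _ = c := by rw [← add_mul, hab, one_mul]
  exact hconv.integral_mem (isClosed_le hN.continuous continuous_const)
    (Filter.Eventually.of_forall hc) hg

theorem ellNorm_sub_le_ellDiam {p : ENNReal} (hp : 1 ≤ p) {K : Set (Fin d → ℝ)} (hK : IsCompact K)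
    {x y : Fin d → ℝ} (hx : x ∈ K) (hy : y ∈ K) : ellNorm p (x - y) ≤ ellDiam p K := by
  refine le_csSup ?_ ⟨x, hx, y, hy, rfl⟩
  have hc : Continuous fun z : (Fin d → ℝ) × (Fin d → ℝ) => ellNorm p (z.1 - z.2) :=
    (continuous_ellNorm hp).comp (continuous_fst.sub continuous_snd)
  refine ((hK.prod hK).image hc).bddAbove.mono ?_
  rintro r ⟨x, hx, y, hy, rfl⟩
  exact ⟨(x, y), ⟨hx, hy⟩, rfl⟩

/-- A stochastic convex optimization problem in the `ℓ_p` geometry. -/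
structure StochasticProblem {X : Type*} [MeasurableSpace X] (P : Measure X) (p q : ENNReal)
    (K : Set (Fin d → ℝ)) (f : (Fin d → ℝ) → X → ℝ) (grad : (Fin d → ℝ) → X → (Fin d → ℝ))
    (F : (Fin d → ℝ) → ℝ) (β G L D : ℝ) : Prop where
  one_lt : 1 < p
  conj : p⁻¹ + q⁻¹ = 1
  beta_nonneg : 0 ≤ β
  convex : Convex ℝ K
  zero_mem : (0 : Fin d → ℝ) ∈ K
  diam : ∀ x ∈ K, ∀ y ∈ K, ellNorm p (x - y) ≤ D
  integrable : ∀ θ ∈ K, Integrable (f θ) P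
  loss : ∀ θ, F θ = ∫ x, f θ x ∂P
  measurable : ∀ θ ∈ K, Measurable (grad θ)
  gradient : ∀ x, IsGradientOn K (fun θ => f θ x) fun θ => grad θ x
  convexOn : ConvexOn ℝ K F
  smooth : ∀ θ₁ ∈ K, ∀ θ₂ ∈ K, ∀ x,
    ellNorm q (grad θ₁ x - grad θ₂ x) ≤ β * ellNorm p (θ₁ - θ₂)
  deviation : ∀ θ ∈ K, ∃ g, ∀ x, ellNorm q (grad θ x - g) ≤ G
  lipschitz : ∀ θ ∈ K, ∀ x, ellNorm q (grad θ x) ≤ L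

/-- The mean of the stochastic gradient. -/
noncomputable def meanGrad {X : Type*} [MeasurableSpace X] (P : Measure X)
    (grad : (Fin d → ℝ) → X → (Fin d → ℝ)) (θ : Fin d → ℝ) : Fin d → ℝ :=
  ∫ x, grad θ x ∂P

namespace StochasticProblem

variable {X : Type*} [MeasurableSpace X] {P : Measure X}
  {p q : ENNReal} {K : Set (Fin d → ℝ)} {f : (Fin d → ℝ) → X → ℝ}
  {grad : (Fin d → ℝ) → X → (Fin d → ℝ)} {F : (Fin d → ℝ) → ℝ} {β G L D : ℝ}
  (h : StochasticProblem P p q K f grad F β G L D)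

include h

theorem one_le_q : 1 ≤ q := one_le_conj h.conj

theorem isNormFun_q : IsNormFun (ellNorm q : (Fin d → ℝ) → ℝ) := isNormFun_ellNorm h.one_le_q

theorem isNormFun_p : IsNormFun (ellNorm p : (Fin d → ℝ) → ℝ) := isNormFun_ellNorm h.one_lt.le

theorem D_nonneg : 0 ≤ D := (ellNorm_nonneg h.one_lt.le _).trans (h.diam 0 h.zero_mem 0 h.zero_mem)

/-- The difference with its linearization is monotone along the segment, which stays in `K`, so
derivatives relative to `K` suffice. Both signs are kept: the upper bound drives the Frank–Wolfe
step, the lower one yields `risk_add_le`. -/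
theorem abs_loss_sub_le {θ θ' : Fin d → ℝ} (hθ : θ ∈ K) (hθ' : θ' ∈ K) (x : X) :
    |f θ' x - f θ x - dotL (grad θ x) (θ' - θ)| ≤ β / 2 * ellNorm p (θ' - θ) ^ 2 := by
  set u := θ' - θ with hu
  set r := ellNorm p u with hr
  have hmem : ∀ s ∈ Set.Icc (0 : ℝ) 1, θ + s • u ∈ K := fun s hs =>
    h.convex.add_smul_sub_mem hθ hθ' hs
  have hder : ∀ s ∈ Set.Icc (0 : ℝ) 1, HasDerivWithinAt (fun s => f (θ + s • u) x)
      (dotL (grad (θ + s • u) x) u) (Set.Icc 0 1) s := by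
    intro s hs
    have h1 : HasDerivWithinAt (fun s : ℝ => θ + s • u) u (Set.Icc 0 1) s := by
      simpa using (((hasDerivAt_id' s).smul_const u).const_add θ).hasDerivWithinAt
    exact HasFDerivWithinAt.comp_hasDerivWithinAt s (h.gradient x _ (hmem s hs)) h1 hmem
  have hbd : ∀ s ∈ Set.Icc (0 : ℝ) 1,
      |dotL (grad (θ + s • u) x) u - dotL (grad θ x) u| ≤ β * r ^ 2 * s := by
    intro s hs
    have e : dotL (grad (θ + s • u) x) u - dotL (grad θ x) u =
        dotL (grad (θ + s • u) x - grad θ x) u := by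
      simp [dotL_apply, sub_mul, Finset.sum_sub_distrib]
    rw [e]
    refine (abs_dotL_le h.one_lt h.conj _ _).trans ?_
    have h1 := h.smooth _ (hmem s hs) _ hθ x
    rw [add_sub_cancel_left, h.isNormFun_p.smul, abs_of_nonneg hs.1] at h1
    have h2 := mul_le_mul_of_nonneg_right h1 (h.isNormFun_p.nonneg u)
    linarith
  have key : ∀ c : ℝ, |c| = 1 →
      c * (f θ' x - f θ x - dotL (grad θ x) u) ≤ β / 2 * r ^ 2 := by
    intro c hc
    have hd : ∀ s ∈ Set.Icc (0 : ℝ) 1, HasDerivWithinAt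
        (fun s => c * (f (θ + s • u) x - s * dotL (grad θ x) u) - β / 2 * r ^ 2 * s ^ 2)
        (c * (dotL (grad (θ + s • u) x) u - dotL (grad θ x) u) - β * r ^ 2 * s)
        (Set.Icc 0 1) s := by
      intro s hs
      refine ((((hder s hs).sub ((hasDerivWithinAt_id s _).mul_const _)).const_mul c).sub
        ((hasDerivAt_pow 2 s).hasDerivWithinAt.const_mul (β / 2 * r ^ 2))).congr_deriv ?_
      simp; ring
    have ha := antitoneOn_of_hasDerivWithinAt_nonpos (convex_Icc (0 : ℝ) 1)
      (fun s hs => (hd s hs).continuousWithinAt)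
      (fun s hs => (hd s (interior_subset hs)).mono interior_subset) (fun s hs => by
        have h1 := hbd s (interior_subset hs)
        have h2 := le_abs_self (c * (dotL (grad (θ + s • u) x) u - dotL (grad θ x) u))
        rw [abs_mul, hc, one_mul] at h2
        linarith)
    have := ha (by simp : (0 : ℝ) ∈ Set.Icc 0 1) (by simp : (1 : ℝ) ∈ Set.Icc 0 1) zero_le_one
    have e : θ + u = θ' := by rw [hu]; abel
    simp only [one_smul, zero_smul, add_zero, one_mul, zero_mul, one_pow, e] at this
    linarith
  have k1 := key 1 (by simp)
  have k2 := key (-1) (by simp)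
  rw [abs_le]
  constructor <;> linarith

variable [IsProbabilityMeasure P]

theorem G_nonneg : 0 ≤ G := by
  obtain ⟨x⟩ := nonempty_of_isProbabilityMeasure P
  obtain ⟨g, hg⟩ := h.deviation 0 h.zero_mem
  exact (h.isNormFun_q.nonneg _).trans (hg x)

theorem L_nonneg : 0 ≤ L := by
  obtain ⟨x⟩ := nonempty_of_isProbabilityMeasure P
  exact (h.isNormFun_q.nonneg _).trans (h.lipschitz 0 h.zero_mem x)

theorem integrable_grad {θ : Fin d → ℝ} (hθ : θ ∈ K) : Integrable (grad θ) P :=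
  Integrable.of_bound (h.measurable θ hθ).aestronglyMeasurable L
    (Filter.Eventually.of_forall fun x => (norm_le_ellNorm h.one_le_q _).trans (h.lipschitz θ hθ x))

theorem meanGrad_le {θ : Fin d → ℝ} (hθ : θ ∈ K) : ellNorm q (meanGrad P grad θ) ≤ L :=
  h.isNormFun_q.integral_le (h.integrable_grad hθ) (h.lipschitz θ hθ)

theorem meanGrad_lipschitz {θ₁ θ₂ : Fin d → ℝ} (h₁ : θ₁ ∈ K) (h₂ : θ₂ ∈ K) :
    ellNorm q (meanGrad P grad θ₁ - meanGrad P grad θ₂) ≤ β * ellNorm p (θ₁ - θ₂) := by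
  have e : meanGrad P grad θ₁ - meanGrad P grad θ₂ = ∫ x, (grad θ₁ x - grad θ₂ x) ∂P :=
    (integral_sub (h.integrable_grad h₁) (h.integrable_grad h₂)).symm
  rw [e]
  exact h.isNormFun_q.integral_le ((h.integrable_grad h₁).sub (h.integrable_grad h₂))
    (h.smooth θ₁ h₁ θ₂ h₂)

/-- A gradient relative to `K` need not be unique when `K` has empty interior, so the centre `g`
need not be the mean. Jensen places the mean within `G` of `g`, at the price of the factor `2`. -/
theorem grad_sub_meanGrad_le {θ : Fin d → ℝ} (hθ : θ ∈ K) (x : X) :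
    ellNorm q (grad θ x - meanGrad P grad θ) ≤ 2 * G := by
  obtain ⟨g, hg⟩ := h.deviation θ hθ
  have e : meanGrad P grad θ - g = ∫ x, (grad θ x - g) ∂P := by
    rw [integral_sub (h.integrable_grad hθ) (integrable_const g)]
    simp [meanGrad]
  have h1 : ellNorm q (meanGrad P grad θ - g) ≤ G := by
    rw [e]
    exact h.isNormFun_q.integral_le ((h.integrable_grad hθ).sub (integrable_const g)) hg
  have h2 := h.isNormFun_q.add_le (grad θ x - g) (-(meanGrad P grad θ - g))
  rw [h.isNormFun_q.neg] at h2
  have h3 := hg x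
  have e2 : grad θ x - g + -(meanGrad P grad θ - g) = grad θ x - meanGrad P grad θ := by abel
  rw [e2] at h2
  linarith

theorem abs_risk_sub_le {θ θ' : Fin d → ℝ} (hθ : θ ∈ K) (hθ' : θ' ∈ K) :
    |F θ' - F θ - dotL (meanGrad P grad θ) (θ' - θ)| ≤ β / 2 * ellNorm p (θ' - θ) ^ 2 := by
  have hi := h.integrable_grad hθ
  have hdl : ∀ z : Fin d → ℝ, dotL z (θ' - θ) = dotL (θ' - θ) z := fun z => by
    simp [dotL_apply, mul_comm]
  have hi2 : Integrable (fun x => dotL (grad θ x) (θ' - θ)) P := by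
    simp only [hdl]
    exact (dotL (θ' - θ)).integrable_comp hi
  have e : F θ' - F θ - dotL (meanGrad P grad θ) (θ' - θ) =
      ∫ x, (f θ' x - f θ x - dotL (grad θ x) (θ' - θ)) ∂P := by
    have e1 : ∫ x, (f θ' x - f θ x - dotL (grad θ x) (θ' - θ)) ∂P =
        ∫ x, (f θ' x - f θ x) ∂P - ∫ x, dotL (grad θ x) (θ' - θ) ∂P :=
      integral_sub ((h.integrable θ' hθ').sub (h.integrable θ hθ)) hi2
    rw [e1, integral_sub (h.integrable θ' hθ') (h.integrable θ hθ), h.loss, h.loss]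
    simp only [hdl]
    rw [ContinuousLinearMap.integral_comp_comm _ hi]
    rfl
  rw [e, ← Real.norm_eq_abs]
  refine (norm_integral_le_of_norm_le_const (Filter.Eventually.of_forall fun x => ?_)).trans_eq
    (by rw [probReal_univ, mul_one])
  exact h.abs_loss_sub_le hθ hθ' x

/-- Convexity on `[θ, θ + s(θ' - θ)]` and the integrated lower Taylor bound give the inequality up
to `s * b`; let `s → 0`. No differentiation under the integral is involved. -/
theorem risk_add_le {θ θ' : Fin d → ℝ} (hθ : θ ∈ K) (hθ' : θ' ∈ K) :
    F θ + dotL (meanGrad P grad θ) (θ' - θ) ≤ F θ' := by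
  set a := dotL (meanGrad P grad θ) (θ' - θ) with ha
  set b := β / 2 * ellNorm p (θ' - θ) ^ 2 with hb
  have hs : ∀ s : ℝ, 0 < s → s ≤ 1 → a - s * b ≤ F θ' - F θ := by
    intro s hs0 hs1
    have hmem := h.convex.add_smul_sub_mem hθ hθ' ⟨hs0.le, hs1⟩
    have h1 := (abs_le.1 (h.abs_risk_sub_le hθ hmem)).1
    rw [add_sub_cancel_left, map_smul, smul_eq_mul, h.isNormFun_p.smul, abs_of_pos hs0, ← ha] at h1
    have h2 := h.convexOn.2 hθ hθ' (by linarith : 0 ≤ 1 - s) hs0.le (by ring)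
    have e : (1 - s) • θ + s • θ' = θ + s • (θ' - θ) := by
      rw [sub_smul, one_smul, smul_sub]; abel
    rw [e, smul_eq_mul, smul_eq_mul] at h2
    have h3 : 0 ≤ s * (F θ' - F θ - (a - s * b)) := by
      rw [hb]; nlinarith
    have := nonneg_of_mul_nonneg_right h3 hs0
    linarith
  have ht : Filter.Tendsto (fun s : ℝ => a - s * b) (nhdsWithin 0 (Set.Ioi 0)) (nhds a) := by
    have hc : Continuous fun s : ℝ => a - s * b := by fun_prop
    have := hc.tendsto 0
    rw [zero_mul, sub_zero] at this
    exact this.mono_left nhdsWithin_le_nhds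
  have := le_of_tendsto ht (b := F θ' - F θ) (by
    filter_upwards [Ioo_mem_nhdsGT (zero_lt_one (α := ℝ))] with s hs1
    exact hs s hs1.1 hs1.2.le)
  linarith

theorem risk_zero_sub_le {θ' : Fin d → ℝ} (hθ' : θ' ∈ K) : F 0 - F θ' ≤ L * D := by
  have h1 := h.risk_add_le h.zero_mem hθ'
  have h2 := (abs_le.1 (abs_dotL_le h.one_lt h.conj (meanGrad P grad 0) (θ' - 0))).1
  have h3 := mul_le_mul (h.meanGrad_le h.zero_mem) (h.diam _ hθ' _ h.zero_mem)
    (h.isNormFun_p.nonneg _) h.L_nonneg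
  linarith

/-- One Frank–Wolfe step with the inexact gradient `w`. -/
theorem frankWolfe_step {lmo : (Fin d → ℝ) → (Fin d → ℝ)} (hlmo : IsLinMinOracle K lmo)
    {θ θ' : Fin d → ℝ} (hθ : θ ∈ K) (hθ' : θ' ∈ K) (w : Fin d → ℝ) {η : ℝ} (h0 : 0 ≤ η)
    (h1 : η ≤ 1) :
    F (θ + η • (lmo w - θ)) - F θ' ≤ (1 - η) * (F θ - F θ') +
      η * (D * ellNorm q (meanGrad P grad θ - w)) + η ^ 2 * (β * D ^ 2 / 2) := by
  obtain ⟨hv, hmin⟩ := hlmo.2 w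
  set v := lmo w with hvdef
  have a1 := (abs_le.1 (h.abs_risk_sub_le hθ (h.convex.add_smul_sub_mem hθ hv ⟨h0, h1⟩))).2
  rw [add_sub_cancel_left, map_smul, smul_eq_mul, h.isNormFun_p.smul, abs_of_nonneg h0] at a1
  have a2 := h.risk_add_le hθ hθ'
  have a3 := hmin θ' hθ'
  have a4 := (le_abs_self _).trans (abs_dotL_le h.one_lt h.conj (meanGrad P grad θ - w) (v - θ'))
  -- The three terms are bounded by convexity of `F`, optimality of `v` for `w`, and Hölder together
  -- with the diameter.
  have e : dotL (meanGrad P grad θ) (v - θ) = dotL (meanGrad P grad θ) (θ' - θ) +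
      (dotL w v - dotL w θ') + dotL (meanGrad P grad θ - w) (v - θ') := by
    simp only [dotL_apply, ← Finset.sum_sub_distrib, ← Finset.sum_add_distrib]
    refine Finset.sum_congr rfl fun i _ => ?_
    simp only [Pi.sub_apply]; ring
  have a5 := mul_le_mul_of_nonneg_left (h.diam _ hv _ hθ')
    (h.isNormFun_q.nonneg (meanGrad P grad θ - w))
  have a6 : (η * ellNorm p (v - θ)) ^ 2 ≤ η ^ 2 * D ^ 2 := by
    rw [mul_pow]
    have := pow_le_pow_left₀ (h.isNormFun_p.nonneg _) (h.diam _ hv _ hθ) 2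
    gcongr
  have a7 := mul_le_mul_of_nonneg_left a6 (by linarith [h.beta_nonneg] : 0 ≤ β / 2)
  have a8 : dotL (meanGrad P grad θ) (v - θ) ≤
      -(F θ - F θ') + D * ellNorm q (meanGrad P grad θ - w) := by
    rw [e]; linarith
  have a9 := mul_le_mul_of_nonneg_left a8 h0
  linarith

end StochasticProblem

theorem frankWolfe_recursion {x e : ℕ → ℝ} {n : ℕ} {D A R c x₀ : ℝ} (hD : 0 ≤ D) (hA : 0 ≤ A)
    (hR : 0 ≤ R) (hc : 0 ≤ c) (h1 : x 1 ≤ x₀)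
    (he : ∀ t, 1 ≤ t → t < n → e t ≤ (A * √t + R) / (t + 1))
    (hx : ∀ t, 1 ≤ t → t < n →
      x (t + 1) ≤ (1 - 1 / ((t : ℝ) + 1)) * x t + 1 / ((t : ℝ) + 1) * (D * e t) +
        (1 / ((t : ℝ) + 1)) ^ 2 * c) {t : ℕ} (ht : 1 ≤ t) (htn : t ≤ n) :
    t * x t ≤ x₀ + 2 * D * A * √t + (D * R + c) * Real.log t := by
  induction t, ht using Nat.le_induction with
  | base =>
    simp only [Nat.cast_one, Real.sqrt_one, Real.log_one]
    have : 0 ≤ 2 * D * A := by positivity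
    linarith
  | succ t ht ih =>
    have ih := ih (by omega)
    have ht0 : (0 : ℝ) < t := by exact_mod_cast ht
    have hx := mul_le_mul_of_nonneg_left (hx t ht (by omega)) (by positivity : (0 : ℝ) ≤ t + 1)
    have e1 : ((t : ℝ) + 1) * ((1 - 1 / ((t : ℝ) + 1)) * x t + 1 / ((t : ℝ) + 1) * (D * e t) +
        (1 / ((t : ℝ) + 1)) ^ 2 * c) = t * x t + D * e t + 1 / (t + 1) * c := by
      field_simp; ring
    rw [e1] at hx
    have he' := mul_le_mul_of_nonneg_left (he t ht (by omega)) hD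
    have e2 : D * ((A * √t + R) / (t + 1)) = D * A * (√t / (t + 1)) + D * R * (1 / (t + 1)) := by
      field_simp
    -- In fact `1/√(t+1) ≤ 2(√(t+1) - √t)`, the usual telescoping majorant, and `√t ≤ √(t+1)`.
    have hsq : √(t : ℝ) / (t + 1) ≤ 2 * (√((t : ℝ) + 1) - √t) := by
      have b1 : √(t : ℝ) ^ 2 = t := Real.sq_sqrt ht0.le
      have b2 : √((t : ℝ) + 1) ^ 2 = t + 1 := Real.sq_sqrt (by positivity)
      have b3 : √(t : ℝ) ≤ √((t : ℝ) + 1) := Real.sqrt_le_sqrt (by linarith)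
      have b4 : 0 < √(t : ℝ) := Real.sqrt_pos.2 ht0
      rw [div_le_iff₀ (by positivity)]
      have b5 : 2 * (√((t : ℝ) + 1) - √t) * (t + 1) - √((t : ℝ) + 1) =
          (√((t : ℝ) + 1) - √t) ^ 2 * √((t : ℝ) + 1) := by
        linear_combination (-2 * (√((t : ℝ) + 1) - √t) + √((t : ℝ) + 1)) * b2 -
          √((t : ℝ) + 1) * b1
      have b6 : 0 ≤ (√((t : ℝ) + 1) - √t) ^ 2 * √((t : ℝ) + 1) := by positivity
      linarith
    have hlog : 1 / ((t : ℝ) + 1) ≤ Real.log (t + 1) - Real.log t := by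
      rw [← Real.log_div (by positivity) (by positivity)]
      refine le_trans (le_of_eq ?_) (Real.one_sub_inv_le_log_of_pos (by positivity))
      field_simp; ring
    have c1 := mul_le_mul_of_nonneg_left hsq (by positivity : 0 ≤ D * A)
    have c2 := mul_le_mul_of_nonneg_left hlog (by positivity : 0 ≤ D * R + c)
    push_cast
    linarith

end Problem

/-! ### Runs of the algorithm -/

section Run

variable {d n : ℕ} {X : Type*}

/-- The `k`-th element of the stream inserted into the aggregation tree. -/
noncomputable def streamElement (grad : (Fin d → ℝ) → X → (Fin d → ℝ))
    (lmo : (Fin d → ℝ) → (Fin d → ℝ)) (xs : Fin n → X)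
    (zs : Fin n → Fin (Nat.clog 2 n + 1) → (Fin d → ℝ)) (k : ℕ) : Fin d → ℝ :=
  if hk : k < n then
    ((k : ℝ) + 2) • grad (fwRun grad lmo xs zs k).cur (xs ⟨k, hk⟩) -
      ((k : ℝ) + 1) • grad (fwRun grad lmo xs zs k).prev (xs ⟨k, hk⟩)
  else 0

/-- The deviation of the `k`-th element of the stream from its conditional mean. -/
noncomputable def streamNoise [MeasurableSpace X] (P : Measure X)
    (grad : (Fin d → ℝ) → X → (Fin d → ℝ))
    (lmo : (Fin d → ℝ) → (Fin d → ℝ)) (xs : Fin n → X)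
    (zs : Fin n → Fin (Nat.clog 2 n + 1) → (Fin d → ℝ)) (k : ℕ) : Fin d → ℝ :=
  if hk : k < n then
    ((k : ℝ) + 2) • (grad (fwRun grad lmo xs zs k).cur (xs ⟨k, hk⟩) -
        meanGrad P grad (fwRun grad lmo xs zs k).cur) -
      ((k : ℝ) + 1) • (grad (fwRun grad lmo xs zs k).prev (xs ⟨k, hk⟩) -
        meanGrad P grad (fwRun grad lmo xs zs k).prev)
  else 0

/-- The time at which the node of height `ℓ` used by the partial sum at time `t` is completed,
counted from `0`. -/
def completionTime {t : ℕ} (ht : 1 ≤ t) (htn : t ≤ n) (ℓ : ℕ) : Fin n :=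
  ⟨t / 2 ^ ℓ * 2 ^ ℓ - 1, by have := Nat.div_mul_le_self t (2 ^ ℓ); omega⟩

variable {grad : (Fin d → ℝ) → X → (Fin d → ℝ)} {lmo : (Fin d → ℝ) → (Fin d → ℝ)}
  {xs : Fin n → X} {zs : Fin n → Fin (Nat.clog 2 n + 1) → (Fin d → ℝ)}

theorem fwRun_succ {k : ℕ} (hk : k < n) : fwRun grad lmo xs zs (k + 1) =
    fwStep grad lmo (k + 1) (xs ⟨k, hk⟩) (zs ⟨k, hk⟩) (fwRun grad lmo xs zs k) := by
  simp [fwRun, hk]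

theorem fwRun_succ_of_le {k : ℕ} (hk : n ≤ k) :
    fwRun grad lmo xs zs (k + 1) = fwRun grad lmo xs zs k := by
  simp [fwRun, hk.not_gt]

theorem fwRun_succ_prev {k : ℕ} (hk : k < n) :
    (fwRun grad lmo xs zs (k + 1)).prev = (fwRun grad lmo xs zs k).cur := by
  rw [fwRun_succ hk]; rfl

theorem fwRun_tree {k : ℕ} (hk : k ≤ n) : (fwRun grad lmo xs zs k).tree =
    treeRun (streamElement grad lmo xs zs) (fun k => if hk : k < n then zs ⟨k, hk⟩ else 0) k := by
  induction k with
  | zero => rfl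
  | succ k ih =>
    have hkn : k < n := hk
    rw [fwRun_succ hkn]
    simp only [fwStep, treeRun, ih hkn.le, streamElement, hkn, dif_pos]
    congr 1
    push_cast
    rw [add_assoc, one_add_one_eq_two]

theorem fwRun_update {k : ℕ} (hk : k < n) (y : X) {j : ℕ} (hj : j ≤ k) :
    fwRun grad lmo (Function.update xs ⟨k, hk⟩ y) zs j = fwRun grad lmo xs zs j := by
  induction j with
  | zero => rfl
  | succ j ih =>
    have hjn : j < n := by omega
    rw [fwRun_succ hjn, fwRun_succ hjn, ih (by omega), Function.update_of_ne]
    simp only [ne_eq, Fin.mk.injEq]; omega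

theorem fwRun_mem {K : Set (Fin d → ℝ)} (hK : Convex ℝ K) (h0 : (0 : Fin d → ℝ) ∈ K)
    (hlmo : ∀ u, lmo u ∈ K) (k : ℕ) :
    (fwRun grad lmo xs zs k).prev ∈ K ∧ (fwRun grad lmo xs zs k).cur ∈ K := by
  induction k with
  | zero => exact ⟨h0, h0⟩
  | succ k ih =>
    rcases lt_or_ge k n with hk | hk
    · rw [fwRun_succ hk]
      refine ⟨ih.2, hK.add_smul_sub_mem ih.2 (hlmo _) ⟨by positivity, ?_⟩⟩
      rw [div_le_one (by positivity)]
      push_cast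
      linarith [(Nat.cast_nonneg k : (0 : ℝ) ≤ k)]
    · rw [fwRun_succ_of_le hk]; exact ih

variable [MeasurableSpace X] {P : Measure X}

/-- State `k` holds `θ_k` and `θ_{k+1}`, so the previous point of one step is the current point of
the step before and the means telescope. Only the last mean gradient and the one at the starting
point `0` survive. -/
theorem sum_streamElement {t : ℕ} (ht : t < n) :
    ∑ i ∈ Finset.range (t + 1), streamElement grad lmo xs zs i =
      ∑ i ∈ Finset.range (t + 1), streamNoise P grad lmo xs zs i +
        (((t : ℝ) + 2) • meanGrad P grad (fwRun grad lmo xs zs t).cur - meanGrad P grad 0) := by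
  have hdiff : ∀ i (_ : i < n), streamElement grad lmo xs zs i = streamNoise P grad lmo xs zs i +
      (((i : ℝ) + 2) • meanGrad P grad (fwRun grad lmo xs zs i).cur -
        ((i : ℝ) + 1) • meanGrad P grad (fwRun grad lmo xs zs i).prev) := by
    intro i hi
    simp only [streamElement, streamNoise, hi, dif_pos, smul_sub]
    abel
  induction t with
  | zero =>
    rw [Finset.sum_range_one, Finset.sum_range_one, hdiff 0 ht]
    simp [fwRun]
  | succ t ih =>
    rw [Finset.sum_range_succ, ih (by omega), Finset.sum_range_succ _ (t + 1), hdiff (t + 1) ht,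
      fwRun_succ_prev (by omega : t < n)]
    push_cast
    rw [show (t : ℝ) + 1 + 1 = t + 2 by ring]
    abel

/-- The gradient estimate of the algorithm. -/
theorem treeOutput_fwRun (t : ℕ) (ht : t < n) :
    treeOutput (t + 1) (fwRun grad lmo xs zs (t + 1)).tree =
      ∑ i ∈ Finset.range (t + 1), streamNoise P grad lmo xs zs i +
        (((t : ℝ) + 2) • meanGrad P grad (fwRun grad lmo xs zs t).cur - meanGrad P grad 0) +
      ∑ ℓ ∈ Finset.univ.filter (fun ℓ : Fin (Nat.clog 2 n + 1) => (t + 1).testBit ℓ),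
        zs (completionTime (Nat.succ_pos t) ht ℓ) ℓ := by
  have hlt : t + 1 < 2 ^ (Nat.clog 2 n + 1) := by
    have h1 : n ≤ 2 ^ Nat.clog 2 n := Nat.le_pow_clog one_lt_two n
    have h2 : 0 < 2 ^ Nat.clog 2 n := by positivity
    rw [pow_succ]; omega
  rw [fwRun_tree (Nat.succ_le_of_lt ht), treeOutput_treeRun _ _ hlt, sum_streamElement (P := P) ht,
    Finset.sum_filter]
  congr 1
  refine Finset.sum_congr rfl fun ℓ _ => ?_
  split_ifs with h1 h2
  · rfl
  · exact absurd (completionTime (Nat.succ_pos t) ht ℓ).2 h2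
  · rfl

theorem streamNoise_update {k : ℕ} (hk : k < n) (y : X) {j : ℕ} (hj : j < k) :
    streamNoise P grad lmo (Function.update xs ⟨k, hk⟩ y) zs j =
      streamNoise P grad lmo xs zs j := by
  have hjn : j < n := by omega
  have hne : (⟨j, hjn⟩ : Fin n) ≠ ⟨k, hk⟩ := by
    simp only [ne_eq, Fin.mk.injEq]; omega
  simp only [streamNoise, hjn, dif_pos, fwRun_update hk y hj.le, Function.update_of_ne hne]

namespace StochasticProblem

variable {p q : ENNReal} {K : Set (Fin d → ℝ)} {f : (Fin d → ℝ) → X → ℝ}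
  {F : (Fin d → ℝ) → ℝ} {β G L D : ℝ}

theorem cur_sub_prev_le (h : StochasticProblem P p q K f grad F β G L D) (hlmo : ∀ u, lmo u ∈ K)
    {k : ℕ} (hk : k ≤ n) : ((k : ℝ) + 1) *
      ellNorm p ((fwRun grad lmo xs zs k).cur - (fwRun grad lmo xs zs k).prev) ≤ D := by
  cases k with
  | zero => simpa [fwRun, h.isNormFun_p.zero] using h.D_nonneg
  | succ k =>
    rw [fwRun_succ (Nat.lt_of_succ_le hk)]
    simp only [fwStep, add_sub_cancel_left]
    rw [h.isNormFun_p.smul, abs_of_nonneg (by positivity), ← mul_assoc,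
      mul_one_div_cancel (by positivity), one_mul]
    exact h.diam _ (hlmo _) _ (fwRun_mem h.convex h.zero_mem hlmo k).2

/-- The large weight `k + 1` multiplies only differences between consecutive iterates, whose
distance is at most `D / (k + 1)`; a single deviation of weight one remains. -/
theorem streamNoise_le [IsProbabilityMeasure P] (h : StochasticProblem P p q K f grad F β G L D)
    (hlmo : ∀ u, lmo u ∈ K) {k : ℕ} (hk : k < n) :
    ellNorm q (streamNoise P grad lmo xs zs k) ≤ 2 * (β * D + G) := by
  obtain ⟨hp, hc⟩ := fwRun_mem (grad := grad) (xs := xs) (zs := zs) h.convex h.zero_mem hlmo k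
  have hd := h.cur_sub_prev_le (grad := grad) (xs := xs) (zs := zs) hlmo hk.le
  simp only [streamNoise, hk, dif_pos]
  generalize (fwRun grad lmo xs zs k).cur = θ at *
  generalize (fwRun grad lmo xs zs k).prev = θ' at *
  generalize xs ⟨k, hk⟩ = x
  have e : ((k : ℝ) + 2) • (grad θ x - meanGrad P grad θ) -
      ((k : ℝ) + 1) • (grad θ' x - meanGrad P grad θ') =
      ((k : ℝ) + 1) • (grad θ x - grad θ' x) +
        -(((k : ℝ) + 1) • (meanGrad P grad θ - meanGrad P grad θ')) +
        (grad θ x - meanGrad P grad θ) := by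
    module
  have hN := h.isNormFun_q (d := d)
  have h1 := hN.add_le (((k : ℝ) + 1) • (grad θ x - grad θ' x) +
    -(((k : ℝ) + 1) • (meanGrad P grad θ - meanGrad P grad θ'))) (grad θ x - meanGrad P grad θ)
  have h2 := hN.add_le (((k : ℝ) + 1) • (grad θ x - grad θ' x))
    (-(((k : ℝ) + 1) • (meanGrad P grad θ - meanGrad P grad θ')))
  have hk0 : (0 : ℝ) ≤ k + 1 := by positivity
  rw [hN.neg, hN.smul, hN.smul, abs_of_nonneg hk0] at h2
  have h3 := mul_le_mul_of_nonneg_left (h.smooth θ hc θ' hp x) hk0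
  have h4 := mul_le_mul_of_nonneg_left (h.meanGrad_lipschitz hc hp) hk0
  have h5 := mul_le_mul_of_nonneg_left hd h.beta_nonneg
  have h6 := h.grad_sub_meanGrad_le hc x
  rw [e]
  linarith

theorem lipschitz_restrict (h : StochasticProblem P p q K f grad F β G L D)
    {g : (Fin d → ℝ) → Fin d → ℝ}
    (hg : ∀ θ₁ ∈ K, ∀ θ₂ ∈ K, ellNorm q (g θ₁ - g θ₂) ≤ β * ellNorm p (θ₁ - θ₂)) :
    Continuous fun θ : K => g θ := by
  obtain ⟨c, hc0, hc⟩ := h.isNormFun_p.exists_le_mul_norm (d := d)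
  have hβ := h.beta_nonneg
  have : LipschitzWith (β * c).toNNReal fun θ : K => g θ := by
    refine LipschitzWith.of_dist_le_mul fun θ₁ θ₂ => ?_
    rw [Real.coe_toNNReal _ (by positivity), Subtype.dist_eq, dist_eq_norm, dist_eq_norm, mul_assoc]
    exact (norm_le_ellNorm h.one_le_q _).trans ((hg θ₁ θ₁.2 θ₂ θ₂.2).trans
      (mul_le_mul_of_nonneg_left (hc _) hβ))
  exact this.continuous

variable {Ω : Type*} [MeasurableSpace Ω]

/-- Carathéodory: the gradient is Lipschitz in `θ ∈ K` and measurable in the sample, hence jointly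
measurable on `K × X`. -/
theorem measurable_grad_comp (h : StochasticProblem P p q K f grad F β G L D)
    {θ : Ω → Fin d → ℝ} {ξ : Ω → X} (hθ : Measurable θ) (hξ : Measurable ξ) (hK : ∀ ω, θ ω ∈ K) :
    Measurable fun ω => grad (θ ω) (ξ ω) := by
  have h1 : Measurable (Function.uncurry fun (θ : K) x => grad θ x) :=
    measurable_uncurry_of_continuous_of_measurable
      (fun x => h.lipschitz_restrict (g := fun θ => grad θ x)
        fun θ₁ h₁ θ₂ h₂ => h.smooth θ₁ h₁ θ₂ h₂ x) fun θ => h.measurable θ θ.2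
  exact h1.comp ((hθ.subtype_mk (h := hK)).prodMk hξ)

theorem measurable_meanGrad_comp [IsProbabilityMeasure P]
    (h : StochasticProblem P p q K f grad F β G L D)
    {θ : Ω → Fin d → ℝ} (hθ : Measurable θ) (hK : ∀ ω, θ ω ∈ K) :
    Measurable fun ω => meanGrad P grad (θ ω) :=
  (h.lipschitz_restrict fun _ h₁ _ h₂ => h.meanGrad_lipschitz h₁ h₂).measurable.comp
    (hθ.subtype_mk (h := hK))

theorem measurable_fwRun (h : StochasticProblem P p q K f grad F β G L D)
    (hlmo : IsLinMinOracle K lmo) (k : ℕ) :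
    Measurable (fun ω : (Fin n → X) × (Fin n → Fin (Nat.clog 2 n + 1) → (Fin d → ℝ)) =>
        (fwRun grad lmo ω.1 ω.2 k).prev) ∧
      Measurable (fun ω : (Fin n → X) × (Fin n → Fin (Nat.clog 2 n + 1) → (Fin d → ℝ)) =>
        (fwRun grad lmo ω.1 ω.2 k).cur) ∧
      ∀ ℓ j, Measurable (fun ω : (Fin n → X) × (Fin n → Fin (Nat.clog 2 n + 1) → (Fin d → ℝ)) =>
        (fwRun grad lmo ω.1 ω.2 k).tree ℓ j) := by
  induction k with
  | zero => exact ⟨measurable_const, measurable_const, fun _ _ => measurable_const⟩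
  | succ k ih =>
    rcases lt_or_ge k n with hk | hk
    · obtain ⟨hp, hc, ht⟩ := ih
      have hmem := fun ω : (Fin n → X) × (Fin n → Fin (Nat.clog 2 n + 1) → (Fin d → ℝ)) =>
        fwRun_mem (grad := grad) (xs := ω.1) (zs := ω.2) h.convex h.zero_mem
          (fun u => (hlmo.2 u).1) k
      have hx : Measurable fun ω : (Fin n → X) × (Fin n → Fin (Nat.clog 2 n + 1) → (Fin d → ℝ)) =>
          ω.1 ⟨k, hk⟩ := (measurable_pi_apply _).comp measurable_fst
      have hz : ∀ ℓ, Measurable fun ω : (Fin n → X) × (Fin n → Fin (Nat.clog 2 n + 1) →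
          (Fin d → ℝ)) => ω.2 ⟨k, hk⟩ ℓ := fun ℓ =>
        (measurable_pi_apply ℓ).comp ((measurable_pi_apply _).comp measurable_snd)
      have h1 := h.measurable_grad_comp hc hx fun ω => (hmem ω).2
      have h2 := h.measurable_grad_comp hp hx fun ω => (hmem ω).1
      have hg := (h1.fun_const_smul (((k + 1 : ℕ) : ℝ) + 1)).fun_sub
        (h2.fun_const_smul ((k + 1 : ℕ) : ℝ))
      have htree : ∀ ℓ j, Measurable (fun ω : (Fin n → X) × (Fin n → Fin (Nat.clog 2 n + 1) →
          (Fin d → ℝ)) => (fwRun grad lmo ω.1 ω.2 (k + 1)).tree ℓ j) := by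
        intro ℓ j
        simp only [fwRun_succ hk, fwStep, treeUpdate]
        split_ifs
        · exact ((ht ℓ j).fun_add hg).fun_add (hz ℓ)
        · exact ((ht ℓ j).fun_add hg).fun_add measurable_const
        · exact ht ℓ j
      refine ⟨by simpa only [fwRun_succ_prev hk] using hc, ?_, htree⟩
      have hout : Measurable (fun ω : (Fin n → X) × (Fin n → Fin (Nat.clog 2 n + 1) →
          (Fin d → ℝ)) => treeOutput (k + 1) (fwRun grad lmo ω.1 ω.2 (k + 1)).tree) := by
        unfold treeOutput
        refine Finset.measurable_sum _ fun ℓ _ => ?_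
        split_ifs
        · exact htree _ _
        · exact htree _ _
        · exact measurable_const
      have hcur : (fun ω : (Fin n → X) × (Fin n → Fin (Nat.clog 2 n + 1) → (Fin d → ℝ)) =>
          (fwRun grad lmo ω.1 ω.2 (k + 1)).cur) = fun ω => (fwRun grad lmo ω.1 ω.2 k).cur +
            (1 / (((k + 1 : ℕ) : ℝ) + 1)) • (lmo ((1 / (((k + 1 : ℕ) : ℝ) + 1)) •
              treeOutput (k + 1) (fwRun grad lmo ω.1 ω.2 (k + 1)).tree) -
                (fwRun grad lmo ω.1 ω.2 k).cur) := by
        funext ω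
        rw [fwRun_succ hk]; rfl
      rw [hcur]
      exact hc.fun_add (((hlmo.1.comp (hout.fun_const_smul (1 / (((k + 1 : ℕ) : ℝ) + 1)))).fun_sub
        hc).fun_const_smul (1 / (((k + 1 : ℕ) : ℝ) + 1)))
    · simpa only [fwRun_succ_of_le hk] using ih

theorem measurable_streamNoise [IsProbabilityMeasure P]
    (h : StochasticProblem P p q K f grad F β G L D) (hlmo : IsLinMinOracle K lmo) (k : ℕ) :
    Measurable (fun ω : (Fin n → X) × (Fin n → Fin (Nat.clog 2 n + 1) → (Fin d → ℝ)) =>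
      streamNoise P grad lmo ω.1 ω.2 k) := by
  rcases lt_or_ge k n with hk | hk
  · simp only [streamNoise, hk, dif_pos]
    obtain ⟨hp, hc, -⟩ := h.measurable_fwRun (n := n) hlmo k
    have hmem := fun ω : (Fin n → X) × (Fin n → Fin (Nat.clog 2 n + 1) → (Fin d → ℝ)) =>
      fwRun_mem (grad := grad) (xs := ω.1) (zs := ω.2) h.convex h.zero_mem
        (fun u => (hlmo.2 u).1) k
    have hx : Measurable fun ω : (Fin n → X) × (Fin n → Fin (Nat.clog 2 n + 1) → (Fin d → ℝ)) =>
        ω.1 ⟨k, hk⟩ := (measurable_pi_apply _).comp measurable_fst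
    exact (((h.measurable_grad_comp hc hx fun ω => (hmem ω).2).fun_sub
      (h.measurable_meanGrad_comp hc fun ω => (hmem ω).2)).fun_const_smul ((k : ℝ) + 2)).fun_sub
      (((h.measurable_grad_comp hp hx fun ω => (hmem ω).1).fun_sub
      (h.measurable_meanGrad_comp hp fun ω => (hmem ω).1)).fun_const_smul ((k : ℝ) + 1))
  · simp only [streamNoise, hk.not_gt, dif_neg, not_false_eq_true]
    exact measurable_const

/-- The privacy noise influences the iterates but is independent of the samples, so all of its
draws, including future ones, can be frozen and the martingale taken in the samples alone. -/
theorem isBoundedMartingale [IsProbabilityMeasure P]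
    (h : StochasticProblem P p q K f grad F β G L D) (hlmo : IsLinMinOracle K lmo)
    (zs : Fin n → Fin (Nat.clog 2 n + 1) → (Fin d → ℝ)) :
    IsBoundedMartingale P (ellNorm q) (2 * (β * D + G))
      (fun k (xs : Fin n → X) => ∑ i ∈ Finset.range k, streamNoise P grad lmo xs zs i)
      (fun k xs => streamNoise P grad lmo xs zs k) where
  zero xs := by simp
  succ k xs _ := Finset.sum_range_succ _ _
  measurable k _ := (h.measurable_streamNoise hlmo k).comp measurable_prodMk_right
  measurable_sum k _ := Finset.measurable_sum _ fun i _ =>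
    (h.measurable_streamNoise hlmo i).comp measurable_prodMk_right
  adapted k hk xs y := Finset.sum_congr rfl fun i hi =>
    streamNoise_update hk y (Finset.mem_range.1 hi)
  bound k xs hk := h.streamNoise_le (fun u => (hlmo.2 u).1) hk
  mean k hk xs := by
    obtain ⟨hp, hc⟩ := fwRun_mem (grad := grad) (xs := xs) (zs := zs) h.convex h.zero_mem
      (fun u => (hlmo.2 u).1) k
    simp only [streamNoise, hk, dif_pos, fwRun_update hk _ le_rfl, Function.update_self]
    have h0 : ∀ θ ∈ K, ∫ y, (grad θ y - meanGrad P grad θ) ∂P = 0 := by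
      intro θ hθ
      rw [integral_sub (h.integrable_grad hθ) (integrable_const _)]
      simp [meanGrad]
    have hi : ∀ θ ∈ K, Integrable (fun y => grad θ y - meanGrad P grad θ) P := fun θ hθ =>
      (h.integrable_grad hθ).sub (integrable_const _)
    rw [integral_sub ((hi _ hc).fun_smul ((k : ℝ) + 2)) ((hi _ hp).fun_smul ((k : ℝ) + 1)), integral_smul,
      integral_smul, h0 _ hc, h0 _ hp]
    simp

end StochasticProblem

end Run

/-! ### The high-probability bound -/

section HighProbability

variable {d n : ℕ} {X : Type*} [MeasurableSpace X] {P : Measure X} [IsProbabilityMeasure P]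
  {grad : (Fin d → ℝ) → X → (Fin d → ℝ)} {lmo : (Fin d → ℝ) → (Fin d → ℝ)}
  {p q : ENNReal} {K : Set (Fin d → ℝ)} {f : (Fin d → ℝ) → X → ℝ}
  {F : (Fin d → ℝ) → ℝ} {β G L D : ℝ}

/-- The deviations of the gradient stream and of the privacy noise are bounded at all times. -/
def GoodRun (P : Measure X) (grad : (Fin d → ℝ) → X → (Fin d → ℝ))
    (lmo : (Fin d → ℝ) → (Fin d → ℝ)) (M N : (Fin d → ℝ) → ℝ) (A W : ℝ) (xs : Fin n → X)
    (zs : Fin n → Fin (Nat.clog 2 n + 1) → (Fin d → ℝ)) : Prop :=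
  ∀ (t : ℕ) (ht : 1 ≤ t) (htn : t ≤ n),
    M (∑ i ∈ Finset.range t, streamNoise P grad lmo xs zs i) ≤ A * √t ∧
      ∑ ℓ ∈ Finset.univ.filter (fun ℓ : Fin (Nat.clog 2 n + 1) => t.testBit ℓ),
        N (zs (completionTime ht htn ℓ) ℓ) ≤ W

namespace StochasticProblem

theorem risk_le_of_goodRun (h : StochasticProblem P p q K f grad F β G L D)
    (hlmo : IsLinMinOracle K lmo) {N : (Fin d → ℝ) → ℝ} (hN : ∀ z, ellNorm q z ≤ N z) {A W : ℝ}
    (hA : 0 ≤ A) (hW : 0 ≤ W) {xs : Fin n → X}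
    {zs : Fin n → Fin (Nat.clog 2 n + 1) → (Fin d → ℝ)}
    (hgood : GoodRun P grad lmo (ellNorm q) N A W xs zs) {θ' : Fin d → ℝ} (hθ' : θ' ∈ K) {t : ℕ}
    (ht : 1 ≤ t) (htn : t ≤ n) :
    t * (F (fwIterate grad lmo xs zs t) - F θ') ≤
      L * D + 2 * D * A * √t + (D * (L + W) + β * D ^ 2 / 2) * Real.log t := by
  have hq := h.isNormFun_q (d := d)
  have hL := h.L_nonneg
  have hβ := h.beta_nonneg
  let est : ℕ → Fin d → ℝ := fun t =>
    (1 / ((t : ℝ) + 1)) • treeOutput t (fwRun grad lmo xs zs t).tree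
  have hmem : ∀ k, (fwRun grad lmo xs zs k).cur ∈ K := fun k =>
    (fwRun_mem h.convex h.zero_mem (fun u => (hlmo.2 u).1) k).2
  refine frankWolfe_recursion (x := fun t => F (fwIterate grad lmo xs zs t) - F θ')
    (e := fun t => ellNorm q (meanGrad P grad (fwIterate grad lmo xs zs t) - est t))
    (n := n) (A := A) (R := L + W) (c := β * D ^ 2 / 2) h.D_nonneg hA (by positivity)
    (by positivity) (h.risk_zero_sub_le hθ') ?_ ?_ ht htn
  · intro t ht htn
    obtain ⟨k, rfl⟩ := Nat.exists_eq_add_of_le' ht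
    have hk : k < n := by omega
    obtain ⟨g1, g2⟩ := hgood (k + 1) ht hk
    have e1 : meanGrad P grad (fwIterate grad lmo xs zs (k + 1)) - est (k + 1) =
        (1 / ((k : ℝ) + 2)) • -(∑ i ∈ Finset.range (k + 1), streamNoise P grad lmo xs zs i +
          -meanGrad P grad 0 +
          ∑ ℓ ∈ Finset.univ.filter (fun ℓ : Fin (Nat.clog 2 n + 1) => (k + 1).testBit ℓ),
            zs (completionTime ht hk ℓ) ℓ) := by
      have hk2 : (k : ℝ) + 2 ≠ 0 := by positivity
      simp only [est, fwIterate, Nat.add_sub_cancel]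
      rw [treeOutput_fwRun (P := P) k hk]
      generalize ∑ i ∈ Finset.range (k + 1), streamNoise P grad lmo xs zs i = a
      push_cast
      rw [show (k : ℝ) + 1 + 1 = k + 2 by ring]
      simp only [smul_add, smul_sub, smul_neg, neg_add, smul_smul, one_div_mul_cancel hk2, one_smul]
      abel
    simp only [e1]
    rw [hq.smul, hq.neg, abs_of_nonneg (by positivity)]
    have h1 := hq.add_le (∑ i ∈ Finset.range (k + 1), streamNoise P grad lmo xs zs i +
      -meanGrad P grad 0) (∑ ℓ ∈ Finset.univ.filter
        (fun ℓ : Fin (Nat.clog 2 n + 1) => (k + 1).testBit ℓ), zs (completionTime ht hk ℓ) ℓ)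
    have h2 := hq.add_le (∑ i ∈ Finset.range (k + 1), streamNoise P grad lmo xs zs i)
      (-meanGrad P grad 0)
    rw [hq.neg] at h2
    have h3 := h.meanGrad_le h.zero_mem
    have h4 := (hq.sum_le (Finset.univ.filter
      (fun ℓ : Fin (Nat.clog 2 n + 1) => (k + 1).testBit ℓ))
      (fun ℓ => zs (completionTime ht hk ℓ) ℓ)).trans (Finset.sum_le_sum fun ℓ _ => hN _)
    rw [one_div, inv_mul_eq_div]
    push_cast at g1 ⊢
    rw [show (k : ℝ) + 1 + 1 = k + 2 by ring]
    gcongr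
    linarith
  · intro t ht htn
    obtain ⟨k, rfl⟩ := Nat.exists_eq_add_of_le' ht
    have hk : k < n := by omega
    have e1 : fwIterate grad lmo xs zs (k + 1 + 1) = fwIterate grad lmo xs zs (k + 1) +
        (1 / (((k + 1 : ℕ) : ℝ) + 1)) • (lmo (est (k + 1)) - fwIterate grad lmo xs zs (k + 1)) := by
      simp only [fwIterate, Nat.add_sub_cancel, est]
      rw [fwRun_succ hk]; rfl
    rw [e1]
    refine h.frankWolfe_step hlmo (hmem _) hθ' _ (by positivity) ?_
    rw [div_le_one (by positivity)]
    linarith [(Nat.cast_nonneg (k + 1) : (0 : ℝ) ≤ ((k + 1 : ℕ) : ℝ))]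

theorem measure_goodRun (h : StochasticProblem P p q K f grad F β G L D)
    (hlmo : IsLinMinOracle K lmo) {N : (Fin d → ℝ) → ℝ} {κ σ α : ℝ}
    (hreg : IsRegularNorm (ellNorm q) N κ) (hσ : 0 ≤ σ) (hn : 1 ≤ n) (hα : 0 < α) (hα1 : α < 1) :
    ENNReal.ofReal (1 - α) ≤ runLaw n P N σ {ω | GoodRun P grad lmo (ellNorm q) N
      (2 * (β * D + G) * (√κ + √(2 * Real.log (2 * n / α))))
      (2 * σ * √((Nat.clog 2 n + 1 : ℝ) * (d * (Nat.clog 2 n + 1 : ℝ) + Real.log (2 * n / α))))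
      ω.1 ω.2} := by
  have hq := h.isNormFun_q (d := d)
  have hNn := hreg.1
  have hqN : ∀ z, ellNorm q z ≤ N z := by
    obtain ⟨-, κ₁, -, -, -, hMN⟩ := hreg
    exact fun z => (sq_le_sq₀ (hq.nonneg z) (hNn.nonneg z)).1 (hMN z).1
  have hle : ∀ z, ‖z‖ ≤ N z := fun z => (norm_le_ellNorm h.one_le_q z).trans (hqN z)
  have hprob := isProbabilityMeasure_genGaussian hNn hle σ
  have hn' : (1 : ℝ) ≤ n := by exact_mod_cast hn
  set u := Real.log (2 * n / α) with hu
  have hbig : 1 < 2 * n / α := by rw [one_lt_div hα]; linarith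
  have hu0 : 0 < u := Real.log_pos hbig
  have hexp : Real.exp (-u) = α / (2 * n) := by
    rw [hu, Real.exp_neg, Real.exp_log (by linarith), inv_div]
  have hB : 0 ≤ 2 * (β * D + G) := by
    have := h.beta_nonneg
    have := h.D_nonneg
    have := h.G_nonneg
    positivity
  set A := 2 * (β * D + G) * (√κ + √(2 * u)) with hA
  set W := 2 * σ * √((Nat.clog 2 n + 1 : ℝ) * (d * (Nat.clog 2 n + 1 : ℝ) + u)) with hW
  let μ := runLaw n P N σ
  have hμ : IsProbabilityMeasure μ := by
    simp only [μ, runLaw]; infer_instance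
  let bad₁ : ℕ → Set ((Fin n → X) × (Fin n → Fin (Nat.clog 2 n + 1) → (Fin d → ℝ))) := fun t =>
    {ω | A * √t < ellNorm q (∑ i ∈ Finset.range t, streamNoise P grad lmo ω.1 ω.2 i)}
  have hbad₁ : ∀ t, t ≤ n → μ (bad₁ t) ≤ ENNReal.ofReal (α / (2 * n)) := by
    intro t ht
    have hmeas : MeasurableSet (bad₁ t) := by
      refine measurableSet_lt measurable_const ((continuous_ellNorm h.one_le_q).measurable.comp ?_)
      exact Finset.measurable_sum _ fun i _ => h.measurable_streamNoise hlmo i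
    simp only [μ, runLaw]
    -- Fubini with the noise outermost: the Azuma bound holds uniformly in the frozen draws.
    rw [Measure.prod_apply_symm hmeas]
    refine (lintegral_mono (g := fun _ => ENNReal.ofReal (α / (2 * n))) fun zs => ?_).trans_eq
      (by simp)
    have h1 := (h.isBoundedMartingale hlmo zs).measure_gt_le hq (norm_le_ellNorm h.one_le_q) hreg
      hB hu0 ht
    rw [hexp] at h1
    have e : 2 * (β * D + G) * √t * (√κ + √(2 * u)) = A * √t := by rw [hA]; ring
    rw [e] at h1
    exact h1
  let bad₂ : (t : ℕ) → 1 ≤ t ∧ t ≤ n → Set (Fin n → Fin (Nat.clog 2 n + 1) → (Fin d → ℝ)) :=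
    fun t ht => {zs | W < ∑ ℓ ∈ Finset.univ.filter
      (fun ℓ : Fin (Nat.clog 2 n + 1) => t.testBit ℓ), N (zs (completionTime ht.1 ht.2 ℓ) ℓ)}
  have hbad₂ : ∀ t ht, μ (Prod.snd ⁻¹' bad₂ t ht) ≤ ENNReal.ofReal (α / (2 * n)) := by
    intro t ht
    have h1 := measure_sum_noise_gt_le hNn hle hσ (Finset.univ.filter
      (fun ℓ : Fin (Nat.clog 2 n + 1) => t.testBit ℓ)) (fun ℓ => completionTime ht.1 ht.2 ℓ)
      (c := (Nat.clog 2 n + 1 : ℝ)) (by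
        exact_mod_cast (Finset.card_filter_le _ _).trans_eq (by simp)) hu0.le
    rw [hexp] at h1
    refine le_trans (le_of_eq ?_) h1
    simp only [μ, runLaw]
    rw [← Set.univ_prod, Measure.prod_prod, measure_univ, one_mul]
  -- Covering the whole space avoids having to know that the good event is measurable. The `2n` bad
  -- events have probability at most `α / (2n)` each.
  have hcover : (Set.univ : Set ((Fin n → X) × (Fin n → Fin (Nat.clog 2 n + 1) → (Fin d → ℝ)))) ⊆
      {ω | GoodRun P grad lmo (ellNorm q) N A W ω.1 ω.2} ∪
        ⋃ t ∈ Finset.Icc 1 n, (bad₁ t ∪ ⋃ ht : 1 ≤ t ∧ t ≤ n, Prod.snd ⁻¹' bad₂ t ht) := by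
    intro ω _
    by_cases hω : GoodRun P grad lmo (ellNorm q) N A W ω.1 ω.2
    · exact Or.inl hω
    · right
      unfold GoodRun at hω
      push Not at hω
      obtain ⟨t, ht, htn, hcase⟩ := hω
      rw [Set.mem_iUnion₂]
      refine ⟨t, Finset.mem_Icc.2 ⟨ht, htn⟩, ?_⟩
      by_cases h1 : ω ∈ bad₁ t
      · exact Or.inl h1
      · right
        rw [Set.mem_iUnion]
        exact ⟨⟨ht, htn⟩, hcase (not_lt.1 h1)⟩
  have htot : μ (⋃ t ∈ Finset.Icc 1 n, (bad₁ t ∪ ⋃ ht : 1 ≤ t ∧ t ≤ n, Prod.snd ⁻¹' bad₂ t ht)) ≤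
      ENNReal.ofReal α := by
    refine (measure_biUnion_finset_le _ _).trans ?_
    calc ∑ t ∈ Finset.Icc 1 n, μ (bad₁ t ∪ ⋃ ht : 1 ≤ t ∧ t ≤ n, Prod.snd ⁻¹' bad₂ t ht)
        ≤ ∑ _t ∈ Finset.Icc 1 n, ENNReal.ofReal (α / n) := by
          refine Finset.sum_le_sum fun t ht => (measure_union_le _ _).trans ?_
          have ht' := Finset.mem_Icc.1 ht
          have e : (⋃ ht : 1 ≤ t ∧ t ≤ n, Prod.snd ⁻¹' bad₂ t ht :
              Set ((Fin n → X) × (Fin n → Fin (Nat.clog 2 n + 1) → (Fin d → ℝ)))) =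
              Prod.snd ⁻¹' bad₂ t ht' := by
            simp [ht']
          rw [e]
          refine (add_le_add (hbad₁ t ht'.2) (hbad₂ t ht')).trans_eq ?_
          rw [← ENNReal.ofReal_add (by positivity) (by positivity)]
          congr 1
          field_simp; ring
      _ = ENNReal.ofReal α := by
          rw [Finset.sum_const, Nat.card_Icc, Nat.add_sub_cancel, nsmul_eq_mul,
            ← ENNReal.ofReal_natCast, ← ENNReal.ofReal_mul (by positivity)]
          congr 1
          field_simp
  have h1 := (measure_mono (μ := μ) hcover).trans (measure_union_le _ _)
  rw [measure_univ] at h1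
  rw [ENNReal.ofReal_sub _ hα.le, ENNReal.ofReal_one, tsub_le_iff_right]
  exact h1.trans (by gcongr)

end StochasticProblem

end HighProbability

/-! ### The rates -/

section Rates

theorem one_lt_log_three : 1 < Real.log 3 := by
  rw [Real.lt_log_iff_exp_lt (by norm_num)]
  exact Real.exp_one_lt_d9.trans (by norm_num)

/-- This is where `n ≥ 3` matters: `log (log n / α)` stays bounded away from `0`, so the noise term
of the rate can absorb constants. -/
theorem log_log_three_pos : 0 < Real.log (Real.log 3) := Real.log_pos one_lt_log_three

theorem log_log_three_le_one : Real.log (Real.log 3) ≤ 1 := by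
  have h1 : Real.log 3 ≤ 3 - 1 := Real.log_le_sub_one_of_pos (by norm_num)
  have h2 : Real.log (Real.log 3) ≤ Real.log 3 - 1 :=
    Real.log_le_sub_one_of_pos (by linarith [one_lt_log_three])
  linarith

theorem clog_add_one_le_log {n : ℕ} (hn : 3 ≤ n) : (Nat.clog 2 n + 1 : ℝ) ≤ 4 * Real.log n := by
  have hn' : (3 : ℝ) ≤ n := by exact_mod_cast hn
  have hlog : Real.log 3 ≤ Real.log n := Real.log_le_log (by norm_num) hn'
  have h3 := one_lt_log_three
  have h1 : 2 ^ (Nat.clog 2 n - 1) < n := Nat.pow_pred_clog_lt_self one_lt_two (by omega)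
  have h2 : ((2 : ℝ) ^ (Nat.clog 2 n - 1)) < n := by exact_mod_cast h1
  have h4 := Real.log_lt_log (by positivity) h2
  rw [Real.log_pow] at h4
  have h5 : (Nat.clog 2 n : ℝ) ≤ ((Nat.clog 2 n - 1 : ℕ) : ℝ) + 1 := by
    exact_mod_cast (by omega : Nat.clog 2 n ≤ Nat.clog 2 n - 1 + 1)
  have h6 := Real.log_two_gt_d9
  have h7 : (0 : ℝ) ≤ ((Nat.clog 2 n - 1 : ℕ) : ℝ) := by positivity
  nlinarith

theorem three_le_clog_add_one {n : ℕ} (hn : 3 ≤ n) : (3 : ℝ) ≤ Nat.clog 2 n + 1 := by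
  have h1 : 1 < Nat.clog 2 n := (Nat.lt_clog_iff_pow_lt one_lt_two).2 (by omega)
  have : (2 : ℝ) ≤ Nat.clog 2 n := by exact_mod_cast h1
  linarith

theorem clog_add_one_le {n : ℕ} (hn : 3 ≤ n) : (Nat.clog 2 n + 1 : ℝ) ≤ n := by
  have h1 : Nat.clog 2 n ≤ n - 1 := by
    refine Nat.clog_le_of_le_pow ?_
    have := Nat.lt_two_pow_self (n := n - 1)
    omega
  exact_mod_cast (by omega : Nat.clog 2 n + 1 ≤ n)

theorem log_clog_div_ge_one {n : ℕ} (hn : 3 ≤ n) {δ : ℝ} (hδ : 0 < δ) (hδ1 : δ < 1) :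
    1 ≤ Real.log ((Nat.clog 2 n + 1 : ℝ) / δ) := by
  refine one_lt_log_three.le.trans (Real.log_le_log (by norm_num) ?_)
  rw [le_div_iff₀ hδ]
  nlinarith [three_le_clog_add_one hn]

/-- All factors of `σ_+` other than `(βD + L)/ε` are at least one. This lets the noise term absorb
the terms in `L`, at a cost proportional to `ε`. -/
theorem le_sigmaPlus {n : ℕ} (hn : 3 ≤ n) {κ β D L ε δ : ℝ} (hκ : 1 ≤ κ) (hβD : 0 ≤ β * D)
    (hL : 0 ≤ L) (hε : 0 < ε) (hδ : 0 < δ) (hδ1 : δ < 1) : L ≤ ε * sigmaPlus n κ β D L ε δ := by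
  have h1 := three_le_clog_add_one hn
  have h2 := log_clog_div_ge_one hn hδ hδ1
  have h3 : L / ε ≤ sigmaPlus n κ β D L ε δ := by
    refine Real.le_sqrt_of_sq_le ?_
    rw [div_pow]
    gcongr
    have h4 : L ^ 2 ≤ (β * D + L) ^ 2 := by gcongr; linarith
    have h5 : 1 ≤ 8 * ((Nat.clog 2 n : ℝ) + 1) ^ 2 * κ *
        Real.log (((Nat.clog 2 n : ℝ) + 1) / δ) := by
      have : (1 : ℝ) ≤ 8 * ((Nat.clog 2 n : ℝ) + 1) ^ 2 := by nlinarith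
      exact one_le_mul_of_one_le_of_one_le (one_le_mul_of_one_le_of_one_le this hκ) h2
    nlinarith [sq_nonneg (β * D + L)]
  rw [div_le_iff₀ hε] at h3
  linarith

theorem sigmaPlus_le {n : ℕ} (hn : 3 ≤ n) {κ β D L ε δ α : ℝ} (hκ : 1 ≤ κ) (hβD : 0 ≤ β * D)
    (hL : 0 ≤ L) (hε : 0 < ε) (hδ : 0 < δ) (hδ1 : δ < 1) (hα : 0 < α) (hα1 : α < 1) :
    sigmaPlus n κ β D L ε δ ≤ 12 * Real.log n * √κ * √(Real.log (n / (α * δ))) *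
      ((β * D + L) / ε) := by
  have h1 := three_le_clog_add_one hn
  have h2 := log_clog_div_ge_one hn hδ hδ1
  have hlog : Real.log (((Nat.clog 2 n : ℝ) + 1) / δ) ≤ Real.log (n / (α * δ)) := by
    refine Real.log_le_log (by positivity) ?_
    rw [div_le_div_iff₀ hδ (by positivity)]
    have h3 := clog_add_one_le hn
    have h4 : ((Nat.clog 2 n : ℝ) + 1) * α ≤ n := by nlinarith
    nlinarith
  have hc := clog_add_one_le_log hn
  have hln : 0 ≤ Real.log n := by linarith
  have hΛ : 0 ≤ Real.log (n / (α * δ)) := by linarith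
  refine Real.sqrt_le_iff.2 ⟨by positivity, ?_⟩
  rw [mul_pow, mul_pow, mul_pow, mul_pow, Real.sq_sqrt (by linarith), Real.sq_sqrt hΛ, div_pow,
    mul_div_assoc]
  have h5 : 8 * ((Nat.clog 2 n : ℝ) + 1) ^ 2 ≤ 12 ^ 2 * Real.log n ^ 2 := by
    have := pow_le_pow_left₀ (by positivity) hc 2
    nlinarith [sq_nonneg (Real.log n)]
  gcongr

/-- The constant of the general convergence guarantee. -/
noncomputable def rateConst (ε₀ : ℝ) : ℝ :=
  8 + (2 * √(28 / Real.log (Real.log 3)) + ε₀ / √(Real.log (Real.log 3)))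

theorem log_div_eq {a b : ℝ} (ha : 0 < a) (hb : 0 < b) :
    Real.log (a / b) = Real.log a + -Real.log b := by
  rw [Real.log_div ha.ne' hb.ne', sub_eq_add_neg]

theorem noise_le {d n : ℕ} (hd : 1 ≤ d) (hn : 3 ≤ n) {σ α : ℝ} (hσ : 0 ≤ σ) (hα : 0 < α)
    (hα1 : α < 1) :
    2 * σ * √((Nat.clog 2 n + 1 : ℝ) * (d * (Nat.clog 2 n + 1 : ℝ) + Real.log (2 * n / α))) ≤
      2 * √(28 / Real.log (Real.log 3)) *
        (σ * √(d * Real.log (Real.log n / α)) * Real.log n) := by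
  have hn' : (3 : ℝ) ≤ n := by exact_mod_cast hn
  have hd' : (1 : ℝ) ≤ d := by exact_mod_cast hd
  have hlog : Real.log 3 ≤ Real.log n := Real.log_le_log (by norm_num) hn'
  have h3 := one_lt_log_three
  have hc := clog_add_one_le_log hn
  have ha0 := log_log_three_pos
  have ha1 := log_log_three_le_one
  have hloglog : Real.log (Real.log 3) ≤ Real.log (Real.log n) :=
    Real.log_le_log (by linarith) hlog
  have hla : 0 ≤ -Real.log α := by linarith [Real.log_neg hα hα1]
  have e1 := log_div_eq (by linarith : 0 < Real.log n) hα
  have e2 : Real.log (2 * n / α) = Real.log 2 + Real.log n + -Real.log α := by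
    rw [log_div_eq (by linarith) hα, Real.log_mul (by norm_num) (by linarith)]
  have h2 : Real.log 2 ≤ Real.log n := Real.log_le_log (by norm_num) (by linarith)
  have hl2 : 0 < Real.log 2 := Real.log_pos (by norm_num)
  rw [e1, e2]
  set l := Real.log n
  set a₀ := Real.log (Real.log 3)
  set la := -Real.log α
  set Λ := Real.log l + la with hΛ
  have hΛ0 : 1 ≤ Λ / a₀ := by rw [one_le_div ha0]; linarith
  have hΛ1 : la ≤ Λ := by linarith
  have hΛ2 : Λ ≤ Λ / a₀ := by
    rw [le_div_iff₀ ha0]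
    nlinarith
  set c : ℝ := Nat.clog 2 n + 1 with hcdef
  have hc0 : 0 ≤ c := by positivity
  have key : c * (d * c + (Real.log 2 + l + la)) ≤ 28 / a₀ * (d * Λ) * l ^ 2 := by
    -- The constant is `28 = 16 + 12`: `(4l)²` from `c ≤ 4 log n`, and `4l` times the three terms of
    -- `b2`, each at most `l * r`. The ratio `r ≥ 1` serves as a common majorant.
    set r := Λ / a₀ with hr
    have e : 28 / a₀ * (d * Λ) * l ^ 2 = 28 * (d * r * l ^ 2) := by rw [hr]; ring
    rw [e]
    have b1 : c * (d * c) ≤ 16 * (d * r * l ^ 2) := by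
      have : c * c ≤ (4 * l) * (4 * l) := by gcongr
      calc c * (d * c) = d * (c * c) := by ring
        _ ≤ d * ((4 * l) * (4 * l)) := by gcongr
        _ = 16 * (d * 1 * l ^ 2) := by ring
        _ ≤ 16 * (d * r * l ^ 2) := by gcongr
    have b2 : Real.log 2 + l + la ≤ 3 * (l * r) := by
      have : l ≤ l * r := by nlinarith
      have : r ≤ l * r := by nlinarith
      linarith
    have b3 : c * (Real.log 2 + l + la) ≤ 12 * (d * r * l ^ 2) := by
      calc c * (Real.log 2 + l + la) ≤ (4 * l) * (3 * (l * r)) := by gcongr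
        _ = 12 * (1 * r * l ^ 2) := by ring
        _ ≤ 12 * (d * r * l ^ 2) := by gcongr
    linarith
  have h4 := Real.sqrt_le_sqrt key
  have e3 : √(28 / a₀ * (d * Λ) * l ^ 2) = √(28 / a₀) * √(d * Λ) * l := by
    have : 0 ≤ Λ := by linarith
    rw [Real.sqrt_mul (by positivity), Real.sqrt_sq (by linarith), Real.sqrt_mul (by positivity)]
  rw [e3] at h4
  calc 2 * σ * √(c * (d * c + (Real.log 2 + l + la)))
      ≤ 2 * σ * (√(28 / a₀) * √(d * Λ) * l) := by gcongr
    _ = _ := by ring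

theorem rate_of_recursion {d n : ℕ} (hd : 1 ≤ d) (hn : 3 ≤ n) {ε₀ ε δ α κ β D G L x : ℝ}
    (hε : 0 < ε) (hε₀ : ε ≤ ε₀) (hδ : 0 < δ) (hδ1 : δ < 1) (hα : 0 < α) (hα1 : α < 1) (hκ : 1 ≤ κ)
    (hβ : 0 ≤ β) (hD : 0 ≤ D) (hG : 0 ≤ G) (hL : 0 ≤ L) {t : ℕ} (ht : 1 ≤ t)
    (hx : t * x ≤ L * D + 2 * D * (2 * (β * D + G) * (√κ + √(2 * Real.log (2 * n / α)))) * √t +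
      (D * (L + 2 * sigmaPlus n κ β D L ε δ * √((Nat.clog 2 n + 1 : ℝ) *
        (d * (Nat.clog 2 n + 1 : ℝ) + Real.log (2 * n / α)))) + β * D ^ 2 / 2) * Real.log t) :
    x ≤ rateConst ε₀ * (D * (β * D + G) * (√κ + √(Real.log (n / α))) / √t +
      (1 + Real.log t) * (β * D ^ 2 + D * sigmaPlus n κ β D L ε δ *
        √(d * Real.log (Real.log n / α)) * Real.log n) / t) := by
  have hn' : (3 : ℝ) ≤ n := by exact_mod_cast hn
  have hd' : (1 : ℝ) ≤ d := by exact_mod_cast hd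
  have ht' : (1 : ℝ) ≤ t := by exact_mod_cast ht
  have hlogt : 0 ≤ Real.log t := Real.log_nonneg ht'
  have hlog : Real.log 3 ≤ Real.log n := Real.log_le_log (by norm_num) hn'
  have h3 := one_lt_log_three
  have ha0 := log_log_three_pos
  have hσ : 0 ≤ sigmaPlus n κ β D L ε δ := Real.sqrt_nonneg _
  have hW := noise_le hd hn hσ hα hα1
  have hLσ := le_sigmaPlus hn hκ (mul_nonneg hβ hD) hL hε hδ hδ1
  set σ := sigmaPlus n κ β D L ε δ
  have hΛ : Real.log (Real.log 3) ≤ Real.log (Real.log n / α) := by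
    refine Real.log_le_log (by linarith) ?_
    rw [le_div_iff₀ hα]
    nlinarith
  have hsqrt : √(Real.log (Real.log 3)) ≤ √(d * Real.log (Real.log n / α)) :=
    Real.sqrt_le_sqrt (by nlinarith)
  set a₀ := Real.log (Real.log 3)
  have hsa : 0 < √a₀ := Real.sqrt_pos.2 ha0
  set W := 2 * σ * √((Nat.clog 2 n + 1 : ℝ) * (d * (Nat.clog 2 n + 1 : ℝ) +
    Real.log (2 * n / α))) with hWdef
  set s := √(d * Real.log (Real.log n / α))
  set Q := σ * s * Real.log n with hQ
  have hQ0 : 0 ≤ Q := mul_nonneg (mul_nonneg hσ (Real.sqrt_nonneg _)) (by linarith)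
  have hLQ : L ≤ ε₀ / √a₀ * Q := by
    have h4 : σ * √a₀ ≤ Q := by
      calc σ * √a₀ ≤ σ * s := by gcongr
        _ = σ * s * 1 := by ring
        _ ≤ Q := mul_le_mul_of_nonneg_left (by linarith) (mul_nonneg hσ (Real.sqrt_nonneg _))
    have h5 : L ≤ ε₀ * σ := hLσ.trans (by gcongr)
    calc L ≤ ε₀ * σ := h5
      _ = ε₀ / √a₀ * (σ * √a₀) := by field_simp
      _ ≤ ε₀ / √a₀ * Q := by
        have : 0 ≤ ε₀ := by linarith
        gcongr
  set C₀ := 2 * √(28 / a₀) + ε₀ / √a₀ with hC₀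
  have hC₀0 : 0 ≤ C₀ := by
    have : 0 ≤ ε₀ := by linarith
    positivity
  have hLW : L + W ≤ C₀ * Q := by
    rw [hC₀, add_mul]; linarith
  have hu : √(2 * Real.log (2 * n / α)) ≤ 2 * √(Real.log (n / α)) := by
    have h4 : 2 * Real.log (2 * n / α) ≤ 2 ^ 2 * Real.log (n / α) := by
      have e : (2 * n / α) = 2 * (n / α) := by ring
      have h5 : Real.log 2 ≤ Real.log (n / α) := by
        refine Real.log_le_log (by norm_num) ?_
        rw [le_div_iff₀ hα]; nlinarith
      rw [e, Real.log_mul (by norm_num) (by positivity)]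
      linarith
    refine (Real.sqrt_le_sqrt h4).trans_eq ?_
    rw [Real.sqrt_mul (by norm_num), Real.sqrt_sq (by norm_num)]
  have hW0 : 0 ≤ W := by positivity
  set T₁ := D * (β * D + G) * (√κ + √(Real.log (n / α))) with hT₁
  have hT₁0 : 0 ≤ T₁ := by positivity
  -- The `8` is `2 · 2` from the recursion and the increment bound, times `2` for replacing `√(2
  -- log(2n/α))` by `√log(n/α)`.
  have hA : 2 * D * (2 * (β * D + G) * (√κ + √(2 * Real.log (2 * n / α)))) ≤ 8 * T₁ := by
    have h4 : √κ + √(2 * Real.log (2 * n / α)) ≤ 2 * (√κ + √(Real.log (n / α))) := by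
      linarith [Real.sqrt_nonneg κ]
    calc 2 * D * (2 * (β * D + G) * (√κ + √(2 * Real.log (2 * n / α))))
        ≤ 2 * D * (2 * (β * D + G) * (2 * (√κ + √(Real.log (n / α))))) := by gcongr
      _ = 8 * T₁ := by rw [hT₁]; ring
  have e1 : β * D ^ 2 + D * σ * s * Real.log n = β * D ^ 2 + D * Q := by rw [hQ]; ring
  have e2 : rateConst ε₀ = 8 + C₀ := rfl
  rw [e1, e2]
  have hDQ : D * (L + W) ≤ C₀ * (D * Q) := by
    calc D * (L + W) ≤ D * (C₀ * Q) := by gcongr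
      _ = C₀ * (D * Q) := by ring
  have hDQ0 : 0 ≤ D * Q := mul_nonneg hD hQ0
  have hLD : L * D ≤ C₀ * (D * Q) := by
    linarith [mul_nonneg hD hW0]
  have hβD : 0 ≤ β * D ^ 2 := by positivity
  have hmain : t * x ≤ (8 + C₀) * (T₁ * √t + (1 + Real.log t) * (β * D ^ 2 + D * Q)) := by
    have c1 := mul_le_mul_of_nonneg_right hA (Real.sqrt_nonneg (t : ℝ))
    have c2 := mul_le_mul_of_nonneg_right hDQ hlogt
    have c3 : 0 ≤ C₀ * (T₁ * √t) := by positivity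
    have c4 : 0 ≤ β * D ^ 2 * Real.log t := by positivity
    have c5 : 0 ≤ D * Q * Real.log t := by positivity
    have c6 : 0 ≤ C₀ * (β * D ^ 2 * Real.log t) := by positivity
    have c7 : 0 ≤ C₀ * (β * D ^ 2) := by positivity
    have c8 : (8 + C₀) * (T₁ * √t + (1 + Real.log t) * (β * D ^ 2 + D * Q)) =
        8 * T₁ * √t + C₀ * (T₁ * √t) + 8 * (β * D ^ 2) + 8 * (D * Q) + 8 * (β * D ^ 2 * Real.log t) +
          8 * (D * Q * Real.log t) + C₀ * (β * D ^ 2) + C₀ * (D * Q) +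
          C₀ * (β * D ^ 2 * Real.log t) + C₀ * (D * Q) * Real.log t := by ring
    rw [add_mul] at hx
    rw [c8]
    linarith
  have ht0 : (0 : ℝ) < t := by linarith
  have hst : √(t : ℝ) * √t = t := Real.mul_self_sqrt ht0.le
  have hst0 : 0 < √(t : ℝ) := Real.sqrt_pos.2 ht0
  have e3 : T₁ / √t = T₁ * √t / t := by
    rw [div_eq_div_iff hst0.ne' ht0.ne', mul_assoc T₁, hst]
  rw [e3, ← add_div, ← mul_div_assoc, le_div_iff₀ ht0]
  linarith

/-- The fourth power counts logarithms in the noise term: one from `1 + log t`, one and a half from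
`σ_+`, a half from `√(d log(log n/α))` and one from `log n`. The constant is `24 = 2 · 12`. -/
theorem rate_le_poly_log {d n : ℕ} (hd : 1 ≤ d) (hn : 3 ≤ n) {ε δ α κ β D G L : ℝ} (hε : 0 < ε)
    (hδ : 0 < δ) (hδ1 : δ < 1) (hα : 0 < α) (hα1 : α < 1) (hκ : 1 ≤ κ) (hβ : 0 ≤ β) (hD : 0 ≤ D)
    (hG : 0 ≤ G) (hL : 0 ≤ L) {t : ℕ} (ht : 1 ≤ t) (htn : t ≤ n) :
    D * (β * D + G) * (√κ + √(Real.log (n / α))) / √t +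
      (1 + Real.log t) * (β * D ^ 2 + D * sigmaPlus n κ β D L ε δ *
        √(d * Real.log (Real.log n / α)) * Real.log n) / t ≤
      24 * (√κ * (D * (β * D + G + L)) * Real.log (n / (α * δ)) ^ 4 *
        (1 / √t + √d / (t * ε))) := by
  have hn' : (3 : ℝ) ≤ n := by exact_mod_cast hn
  have hd' : (1 : ℝ) ≤ d := by exact_mod_cast hd
  have ht' : (1 : ℝ) ≤ t := by exact_mod_cast ht
  have htn' : (t : ℝ) ≤ n := by exact_mod_cast htn
  have hlogt : 0 ≤ Real.log t := Real.log_nonneg ht'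
  have hlogtn : Real.log t ≤ Real.log n := Real.log_le_log (by linarith) htn'
  have hlog : Real.log 3 ≤ Real.log n := Real.log_le_log (by norm_num) hn'
  have h3 := one_lt_log_three
  have hσ := sigmaPlus_le hn hκ (mul_nonneg hβ hD) hL hε hδ hδ1 hα hα1
  have hαδ : α * δ ≤ α := by nlinarith
  have hαδ0 : 0 < α * δ := by positivity
  have hnα : n / α ≤ n / (α * δ) := div_le_div_of_nonneg_left (by linarith) hαδ0 hαδ
  have hn1 : (n : ℝ) ≤ n / α := by rw [le_div_iff₀ hα]; nlinarith
  have l1 : Real.log (n / α) ≤ Real.log (n / (α * δ)) := Real.log_le_log (by positivity) hnα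
  have l2 : Real.log n ≤ Real.log (n / α) := Real.log_le_log (by positivity) hn1
  have l3 : Real.log (Real.log n / α) ≤ Real.log (n / (α * δ)) := by
    refine Real.log_le_log (div_pos (by linarith) hα) (le_trans ?_ hnα)
    gcongr
    exact Real.log_le_self (by linarith)
  set Λ := Real.log (n / (α * δ))
  have hΛ1 : 1 ≤ Λ := by linarith
  have hΛ0 : 0 ≤ Λ := by linarith
  have hsΛ : √Λ * √Λ = Λ := Real.mul_self_sqrt hΛ0
  have hsΛ1 : √Λ ≤ Λ := Real.sqrt_le_self_iff.2 (Or.inr hΛ1)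
  have hκ1 : 1 ≤ √κ := Real.one_le_sqrt.2 hκ
  have ht0 : (0 : ℝ) < t := by linarith
  have hst0 : 0 < √(t : ℝ) := Real.sqrt_pos.2 ht0
  have hstt : √(t : ℝ) ≤ t := Real.sqrt_le_self_iff.2 (Or.inr ht')
  have hΛ4 : Λ ≤ Λ ^ 4 := le_self_pow₀ hΛ1 (by norm_num)
  set E := β * D + G + L with hE
  have hβD : 0 ≤ β * D := mul_nonneg hβ hD
  have hE0 : 0 ≤ E := by positivity
  have t1 : D * (β * D + G) * (√κ + √(Real.log (n / α))) / √t ≤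
      2 * (√κ * (D * E) * Λ ^ 4 * (1 / √t)) := by
    have a1 : √κ + √(Real.log (n / α)) ≤ 2 * (√κ * Λ ^ 4) := by
      have b1 : √(Real.log (n / α)) ≤ Λ ^ 4 :=
        ((Real.sqrt_le_sqrt l1).trans hsΛ1).trans hΛ4
      have b2 : 1 ≤ Λ ^ 4 := hΛ1.trans hΛ4
      nlinarith
    have a2 : β * D + G ≤ E := by linarith
    calc D * (β * D + G) * (√κ + √(Real.log (n / α))) / √t
        ≤ D * E * (2 * (√κ * Λ ^ 4)) / √t := by gcongr
      _ = _ := by ring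
  have hlt : 1 + Real.log t ≤ 2 * Λ := by linarith
  have t2 : (1 + Real.log t) * (β * D ^ 2) / t ≤ 2 * (√κ * (D * E) * Λ ^ 4 * (1 / √t)) := by
    have a1 : β * D ^ 2 ≤ D * E := by
      have : β * D ≤ E := by linarith
      nlinarith
    calc (1 + Real.log t) * (β * D ^ 2) / t ≤ (2 * Λ ^ 4) * (D * E) / √t := by
          gcongr
          linarith
      _ = 2 * (1 * (D * E) * Λ ^ 4 * (1 / √t)) := by ring
      _ ≤ 2 * (√κ * (D * E) * Λ ^ 4 * (1 / √t)) := by gcongr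
  have t3 : (1 + Real.log t) * (D * sigmaPlus n κ β D L ε δ *
      √(d * Real.log (Real.log n / α)) * Real.log n) / t ≤
      24 * (√κ * (D * E) * Λ ^ 4 * (√d / (t * ε))) := by
    have a1 : √(d * Real.log (Real.log n / α)) ≤ √d * √Λ := by
      rw [← Real.sqrt_mul (by positivity)]
      exact Real.sqrt_le_sqrt (by gcongr)
    have a2 : sigmaPlus n κ β D L ε δ ≤ 12 * Λ * √κ * √Λ * (E / ε) := by
      refine hσ.trans ?_
      have b1 : β * D + L ≤ E := by linarith
      have b2 : Real.log n ≤ Λ := by linarith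
      gcongr
    have a3 : Real.log n ≤ Λ := by linarith
    have a4 : 0 ≤ sigmaPlus n κ β D L ε δ := Real.sqrt_nonneg _
    have a5 : 0 ≤ Real.log n := by linarith
    calc (1 + Real.log t) * (D * sigmaPlus n κ β D L ε δ *
          √(d * Real.log (Real.log n / α)) * Real.log n) / t
        ≤ (2 * Λ) * (D * (12 * Λ * √κ * √Λ * (E / ε)) * (√d * √Λ) * Λ) / t := by gcongr
      _ = 24 * (√κ * (D * E) * (Λ ^ 3 * (√Λ * √Λ)) * (√d / (t * ε))) := by
          field_simp; ring
      _ = _ := by rw [hsΛ]; ring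
  have hX : 0 ≤ √κ * (D * E) * Λ ^ 4 * (1 / √t) := by positivity
  rw [mul_add (1 + Real.log t), add_div, mul_add (√κ * (D * E) * Λ ^ 4)]
  linarith

end Rates

/-! ### Assembly of the high-probability bounds into the rates. -/

section Guarantee

variable {d n : ℕ} {X : Type*} [MeasurableSpace X] {P : Measure X} [IsProbabilityMeasure P]
  {grad : (Fin d → ℝ) → X → (Fin d → ℝ)} {lmo : (Fin d → ℝ) → (Fin d → ℝ)}
  {p q : ENNReal} {K : Set (Fin d → ℝ)} {f : (Fin d → ℝ) → X → ℝ}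
  {F : (Fin d → ℝ) → ℝ} {β G L D : ℝ}

theorem IsRegularNorm.one_le {M N : (Fin d → ℝ) → ℝ} {κ : ℝ} (h : IsRegularNorm M N κ) :
    1 ≤ κ := by
  obtain ⟨-, κ₁, h1, h2, -⟩ := h
  exact h1.trans h2

theorem StochasticProblem.measure_rate (h : StochasticProblem P p q K f grad F β G L D)
    (hlmo : IsLinMinOracle K lmo) {N : (Fin d → ℝ) → ℝ} {κ ε₀ ε δ α : ℝ}
    (hreg : IsRegularNorm (ellNorm q) N κ) (hd : 1 ≤ d) (hn : 3 ≤ n) (hε : 0 < ε) (hε₀ : ε ≤ ε₀)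
    (hδ : 0 < δ) (hδ1 : δ < 1) (hα : 0 < α) (hα1 : α < 1) {θ' : Fin d → ℝ} (hθ' : θ' ∈ K) :
    ENNReal.ofReal (1 - α) ≤
      runLaw n P N (sigmaPlus n κ β D L ε δ)
        {ω | ∀ t : ℕ, 1 ≤ t → t ≤ n → F (fwIterate grad lmo ω.1 ω.2 t) - F θ' ≤
          rateConst ε₀ * (D * (β * D + G) * (√κ + √(Real.log (n / α))) / √t +
            (1 + Real.log t) * (β * D ^ 2 + D * sigmaPlus n κ β D L ε δ *
              √(d * Real.log (Real.log n / α)) * Real.log n) / t)} := by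
  have hq := h.isNormFun_q (d := d)
  have hqN : ∀ z, ellNorm q z ≤ N z := by
    obtain ⟨hNn, κ₁, -, -, -, hMN⟩ := hreg
    exact fun z => (sq_le_sq₀ (hq.nonneg z) (hNn.nonneg z)).1 (hMN z).1
  have hβ := h.beta_nonneg
  have hD := h.D_nonneg
  have hG := h.G_nonneg
  have hL := h.L_nonneg
  refine (h.measure_goodRun hlmo hreg (Real.sqrt_nonneg _) (by omega) hα hα1).trans
    (measure_mono fun ω hω t ht htn => ?_)
  exact rate_of_recursion hd hn hε hε₀ hδ hδ1 hα hα1 hreg.one_le hβ hD hG hL ht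
    (h.risk_le_of_goodRun hlmo hqN (by positivity)
      (by have : 0 ≤ sigmaPlus n κ β D L ε δ := Real.sqrt_nonneg _
          positivity) hω hθ' ht htn)

end Guarantee

theorem mainTheorem1 :
    ∀ ε₀ : ℝ, 0 < ε₀ → ∃ C : ℝ, 0 < C ∧
      ∀ (d n : ℕ) (p q : ENNReal) (X : Type*) [MeasurableSpace X] (P : Measure X)
        [IsProbabilityMeasure P]
        (K : Set (Fin d → ℝ)) (f : (Fin d → ℝ) → X → ℝ)
        (grad : (Fin d → ℝ) → X → (Fin d → ℝ)) (gradF : (Fin d → ℝ) → (Fin d → ℝ))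
        (lmo : (Fin d → ℝ) → (Fin d → ℝ)) (θstar : Fin d → ℝ)
        (β G L D ε δ α : ℝ) (F : (Fin d → ℝ) → ℝ),
        1 ≤ d → 3 ≤ n → 1 < p → p⁻¹ + q⁻¹ = 1 →
        0 < ε → ε ≤ ε₀ → 0 < δ → δ < 1 → 0 < α → α < 1 → 0 ≤ β →
        -- the constraint set
        IsCompact K → Convex ℝ K → (0 : Fin d → ℝ) ∈ K → D = ellDiam p K →
        -- the loss, the population loss and their gradients
        (∀ θ ∈ K, Integrable (f θ) P) →
        (∀ θ, F θ = ∫ x, f θ x ∂P) →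
        (∀ θ ∈ K, Measurable (grad θ)) →
        (∀ x, IsGradientOn K (fun θ => f θ x) (fun θ => grad θ x)) →
        IsGradientOn K F gradF →
        -- convexity, smoothness, bounded gradient deviation, Lipschitz loss
        ConvexOn ℝ K F →
        (∀ θ₁ ∈ K, ∀ θ₂ ∈ K, ∀ x,
          ellNorm q (grad θ₁ x - grad θ₂ x) ≤ β * ellNorm p (θ₁ - θ₂)) →
        (∀ θ ∈ K, ∀ x, ellNorm q (grad θ x - gradF θ) ≤ G) →
        (∀ θ ∈ K, ∀ x, ellNorm q (grad θ x) ≤ L) →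
        -- minimizer and linear minimization oracle
        θstar ∈ K → IsMinOn F K θstar → IsLinMinOracle K lmo →
        -- the convergence guarantee, for every regularity structure of the dual norm
        (∀ (N : (Fin d → ℝ) → ℝ) (κ : ℝ), IsRegularNorm (ellNorm q) N κ →
          ENNReal.ofReal (1 - α) ≤
            runLaw n P N (sigmaPlus n κ β D L ε δ)
              {ω | ∀ t : ℕ, 1 ≤ t → t ≤ n →
                F (fwIterate grad lmo ω.1 ω.2 t) - F θstar ≤
                  C * (D * (β * D + G) * (Real.sqrt κ + Real.sqrt (Real.log (n / α)))
                        / Real.sqrt t +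
                      (1 + Real.log t) *
                        (β * D ^ 2 + D * sigmaPlus n κ β D L ε δ *
                          Real.sqrt (d * Real.log (Real.log n / α)) * Real.log n) / t)}) ∧
        -- the specific regularity structure
        IsRegularNorm (ellNorm q) (plusNorm d p q) (kappaQ d p q) ∧
        -- the resulting rate for `1 < p ≤ 2`
        (p ≤ 2 →
          ENNReal.ofReal (1 - α) ≤
            runLaw n P (plusNorm d p q) (sigmaPlus n (kappaQ d p q) β D L ε δ)
              {ω | ∀ t : ℕ, 1 ≤ t → t ≤ n →
                F (fwIterate grad lmo ω.1 ω.2 t) - F θstar ≤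
                  C * Real.sqrt (kappaQ d p q) * (D * (β * D + G + L)) *
                    Real.log (n / (α * δ)) ^ 4 *
                    (1 / Real.sqrt t + Real.sqrt d / (t * ε))}) ∧
        -- the resulting rate for `2 < p ≤ ∞`
        (2 < p →
          ENNReal.ofReal (1 - α) ≤
            runLaw n P (plusNorm d p q) (sigmaPlus n (kappaQ d p q) β D L ε δ)
              {ω | ∀ t : ℕ, 1 ≤ t → t ≤ n →
                F (fwIterate grad lmo ω.1 ω.2 t) - F θstar ≤
                  C * (D * (β * D + G + L)) * Real.log (n / (α * δ)) ^ 4 *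
                    ((d : ℝ) ^ (1 / 2 - p⁻¹.toReal) / Real.sqrt t +
                      (d : ℝ) ^ (1 - p⁻¹.toReal) / (t * ε))}) := by
  intro ε₀ hε₀
  have hrc : 0 < rateConst ε₀ := by
    unfold rateConst
    have := log_log_three_pos
    positivity
  refine ⟨24 * rateConst ε₀, by positivity, ?_⟩
  intro d n p q X _ P _ K f grad gradF lmo θstar β G L D ε δ α F hd hn hp hpq hε hεε₀ hδ hδ1 hα
    hα1 hβ hK hKc h0 hDdef hint hF hmeas hgrad _ hconv hsm hdev hlip hstar _ hlmo
  have h : StochasticProblem P p q K f grad F β G L D :=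
    { one_lt := hp
      conj := hpq
      beta_nonneg := hβ
      convex := hKc
      zero_mem := h0
      diam := fun x hx y hy => hDdef ▸ ellNorm_sub_le_ellDiam hp.le hK hx hy
      integrable := hint
      loss := hF
      measurable := hmeas
      gradient := hgrad
      convexOn := hconv
      smooth := hsm
      deviation := fun θ hθ => ⟨gradF θ, hdev θ hθ⟩
      lipschitz := hlip }
  have hD := h.D_nonneg
  have hG := h.G_nonneg
  have hL := h.L_nonneg
  have hn' : (3 : ℝ) ≤ n := by exact_mod_cast hn
  have hreg := isRegularNorm_plusNorm hd hp hpq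
  have hmain := h.measure_rate hlmo hreg hd hn hε hεε₀ hδ hδ1 hα hα1 hstar
  have hpoly := fun (t : ℕ) (ht : 1 ≤ t) (htn : t ≤ n) => rate_le_poly_log (ε := ε) hd hn hε hδ hδ1
    hα hα1 hreg.one_le hβ hD hG hL ht htn
  refine ⟨fun N κ hN => ?_, hreg, fun _ => ?_, fun hp2 => ?_⟩
  · refine (h.measure_rate hlmo hN hd hn hε hεε₀ hδ hδ1 hα hα1 hstar).trans
      (measure_mono fun ω hω t ht htn => (hω t ht htn).trans ?_)
    rw [mul_assoc 24]
    refine le_mul_of_one_le_left (mul_nonneg hrc.le (add_nonneg ?_ ?_)) (by norm_num)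
    · positivity
    · have h1 : 0 ≤ Real.log t := Real.log_nonneg (by exact_mod_cast ht)
      have h2 : 0 ≤ Real.log n := Real.log_nonneg (by linarith)
      have h3 : 0 ≤ sigmaPlus n κ β D L ε δ := Real.sqrt_nonneg _
      positivity
  · refine hmain.trans (measure_mono fun ω hω t ht htn => (hω t ht htn).trans ?_)
    refine (mul_le_mul_of_nonneg_left (hpoly t ht htn) hrc.le).trans_eq ?_
    ring
  · refine hmain.trans (measure_mono fun ω hω t ht htn => (hω t ht htn).trans ?_)
    refine (mul_le_mul_of_nonneg_left (hpoly t ht htn) hrc.le).trans_eq ?_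
    have hd0 : (0 : ℝ) < d := by exact_mod_cast hd
    -- Here `√κ_q` is the dimension factor of the `1/√t` term, and its product with `√d` gives that
    -- of the noise term. Writing `1/p` as `p⁻¹.toReal` covers `p = ∞` with value `0`.
    have e1 : √(kappaQ d p q) = (d : ℝ) ^ (1 / 2 - p⁻¹.toReal) := by
      rw [kappaQ, if_neg hp2.not_ge, Real.sqrt_eq_rpow, ← Real.rpow_mul hd0.le]
      congr 1; ring
    have e2 : (d : ℝ) ^ (1 - p⁻¹.toReal) = (d : ℝ) ^ (1 / 2 - p⁻¹.toReal) * √d := by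
      rw [Real.sqrt_eq_rpow, ← Real.rpow_add hd0]
      congr 1; ring
    rw [e1, e2]
    ring
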